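/- Let $d\ge 2$. For $1\le j\le d$ let $I_j\subset\mathbb S^1$ be the closed counter-clockwise arc from $e^{\pi i(j-1)/d}$ to $e^{\pi i j/d}$, let $I_{-j}$ be its complex conjugate, and let $C_j$ be the hyperbolic geodesic of the unit disc $\mathbb D$ with the same endpoints as $I_j$. Let $g_j$ be the Möbius automorphism of $\mathbb D$ given by reflection in $C_j$ followed by complex conjugation, let $g_{-j}:=g_j^{-1}$, and let $G_d=\langle g_1,\dots,g_d\rangle$. The Bowen–Series map $A=A_{G_d}:\mathbb S^1\to\mathbb S^1$ is given by $A|_{I_{i}}=g_{i}$ for $i\in\{\pm1,\dots,\pm d\}$. Let $$\Sigma=\{(i_1,i_2,\dots)\in\{\pm1,\dots,\pm d\}^{\mathbb N}: i_{k+1}\neq -i_k \text{ for all } k\}$$ with the product topology and the left shift $\sigma$. The Parry measure on $\Sigma$ is the Borel probability measure giving mass $\frac1{2d(2d-1)^{n}}$ to each non-empty cylinder set of rank $n+1$, $n\ge0$. Let $X$ be the Cayley tree of the free group $F_d=\langle a_1,\dots,a_d\rangle$ with respect to the standard generators, $|\cdot|$ the word length, and $\partial X$ its Gromov boundary; put $a_{-j}:=a_j^{-1}$.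 Identify $\Sigma$ with $\partial X$ by sending $(i_1,i_2,\dots)$ to the endpoint of the geodesic ray through the vertices $1, a_{i_1}^{-1}, a_{i_1}^{-1}a_{i_2}^{-1},\dots$. A Patterson–Sullivan measure on $\partial X$ (base point $1$, standard generators) is a probability measure that is the weak limit on $X\cup\partial X$ of $\big(\sum_{g} e^{-s_k|g|}\delta_g\big)/\sum_{g} e^{-s_k|g|}$ for some sequence $s_k>\delta$ with $s_k\to\delta$, where $\delta$ is the critical exponent of $\sum_{g\in F_d}e^{-s|g|}$. The (Floyd–)Cannon–Thurston map is the map $\psi:\partial X\to\mathbb S^1$ such that the orbit map $F_d\to\mathbb D$, $a_j\mapsto g_j$, $g\mapsto g\cdot 0$, together with $\psi$, is continuous on $F_d\cup\partial X$. A measure of maximal entropy of $A$ is an $A$-invariant Borel probability measure on $\mathbb S^1$ whose Kolmogorov–Sinai entropy equals the topological entropy of $A$. Then: 1. $A$ has exactly one measure of maximal entropy $\nu$; there is exactly one Patterson–Sullivan measure $\mu$ on $\partial X$; the Cannon–Thurston map $\psi$ exists and is unique; and the identification $\Sigma\to\partial X$ is a homeomorphism. 2. $\nu=\psi_*\mu$.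 3. $\mu$ is also the weak limit, as $n\to\infty$, of the measures $$\mu_n=\frac{\delta_1+\sum_{j=1}^n (2d-1)^{-j}\sum_{|g|=j}\delta_g}{1+\frac{2dn}{2d-1}},$$ and under the identification $\partial X\cong\Sigma$ it is the Parry measure. 4. Under the same identification, $\psi$ is the unique continuous surjection $\Sigma\to\mathbb S^1$ that semi-conjugates $\sigma$ to $A$ and maps each cylinder $[i]=\{i_1=i\}$ onto $I_i$, $i\in\{\pm1,\dots,\pm d\}$. -/

import Mathlib

open MeasureTheory Filter Topology Set
open scoped BoundedContinuousFunction ENNReal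

noncomputable section

/-! ## Measure-theoretic entropy and measures of maximal entropy -/

/-- Shannon entropy of the finite measurable partition `{f⁻¹(i)}` given by a labelling `f`. -/
def partitionEntropy {X ι : Type*} [MeasurableSpace X] [Fintype ι] (μ : Measure X) (f : X → ι) :
    ℝ :=
  ∑ i, Real.negMulLog (μ.real (f ⁻¹' {i}))

/-- The labelling of the join `⋁_{i<n} T⁻ⁱ ξ` of the partition `ξ` labelled by `f`. -/
def itinerary {X ι : Type*} (T : X → X) (f : X → ι) (n : ℕ) (x : X) : Fin n → ι :=
  fun i => f (T^[i] x)

/-- Entropy of `T` relative to the finite partition labelled by `f` (the `limsup` is a limit for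
invariant probability measures, by subadditivity). -/
def entropyOfPartition {X ι : Type*} [MeasurableSpace X] [Fintype ι] (μ : Measure X) (T : X → X)
    (f : X → ι) : EReal :=
  limsup (fun n : ℕ => ((partitionEntropy μ (itinerary T f n) / n : ℝ) : EReal)) atTop

/-- Kolmogorov–Sinai entropy: supremum over all finite measurable partitions. -/
def ksEntropy {X : Type*} [MeasurableSpace X] (μ : Measure X) (T : X → X) : EReal :=
  ⨆ (k : ℕ) (f : X → Fin k) (_ : Measurable f), entropyOfPartition μ T f

/-- `ν` is an invariant probability measure whose entropy is the topological entropy. -/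
structure IsMeasureOfMaximalEntropy {X : Type*} [UniformSpace X] [MeasurableSpace X]
    (T : X → X) (ν : Measure X) : Prop where
  isProbabilityMeasure : IsProbabilityMeasure ν
  measurePreserving : MeasurePreserving T ν ν
  entropy_eq : ksEntropy ν T = Dynamics.coverEntropy T univ

instance : MeasurableSpace Circle := borel Circle
instance : BorelSpace Circle := ⟨rfl⟩

namespace BowenSeries

/-! ## The group `G_d` and its Bowen–Series map

Indices are shifted by one: `j : Fin d` stands for the index `j + 1 ∈ {1, …, d}`. -/

/-- The `2d`-th roots of unity on the upper half circle: `vertex d j = exp (π i j / d)`. -/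
def vertex (d j : ℕ) : Circle := Circle.exp (Real.pi * j / d)

/-- Centre of the Euclidean circle containing the hyperbolic geodesic from `vertex d j` to
`vertex d (j + 1)`. -/
def geodesicCenter (d j : ℕ) : ℂ :=
  (Circle.exp (Real.pi * (2 * j + 1) / (2 * d)) : ℂ) / (Real.cos (Real.pi / (2 * d)) : ℂ)

/-- Radius of that circle. -/
def geodesicRadius (d : ℕ) : ℝ := Real.tan (Real.pi / (2 * d))

lemma angle_mem {d : ℕ} (hd : 2 ≤ d) :
    0 < Real.pi / (2 * d) ∧ Real.pi / (2 * d) < Real.pi / 2 := by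
  have h2 : (2 : ℝ) ≤ d := by exact_mod_cast hd
  have := Real.pi_pos
  refine ⟨by positivity, ?_⟩
  rw [div_lt_div_iff₀ (by positivity) (by norm_num)]
  nlinarith

lemma cos_angle_pos {d : ℕ} (hd : 2 ≤ d) : 0 < Real.cos (Real.pi / (2 * d)) := by
  have h := angle_mem hd
  exact Real.cos_pos_of_mem_Ioo ⟨by linarith [Real.pi_pos], h.2⟩

lemma geodesicRadius_pos {d : ℕ} (hd : 2 ≤ d) : 0 < geodesicRadius d :=
  Real.tan_pos_of_pos_of_lt_pi_div_two (angle_mem hd).1 (angle_mem hd).2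

/-- The circle is orthogonal to the unit circle. -/
lemma normSq_geodesicCenter {d : ℕ} (hd : 2 ≤ d) (j : ℕ) :
    ‖geodesicCenter d j‖ ^ 2 = 1 + geodesicRadius d ^ 2 := by
  have h := cos_angle_pos hd
  rw [geodesicCenter, norm_div, Circle.norm_coe, geodesicRadius, Complex.norm_real,
    Real.norm_eq_abs, abs_of_pos h, Real.tan_eq_sin_div_cos]
  have := Real.sin_sq_add_cos_sq (Real.pi / (2 * d))
  field_simp
  linarith

lemma norm_inversion {c z : ℂ} {R : ℝ} (hc : ‖c‖ ^ 2 = 1 + R ^ 2) (hz : z ≠ c) :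
    ‖EuclideanGeometry.inversion c R z‖ ^ 2 - 1 = (R / dist z c) ^ 2 * (‖z‖ ^ 2 - 1) := by
  have hzc : dist z c ≠ 0 := dist_ne_zero.2 hz
  have e1 : EuclideanGeometry.inversion c R z
      = (((R / dist z c) ^ 2 : ℝ) : ℂ) * (z - c) + c := by
    simp [EuclideanGeometry.inversion]
  set k : ℝ := (R / dist z c) ^ 2 with hk
  have hkd : k * dist z c ^ 2 = R ^ 2 := by rw [hk]; field_simp
  rw [e1]
  rw [Complex.dist_eq] at hkd
  rw [← Complex.normSq_eq_norm_sq, Complex.normSq_apply] at hc hkd ⊢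
  rw [← Complex.normSq_eq_norm_sq, Complex.normSq_apply]
  simp only [Complex.add_re, Complex.mul_re, Complex.ofReal_re, Complex.ofReal_im, Complex.sub_re,
    Complex.sub_im, Complex.add_im, Complex.mul_im, zero_mul, sub_zero, add_zero] at *
  linear_combination (k - 1) * hkd + (1 - k) * hc

/-- The closed unit disc. -/
abbrev ClosedDisc : Type := Metric.closedBall (0 : ℂ) 1

lemma ne_geodesicCenter {d : ℕ} (hd : 2 ≤ d) (j : ℕ) {z : ℂ} (hz : ‖z‖ ≤ 1) :
    z ≠ geodesicCenter d j := by
  rintro rfl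
  have h1 := normSq_geodesicCenter hd j
  have h2 := geodesicRadius_pos hd
  nlinarith [norm_nonneg (geodesicCenter d j)]

/-- Hyperbolic reflection in the geodesic from `vertex d j` to `vertex d (j + 1)`, acting on the
closed unit disc. -/
def reflection {d : ℕ} (hd : 2 ≤ d) (j : ℕ) : Equiv.Perm ClosedDisc :=
  Function.Involutive.toPerm
    (fun z => ⟨EuclideanGeometry.inversion (geodesicCenter d j) (geodesicRadius d) z, by
      have hz : ‖(z : ℂ)‖ ≤ 1 := mem_closedBall_zero_iff.1 z.2
      have h := norm_inversion (normSq_geodesicCenter hd j) (ne_geodesicCenter hd j hz)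
      have h3 : ‖(z : ℂ)‖ ^ 2 - 1 ≤ 0 := by nlinarith [norm_nonneg (z : ℂ)]
      rw [mem_closedBall_zero_iff]
      have h4 := mul_nonpos_of_nonneg_of_nonpos
        (sq_nonneg (geodesicRadius d / dist (z : ℂ) (geodesicCenter d j))) h3
      rw [← h] at h4
      exact (sq_le_one_iff₀ (norm_nonneg _)).1 (by linarith)⟩)
    (fun z => Subtype.ext
      (EuclideanGeometry.inversion_inversion _ (geodesicRadius_pos hd).ne' (z : ℂ)))

/-- Complex conjugation on the closed unit disc. -/
def conjugation : Equiv.Perm ClosedDisc :=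
  Function.Involutive.toPerm
    (fun z => ⟨starRingEnd ℂ z, by
      rw [mem_closedBall_zero_iff, RCLike.norm_conj]; exact mem_closedBall_zero_iff.1 z.2⟩)
    (fun z => Subtype.ext (Complex.conj_conj (z : ℂ)))

/-- The Möbius generator `g_{j+1}`: reflection in the geodesic followed by conjugation. -/
def generator {d : ℕ} (hd : 2 ≤ d) (j : Fin d) : Equiv.Perm ClosedDisc :=
  conjugation * reflection hd j

/-- The marking `F_d → G_d` sending the free generators to the Möbius generators; its range is
the group `G_d = ⟨g_1, …, g_d⟩`. -/
def marking {d : ℕ} (hd : 2 ≤ d) : FreeGroup (Fin d) →* Equiv.Perm ClosedDisc :=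
  FreeGroup.lift (generator hd)

/-- The symbols `±1, …, ±d`: the symbol `(j, true)` is `j + 1`, and `(j, false)` is `-(j + 1)`. -/
abbrev Letter (d : ℕ) : Type := Fin d × Bool

/-- The symbol `-a`. -/
def Letter.neg {d : ℕ} (a : Letter d) : Letter d := (a.1, !a.2)

/-- The pieces `g_j^{±1}`. -/
def piece {d : ℕ} (hd : 2 ≤ d) (a : Letter d) : Equiv.Perm ClosedDisc :=
  if a.2 then generator hd a.1 else (generator hd a.1)⁻¹

/-- The closed arcs `I_{±j}`. -/
def arc {d : ℕ} (a : Letter d) : Set Circle :=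
  (fun t : ℝ => Circle.exp (if a.2 then t else -t)) ''
    Icc (Real.pi * (a.1 : ℕ) / d) (Real.pi * ((a.1 : ℕ) + 1) / d)

/-- The inclusion of the circle in the closed disc. -/
def circleToDisc (x : Circle) : ClosedDisc :=
  ⟨x, mem_closedBall_zero_iff.2 x.norm_coe.le⟩

lemma norm_reflection {d : ℕ} (hd : 2 ≤ d) (j : ℕ) (z : ClosedDisc) (hz : ‖(z : ℂ)‖ = 1) :
    ‖(reflection hd j z : ℂ)‖ = 1 := by
  have h := norm_inversion (normSq_geodesicCenter hd j) (ne_geodesicCenter hd j hz.le)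
  rw [hz] at h
  have h2 : ‖(reflection hd j z : ℂ)‖ ^ 2 = 1 := by
    change ‖EuclideanGeometry.inversion (geodesicCenter d j) (geodesicRadius d) (z : ℂ)‖ ^ 2 = 1
    linarith
  exact (pow_eq_one_iff_of_nonneg (norm_nonneg _) two_ne_zero).1 h2

lemma norm_conjugation (z : ClosedDisc) : ‖(conjugation z : ℂ)‖ = ‖(z : ℂ)‖ :=
  RCLike.norm_conj (z : ℂ)

lemma piece_true {d : ℕ} (hd : 2 ≤ d) (j : Fin d) (z : ClosedDisc) :
    piece hd (j, true) z = conjugation (reflection hd j z) := rfl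

lemma piece_false {d : ℕ} (hd : 2 ≤ d) (j : Fin d) (z : ClosedDisc) :
    piece hd (j, false) z = reflection hd j (conjugation z) := rfl

lemma norm_piece {d : ℕ} (hd : 2 ≤ d) (a : Letter d) (z : ClosedDisc) (hz : ‖(z : ℂ)‖ = 1) :
    ‖(piece hd a z : ℂ)‖ = 1 := by
  obtain ⟨j, _ | _⟩ := a
  · rw [piece_false]
    exact norm_reflection hd j _ ((norm_conjugation z).trans hz)
  · rw [piece_true, norm_conjugation]
    exact norm_reflection hd j _ hz

/-- The label of an arc containing `x` (a choice is made at the common endpoints; it does not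
matter for the Bowen–Series map, see `bowenSeries_eq_piece`). -/
def arcLabel {d : ℕ} (hd : 2 ≤ d) (x : Circle) : Letter d :=
  (⟨min ⌊(d : ℝ) * |Complex.arg x| / Real.pi⌋₊ (d - 1), by omega⟩, decide (0 ≤ Complex.arg x))

/-- The Bowen–Series map `A_{G_d}` associated with the ideal polygon with vertices at the `2d`-th
roots of unity: it acts by `g_j^{±1}` on `I_{±j}`. -/
def bowenSeries {d : ℕ} (hd : 2 ≤ d) (x : Circle) : Circle :=
  ⟨(piece hd (arcLabel hd x) (circleToDisc x) : ℂ),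
    mem_sphere_zero_iff_norm.2 (norm_piece hd _ _ x.norm_coe)⟩

lemma coe_bowenSeries {d : ℕ} (hd : 2 ≤ d) (x : Circle) :
    circleToDisc (bowenSeries hd x) = piece hd (arcLabel hd x) (circleToDisc x) := rfl

lemma dist_vertex {d : ℕ} (hd : 2 ≤ d) (j : ℕ) (u : ℝ)
    (hu : u = Real.pi * j / d ∨ u = Real.pi * (j + 1) / d) :
    dist (Circle.exp u : ℂ) (geodesicCenter d j) = geodesicRadius d := by
  have hc := cos_angle_pos hd
  have hd0 : (d : ℝ) ≠ 0 := by positivity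
  set δ := Real.pi / (2 * d) with hδ
  set w : ℂ := (Circle.exp (Real.pi * (2 * j + 1) / (2 * d)) : ℂ) with hw
  have hw1 : ‖w‖ = 1 := Circle.norm_coe _
  obtain ⟨e, he, huw⟩ : ∃ e : ℝ, (e = δ ∨ e = -δ) ∧
      (Circle.exp u : ℂ) = w * (Circle.exp e : ℂ) := by
    rcases hu with hu | hu
    · refine ⟨-δ, Or.inr rfl, ?_⟩
      rw [hw, ← Circle.coe_mul, ← Circle.exp_add, hu, hδ]
      congr 2
      field_simp
      ring
    · refine ⟨δ, Or.inl rfl, ?_⟩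
      rw [hw, ← Circle.coe_mul, ← Circle.exp_add, hu, hδ]
      congr 2
      field_simp
      ring
  have hce : Real.cos e = Real.cos δ := by rcases he with rfl | rfl <;> simp
  have hse : Real.sin e ^ 2 = Real.sin δ ^ 2 := by rcases he with rfl | rfl <;> simp
  have key : (Circle.exp u : ℂ) - geodesicCenter d j
      = w * ((Circle.exp e : ℂ) - ((Real.cos δ)⁻¹ : ℝ)) := by
    rw [huw, geodesicCenter, ← hw, ← hδ]
    push_cast
    ring
  rw [Complex.dist_eq, key, norm_mul, hw1, one_mul]
  rw [← sq_eq_sq₀ (norm_nonneg _) (geodesicRadius_pos hd).le, ← Complex.normSq_eq_norm_sq,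
    Complex.normSq_apply, geodesicRadius, ← hδ, Real.tan_eq_sin_div_cos, Circle.coe_exp]
  simp only [Complex.sub_re, Complex.exp_ofReal_mul_I_re, Complex.ofReal_re, Complex.sub_im,
    Complex.exp_ofReal_mul_I_im, Complex.ofReal_im, sub_zero]
  have h1 := Real.sin_sq_add_cos_sq δ
  rw [hce, ← sq, ← sq, hse]
  field_simp
  nlinarith

lemma reflection_vertex {d : ℕ} (hd : 2 ≤ d) (j : ℕ) (u : ℝ)
    (hu : u = Real.pi * j / d ∨ u = Real.pi * (j + 1) / d) :
    reflection hd j (circleToDisc (Circle.exp u)) = circleToDisc (Circle.exp u) :=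
  Subtype.ext (EuclideanGeometry.inversion_of_mem_sphere (dist_vertex hd j u hu))

lemma conjugation_toDisc (x : Circle) : conjugation (circleToDisc x) = circleToDisc x⁻¹ :=
  Subtype.ext (Circle.coe_inv_eq_conj x).symm

lemma piece_vertex {d : ℕ} (hd : 2 ≤ d) (a : Letter d) (u : ℝ)
    (hu : u = Real.pi * (a.1 : ℕ) / d ∨ u = Real.pi * ((a.1 : ℕ) + 1) / d) (x : Circle)
    (hx : x = Circle.exp (if a.2 then u else -u)) :
    piece hd a (circleToDisc x) = circleToDisc x⁻¹ := by
  obtain ⟨j, _ | _⟩ := a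
  · simp only [Bool.false_eq_true, if_false, Circle.exp_neg] at hx
    rw [piece_false, conjugation_toDisc, hx, inv_inv]
    exact reflection_vertex hd j u hu
  · simp only [if_true] at hx
    rw [piece_true, hx, reflection_vertex hd j u hu, conjugation_toDisc]

/-- The Bowen–Series map acts on the closed arc `I_{±j}` by `g_j^{±1}`. -/
theorem bowenSeries_eq_piece {d : ℕ} (hd : 2 ≤ d) (a : Letter d) (x : Circle) (hx : x ∈ arc a) :
    (bowenSeries hd x : ℂ) = piece hd a (circleToDisc x) := by
  have hπ := Real.pi_pos
  have hd0 : (0 : ℝ) < d := by positivity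
  suffices h : piece hd (arcLabel hd x) (circleToDisc x) = piece hd a (circleToDisc x) by
    rw [← h]; rfl
  obtain ⟨t, ⟨ht1, ht2⟩, hxt⟩ := hx
  simp only at hxt
  rw [div_le_iff₀ hd0] at ht1
  rw [le_div_iff₀ hd0] at ht2
  have hj : ((a.1 : ℕ) : ℝ) + 1 ≤ d := by exact_mod_cast a.1.2
  have ht0 : 0 ≤ t := by
    have : (0 : ℝ) ≤ (a.1 : ℕ) := by positivity
    by_contra h
    nlinarith
  have htπ : t ≤ Real.pi := by
    by_contra h
    nlinarith
  have harg : |Complex.arg x| = t := by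
    rw [← hxt]
    split_ifs with h
    · rw [Circle.arg_exp (by linarith) htπ, abs_of_nonneg ht0]
    · rcases htπ.eq_or_lt with h | h
      · rw [h, show Circle.exp (-Real.pi) = Circle.exp Real.pi by
          rw [Circle.exp_neg]; ext; simp, Circle.arg_exp (by linarith) le_rfl, abs_of_pos hπ]
      · rw [Circle.arg_exp (by linarith) (by linarith), abs_neg, abs_of_nonneg ht0]
  set b := arcLabel hd x with hb
  have hxb : x = Circle.exp (if b.2 then t else -t) := by
    have h2 : b.2 = decide (0 ≤ Complex.arg x) := rfl
    rw [h2, ← harg]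
    by_cases h : 0 ≤ Complex.arg x
    · simp [h, abs_of_nonneg h]
    · simp [h, abs_of_neg (not_le.1 h)]
  have hb1 : ((b.1 : ℕ)) = min ⌊(d : ℝ) * t / Real.pi⌋₊ (d - 1) := by rw [← harg]; rfl
  have hidx : (b.1 : ℕ) = a.1 ∨ ((b.1 : ℕ) = a.1 + 1 ∧ t * d = Real.pi * ((a.1 : ℕ) + 1)) := by
    have hf1 : (a.1 : ℕ) ≤ ⌊(d : ℝ) * t / Real.pi⌋₊ := by
      rw [Nat.le_floor_iff (by positivity), le_div_iff₀ hπ]; linarith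
    have haj : (a.1 : ℕ) ≤ d - 1 := by have := a.1.2; omega
    rcases ht2.eq_or_lt with h | h
    · have hf2 : ⌊(d : ℝ) * t / Real.pi⌋₊ = a.1 + 1 := by
        rw [mul_comm, h, mul_comm, mul_div_assoc, div_self hπ.ne', mul_one]
        exact_mod_cast Nat.floor_natCast ((a.1 : ℕ) + 1)
      rw [hf2] at hb1
      by_cases h' : (a.1 : ℕ) + 1 ≤ d - 1
      · right; exact ⟨by omega, h⟩
      · left; omega
    · have hf2 : ⌊(d : ℝ) * t / Real.pi⌋₊ < a.1 + 1 := by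
        rw [Nat.floor_lt (by positivity), div_lt_iff₀ hπ]; push_cast; linarith
      left; omega
  rcases hidx with hidx | ⟨hidx, hte⟩
  · by_cases hs : b.2 = a.2
    · rw [Prod.ext (Fin.ext hidx) hs]
    · have hsin : Circle.exp t = Circle.exp (-t) := by
        have h3 := hxt.trans hxb
        cases ha2 : a.2 <;> cases hb2 : b.2 <;>
          simp only [ha2, hb2, if_true, Bool.false_eq_true, if_false] at h3 <;>
          first
          | exact absurd (hb2.trans ha2.symm) hs
          | exact h3
          | exact h3.symm
      have ht' : t = 0 ∨ t = Real.pi := by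
        have h4 : Real.sin t = 0 := by
          have h5 := congrArg (fun z : Circle => (z : ℂ).im) hsin
          simp only [Circle.coe_exp, Complex.exp_ofReal_mul_I_im, Real.sin_neg] at h5
          linarith
        rcases htπ.eq_or_lt with h | h
        · exact Or.inr h
        · exact Or.inl ((Real.sin_eq_zero_iff_of_lt_of_lt (by linarith) h).1 h4)
      have hu : t = Real.pi * (a.1 : ℕ) / d ∨ t = Real.pi * ((a.1 : ℕ) + 1) / d := by
        rcases ht' with h | h
        · left
          rw [eq_div_iff hd0.ne']
          have : (0 : ℝ) ≤ Real.pi * (a.1 : ℕ) := by positivity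
          rw [h] at ht1 ⊢
          linarith
        · right
          rw [eq_div_iff hd0.ne']
          rw [h] at ht2 ⊢
          nlinarith
      rw [piece_vertex hd a t hu x hxt.symm,
        piece_vertex hd b t (by rw [hidx]; exact hu) x hxb]
  · rw [piece_vertex hd a t (Or.inr (by rw [eq_div_iff hd0.ne']; exact hte)) x hxt.symm,
      piece_vertex hd b t (Or.inl (by
        rw [eq_div_iff hd0.ne', hidx]; push_cast; exact hte)) x hxb]

/-! ## The subshift of finite type and its Parry measure -/

/-- The transition matrix of the Markov partition `{I_{±j}}`: all entries are `1`, except those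
in position `(a, -a)`, which are `0`. -/
def transitionMatrix (d : ℕ) : Matrix (Letter d) (Letter d) ℕ :=
  fun a b => if b = a.neg then 0 else 1

/-- The one-sided subshift `Σ_M⁺` of admissible infinite words. -/
def ShiftSpace (d : ℕ) : Type :=
  {ω : ℕ → Letter d // ∀ k, transitionMatrix d (ω k) (ω (k + 1)) = 1}

instance (d : ℕ) : TopologicalSpace (ShiftSpace d) := instTopologicalSpaceSubtype
instance (d : ℕ) : MeasurableSpace (ShiftSpace d) := borel _
instance (d : ℕ) : BorelSpace (ShiftSpace d) := ⟨rfl⟩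

/-- The left shift `σ`. -/
def shift {d : ℕ} (ω : ShiftSpace d) : ShiftSpace d :=
  ⟨fun k => ω.1 (k + 1), fun k => ω.2 (k + 1)⟩

/-- The cylinder set of rank `n` containing `ω`. -/
def cylinder {d : ℕ} (ω : ShiftSpace d) (n : ℕ) : Set (ShiftSpace d) :=
  {η | ∀ k < n, η.1 k = ω.1 k}

/-- The Parry measure: the uniform Markov measure, giving mass `1 / (2d (2d-1)ⁿ)` to each
(non-empty) cylinder set of rank `n + 1`. -/
structure IsParryMeasure {d : ℕ} (P : Measure (ShiftSpace d)) : Prop where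
  isProbabilityMeasure : IsProbabilityMeasure P
  measure_cylinder : ∀ (ω : ShiftSpace d) (n : ℕ),
    P (cylinder ω (n + 1)) = ENNReal.ofReal (1 / (2 * d * (2 * d - 1) ^ n))

/-- `ψ : Σ_M⁺ → S¹` is a continuous surjection which semi-conjugates the shift to the
Bowen–Series map and carries each rank one cylinder `[±j]` onto `I_{±j}`. -/
structure IsSymbolicCoding {d : ℕ} (hd : 2 ≤ d) (ψ : ShiftSpace d → Circle) : Prop where
  continuous : Continuous ψ
  surjective : Function.Surjective ψ
  semiconj : Function.Semiconj ψ shift (bowenSeries hd)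
  image_cylinder : ∀ a : Letter d, ψ '' {ω | ω.1 0 = a} = arc a

/-! ## The Cayley tree of `F_d`, its Gromov boundary and compactification -/

instance (d : ℕ) : TopologicalSpace (FreeGroup (Fin d)) := ⊥
instance (d : ℕ) : DiscreteTopology (FreeGroup (Fin d)) := ⟨rfl⟩

/-- Word metric of `F_d` with respect to the standard generators. -/
def wordDist {d : ℕ} (g h : FreeGroup (Fin d)) : ℕ := (g⁻¹ * h).norm

/-- `c` is a geodesic of length `R ∈ [0, ∞]` in the Cayley tree that starts at the base point `1`,
continued by a constant after time `R`. -/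
structure IsGeneralizedRay {d : ℕ} (c : ℕ → FreeGroup (Fin d)) (R : ℕ∞) : Prop where
  base : c 0 = 1
  geodesic : ∀ m k : ℕ, ((m + k : ℕ) : ℕ∞) ≤ R → wordDist (c m) (c (m + k)) = k
  constant : ∀ m k : ℕ, R ≤ (m : ℕ∞) → c (m + k) = c m

/-- The Gromov boundary `∂X` of the Cayley tree `X`: geodesic rays issuing from `1`, with the
topology of pointwise convergence. As `X` is a tree, distinct geodesic rays from `1` are not
asymptotic, so that each boundary point is represented by exactly one such ray. -/
def Boundary (d : ℕ) : Type := {c : ℕ → FreeGroup (Fin d) // IsGeneralizedRay c ⊤}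

/-- The compactification `X ∪ ∂X` (vertices and boundary points): generalized rays issuing
from `1`, with the topology of pointwise convergence. A vertex `g` corresponds to the geodesic
from `1` to `g`. -/
def Compactification (d : ℕ) : Type :=
  {c : ℕ → FreeGroup (Fin d) // ∃ R, IsGeneralizedRay c R}

instance (d : ℕ) : TopologicalSpace (Boundary d) := instTopologicalSpaceSubtype
instance (d : ℕ) : MeasurableSpace (Boundary d) := borel _
instance (d : ℕ) : BorelSpace (Boundary d) := ⟨rfl⟩
instance (d : ℕ) : TopologicalSpace (Compactification d) := instTopologicalSpaceSubtype
instance (d : ℕ) : MeasurableSpace (Compactification d) := borel _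
instance (d : ℕ) : BorelSpace (Compactification d) := ⟨rfl⟩

lemma wordDist_mk_take {d : ℕ} (L : List (Letter d)) (hL : FreeGroup.IsReduced L) (m k : ℕ)
    (h : m + k ≤ L.length) :
    wordDist (FreeGroup.mk (L.take m)) (FreeGroup.mk (L.take (m + k))) = k := by
  have h1 : L.take (m + k) = L.take m ++ (L.drop m).take k := List.take_add
  have h2 : FreeGroup.IsReduced ((L.drop m).take k) :=
    hL.infix ((List.take_prefix _ _).isInfix.trans (List.drop_suffix _ _).isInfix)
  rw [wordDist, h1, ← FreeGroup.mul_mk, inv_mul_cancel_left, FreeGroup.norm, FreeGroup.toWord_mk,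
    h2.reduce_eq, List.length_take, List.length_drop]
  omega

/-- The inclusion of the vertex set `F_d` of `X` in `X ∪ ∂X`. -/
def ofVertex {d : ℕ} (g : FreeGroup (Fin d)) : Compactification d :=
  ⟨fun n => FreeGroup.mk (g.toWord.take n), g.norm,
    by simp [FreeGroup.one_eq_mk],
    fun m k h => wordDist_mk_take _ FreeGroup.isReduced_toWord m k (by exact_mod_cast h),
    fun m k h => by
      have h' : g.toWord.length ≤ m := by exact_mod_cast h
      rw [List.take_of_length_le h', List.take_of_length_le (by omega)]⟩

/-- The inclusion of `∂X` in `X ∪ ∂X`. -/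
def ofBoundary {d : ℕ} (ξ : Boundary d) : Compactification d := ⟨ξ.1, ⊤, ξ.2⟩

/-- The prefix of length `n` of the infinite reduced word `i₁⁻¹ i₂⁻¹ i₃⁻¹ ⋯` in the free
generators and their inverses. -/
def inversePrefix {d : ℕ} (ω : ShiftSpace d) (n : ℕ) : List (Letter d) :=
  (List.range n).map fun k => (ω.1 k).neg

lemma isReduced_inversePrefix {d : ℕ} (ω : ShiftSpace d) (n : ℕ) :
    FreeGroup.IsReduced (inversePrefix ω n) := by
  rw [FreeGroup.IsReduced, inversePrefix, List.isChain_map]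
  rw [List.isChain_iff_getElem]
  intro i hi
  simp only [List.getElem_range, Letter.neg]
  intro h
  have h2 := ω.2 i
  by_contra hne
  have : ω.1 (i + 1) = (ω.1 i).neg := by
    refine Prod.ext h.symm ?_
    revert hne
    simp only [Letter.neg]
    cases (ω.1 i).2 <;> cases (ω.1 (i + 1)).2 <;> simp
  rw [transitionMatrix, if_pos this] at h2
  exact zero_ne_one h2

lemma take_inversePrefix {d : ℕ} (ω : ShiftSpace d) (m k : ℕ) :
    (inversePrefix ω (m + k)).take m = inversePrefix ω m := by
  rw [inversePrefix, ← List.map_take, List.take_range, Nat.min_eq_left (by omega)]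
  rfl

/-- The identification `Σ_M⁺ ≅ ∂X`. A point of the circle with itinerary `(i₁, i₂, …)` lies behind
the tiles `g_{i₁}⁻¹ ⋯ g_{iₙ}⁻¹ R` of the tessellation, so the word `(i₁, i₂, …)` is sent to the
geodesic ray through the vertices `i₁⁻¹ ⋯ iₙ⁻¹`. -/
def toBoundary {d : ℕ} (ω : ShiftSpace d) : Boundary d :=
  ⟨fun n => FreeGroup.mk (inversePrefix ω n), by simp [inversePrefix, FreeGroup.one_eq_mk],
    fun m k _ => by
      have h := wordDist_mk_take _ (isReduced_inversePrefix ω (m + k)) m k (by simp [inversePrefix])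
      rwa [take_inversePrefix, List.take_of_length_le (by simp [inversePrefix])] at h,
    fun m k h => absurd h (by simp)⟩

/-- `ψ` is the (Floyd–)Cannon–Thurston map: the orbit map `g ↦ g · 0` from the vertex set of the
Cayley tree to the disc, together with `ψ` on `∂X`, is continuous on `X ∪ ∂X`. -/
def IsCannonThurston {d : ℕ} (hd : 2 ≤ d) (ψ : Boundary d → Circle) : Prop :=
  ∃ Φ : Compactification d → ClosedDisc, Continuous Φ ∧
    (∀ g, Φ (ofVertex g) = marking hd g ⟨0, by simp⟩) ∧
    ∀ ξ, Φ (ofBoundary ξ) = circleToDisc (ψ ξ)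

/-! ## Patterson–Sullivan measures -/

/-- The normalized orbit measure `(∑ w(|g|) δ_g) / ∑ w(|g|)` for a weight depending only on the
distance to the base point `1`. -/
def orbitMeasure (d : ℕ) (w : ℕ → ℝ) : Measure (Compactification d) :=
  (∑' g : FreeGroup (Fin d), ENNReal.ofReal (w g.norm))⁻¹ •
    Measure.sum fun g : FreeGroup (Fin d) => ENNReal.ofReal (w g.norm) • Measure.dirac (ofVertex g)

/-- The measures `m k` on `X ∪ ∂X` converge weakly to the measure `μ` on `∂X`. -/
def TendstoWeakly {d : ℕ} (m : ℕ → Measure (Compactification d)) (μ : Measure (Boundary d)) :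
    Prop :=
  ∀ f : Compactification d →ᵇ ℝ,
    Tendsto (fun k => ∫ x, f x ∂(m k)) atTop (𝓝 (∫ x, f x ∂(μ.map ofBoundary)))

/-- The critical exponent of the Poincaré series `∑ exp (-s |g|)` of `F_d`. -/
def criticalExponent (d : ℕ) : ℝ :=
  sInf {s : ℝ | Summable fun g : FreeGroup (Fin d) => Real.exp (-s * g.norm)}

/-- `μ` is a Patterson–Sullivan measure on `∂X` (base point `1`, standard generators): a weak
limit of the normalized orbit measures with weights `exp (-s |g|)`, along some sequence of
exponents `s` that decreases to the critical exponent. -/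
structure IsPattersonSullivan {d : ℕ} (μ : Measure (Boundary d)) : Prop where
  isProbabilityMeasure : IsProbabilityMeasure μ
  exists_tendsto : ∃ s : ℕ → ℝ, (∀ k, criticalExponent d < s k) ∧
    Tendsto s atTop (𝓝 (criticalExponent d)) ∧
    TendstoWeakly (fun k => orbitMeasure d fun r => Real.exp (-s k * r)) μ

/-- The atomic measure `(δ_1 + ∑_{1≤j≤n} (2d-1)^{-j} ∑_{|g|=j} δ_g) / (1 + 2dn / (2d-1))`. -/
def sphereAverage (d n : ℕ) : Measure (Compactification d) :=
  (ENNReal.ofReal (1 + 2 * d * n / (2 * d - 1)))⁻¹ •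
    Measure.sum fun g : FreeGroup (Fin d) =>
      (if g.norm ≤ n then ENNReal.ofReal (1 / (2 * d - 1) ^ g.norm) else 0) •
        Measure.dirac (ofVertex g)

end BowenSeries

/-!
A generator is a Euclidean contraction off its own half disc, strictly so on each of the other
half discs. By compactness long reduced words contract uniformly, so the orbit of `0` converges
uniformly along the rays of the Cayley tree: the orbit map extends continuously to the boundary, and
the extension, read on infinite words, semi-conjugates the shift to `A`. Distinct arcs share at most
end points, so reading itineraries with half-open arcs gives a measurable section of this coding,
and the section inverts the coding outside countably many words.

On the shift, the entropy of an invariant measure is at most the conditional entropy of the first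
letter given the next `n` letters, hence at most `log (2d - 1)`. Equality forces, for every `n`, the
first letter to be equidistributed among the `2d - 1` letters that may precede the second one, and
this recursion on cylinders determines the Parry measure. The Parry measure has no atoms, so its
entropy passes to the circle through the section. The topological entropy of `A` is `log (2d - 1)`
as well: the images of the cylinders shrink uniformly, and every point has `2d - 1` preimages, which
stay a definite distance apart.

Every radial measure on the Cayley tree is a mixture of the uniform probabilities on the spheres.
These are the images of the Parry measure under `ω ↦` (the `n`-th vertex of the ray coded by `ω`)
and converge to it, so any mixture whose weights escape to infinity has the Parry measure as its
limit. This applies to the Patterson–Sullivan sums, which diverge at the critical exponent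
`log (2d - 1)`, and to the measures `μ_n`.
-/

/-! ### Entropy of finite distributions -/

section FiniteDistribution

variable {ι κ : Type*}

lemma negMulLog_lt_gibbs {p q : ℝ} (hp : 0 ≤ p) (hq : 0 ≤ q) (hqp : q = 0 → p = 0) (hpq : p ≠ q) :
    Real.negMulLog p < -p * Real.log q + q - p := by
  have hq : 0 < q := hq.lt_of_ne fun h => hpq ((hqp h.symm).trans h)
  have hmul : Real.negMulLog p = p / q * Real.negMulLog q + q * Real.negMulLog (p / q) := by
    rw [← Real.negMulLog_mul, mul_div_cancel₀ _ hq.ne']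
  have hlt := mul_lt_mul_of_pos_left (Real.negMulLog_lt_one_sub_self (div_nonneg hp hq.le)
    fun h => hpq ((div_eq_one_iff_eq hq.ne').1 h)) hq
  rw [mul_sub, mul_one, mul_div_cancel₀ _ hq.ne'] at hlt
  have hlog : p / q * Real.negMulLog q = -p * Real.log q := by
    rw [Real.negMulLog]
    field_simp
  linarith

lemma negMulLog_le_gibbs {p q : ℝ} (hp : 0 ≤ p) (hq : 0 ≤ q) (hqp : q = 0 → p = 0) :
    Real.negMulLog p ≤ -p * Real.log q + q - p := by
  rcases eq_or_ne p q with rfl | hpq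
  · rw [Real.negMulLog, add_sub_cancel_right]
  · exact (negMulLog_lt_gibbs hp hq hqp hpq).le

lemma negMulLog_sum_le (s : Finset ι) {p : ι → ℝ} (hp : ∀ i ∈ s, 0 ≤ p i) :
    Real.negMulLog (∑ i ∈ s, p i) ≤ ∑ i ∈ s, Real.negMulLog (p i) := by
  rw [Real.negMulLog, neg_mul, Finset.sum_mul, ← Finset.sum_neg_distrib]
  refine Finset.sum_le_sum fun i hi => ?_
  rw [Real.negMulLog, neg_mul, neg_le_neg_iff]
  rcases (hp i hi).eq_or_lt with h | h
  · simp [← h]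
  · exact mul_le_mul_of_nonneg_left (Real.log_le_log h (Finset.single_le_sum hp hi)) h.le

lemma sum_gibbs_average (s : Finset ι) (p : ι → ℝ) (hs : s.Nonempty) :
    ∑ i ∈ s, (-p i * Real.log ((∑ k ∈ s, p k) / s.card) + (∑ k ∈ s, p k) / s.card - p i)
      = Real.negMulLog (∑ i ∈ s, p i) + (∑ i ∈ s, p i) * Real.log s.card := by
  have hc : (s.card : ℝ) ≠ 0 := by exact_mod_cast hs.card_pos.ne'
  set P := ∑ i ∈ s, p i with hP
  rw [Finset.sum_sub_distrib, Finset.sum_add_distrib, ← Finset.sum_mul, Finset.sum_neg_distrib,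
    Finset.sum_const, nsmul_eq_mul, mul_div_cancel₀ _ hc, ← hP, Real.negMulLog]
  rcases eq_or_ne P 0 with h | h
  · simp [h]
  · rw [Real.log_div h hc]
    ring

lemma eq_zero_of_average_eq_zero {s : Finset ι} {p : ι → ℝ} (hp : ∀ i ∈ s, 0 ≤ p i) {j : ι}
    (hj : j ∈ s) (h : (∑ i ∈ s, p i) / s.card = 0) : p j = 0 := by
  have hc : (s.card : ℝ) ≠ 0 := by exact_mod_cast (Finset.card_pos.2 ⟨j, hj⟩).ne'
  exact (Finset.sum_eq_zero_iff_of_nonneg hp).1 ((div_eq_zero_iff.1 h).resolve_right hc) j hj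

lemma sum_negMulLog_le (s : Finset ι) {p : ι → ℝ} (hp : ∀ i ∈ s, 0 ≤ p i) :
    ∑ i ∈ s, Real.negMulLog (p i)
      ≤ Real.negMulLog (∑ i ∈ s, p i) + (∑ i ∈ s, p i) * Real.log s.card := by
  rcases s.eq_empty_or_nonempty with rfl | hs
  · simp
  rw [← sum_gibbs_average s p hs]
  exact Finset.sum_le_sum fun i hi => negMulLog_le_gibbs (hp i hi)
    (div_nonneg (Finset.sum_nonneg hp) (Nat.cast_nonneg _)) (eq_zero_of_average_eq_zero hp hi)

lemma sum_negMulLog_lt {s : Finset ι} {p : ι → ℝ} (hp : ∀ i ∈ s, 0 ≤ p i) {j : ι} (hj : j ∈ s)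
    (h : p j ≠ (∑ i ∈ s, p i) / s.card) :
    ∑ i ∈ s, Real.negMulLog (p i)
      < Real.negMulLog (∑ i ∈ s, p i) + (∑ i ∈ s, p i) * Real.log s.card := by
  rw [← sum_gibbs_average s p ⟨j, hj⟩]
  have hq : 0 ≤ (∑ i ∈ s, p i) / s.card := div_nonneg (Finset.sum_nonneg hp) (Nat.cast_nonneg _)
  exact Finset.sum_lt_sum
    (fun i hi => negMulLog_le_gibbs (hp i hi) hq (eq_zero_of_average_eq_zero hp hi))
    ⟨j, hj, negMulLog_lt_gibbs (hp j hj) hq (eq_zero_of_average_eq_zero hp hj) h⟩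

lemma negMulLog_le_of_le_marginals {p r c P : ℝ} (hp : 0 ≤ p) (hpr : p ≤ r) (hpc : p ≤ c)
    (hrP : r ≤ P) :
    Real.negMulLog p
      ≤ -p * Real.log r + -p * Real.log c + p * Real.log P + r * c / P - p := by
  have hr := hp.trans hpr
  have hc := hp.trans hpc
  have hP := hr.trans hrP
  rcases hp.eq_or_lt with rfl | hp
  · have : 0 ≤ r * c / P := by positivity
    simpa using this
  · have hr := hp.trans_le hpr
    have hc := hp.trans_le hpc
    have hP := hr.trans_le hrP
    have h := negMulLog_le_gibbs hp.le (q := r * c / P) (by positivity)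
      fun h => absurd h (by positivity)
    rw [Real.log_div (by positivity) hP.ne', Real.log_mul hr.ne' hc.ne'] at h
    linarith

variable [Fintype ι] [Fintype κ]

lemma sum_negMulLog_add_negMulLog_sum_le {p : ι → κ → ℝ} (hp : ∀ i j, 0 ≤ p i j) :
    ∑ i, ∑ j, Real.negMulLog (p i j) + Real.negMulLog (∑ i, ∑ j, p i j)
      ≤ ∑ i, Real.negMulLog (∑ j, p i j) + ∑ j, Real.negMulLog (∑ i, p i j) := by
  set r : ι → ℝ := fun i => ∑ j, p i j
  set c : κ → ℝ := fun j => ∑ i, p i j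
  set P : ℝ := ∑ i, r i
  have hPc : ∑ j, c j = P := Finset.sum_comm
  have hle : ∑ i, ∑ j, Real.negMulLog (p i j) ≤ ∑ i, ∑ j,
      (-p i j * Real.log (r i) + -p i j * Real.log (c j) + p i j * Real.log P
        + r i * c j / P - p i j) :=
    Finset.sum_le_sum fun i _ => Finset.sum_le_sum fun j _ => negMulLog_le_of_le_marginals (hp i j)
      (Finset.single_le_sum (fun j _ => hp i j) (Finset.mem_univ j))
      (Finset.single_le_sum (f := fun i => p i j) (fun i _ => hp i j) (Finset.mem_univ i))
      (Finset.single_le_sum (f := r) (fun i _ => Finset.sum_nonneg fun j _ => hp i j)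
        (Finset.mem_univ i))
  have hrow : ∑ i, ∑ j, -p i j * Real.log (r i) = ∑ i, Real.negMulLog (r i) :=
    Finset.sum_congr rfl fun i _ => by
      rw [← Finset.sum_mul, Finset.sum_neg_distrib, Real.negMulLog]
  have hcol : ∑ i, ∑ j, -p i j * Real.log (c j) = ∑ j, Real.negMulLog (c j) := by
    rw [Finset.sum_comm]
    exact Finset.sum_congr rfl fun j _ => by
      rw [← Finset.sum_mul, Finset.sum_neg_distrib, Real.negMulLog]
  have htot : ∑ i, ∑ j, p i j * Real.log P = -Real.negMulLog P := by
    simp_rw [← Finset.sum_mul]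
    rw [Real.negMulLog, neg_mul, neg_neg]
  have hprod : ∑ i, ∑ j, r i * c j / P = P := by
    simp_rw [← Finset.sum_div, ← Finset.mul_sum, hPc, ← Finset.sum_mul]
    exact mul_self_div_self P
  simp only [Finset.sum_sub_distrib, Finset.sum_add_distrib, hrow, hcol, htot, hprod] at hle
  change _ ≤ _ + P - P at hle
  linarith

end FiniteDistribution

/-! ### Entropy of finite partitions -/

section Partition

variable {X Y ι κ τ : Type*} [MeasurableSpace X] [MeasurableSpace Y] {μ : Measure X} [Fintype ι]
  [Fintype κ] [Fintype τ]

lemma measureReal_eq_sum_inter_fiber [MeasurableSpace κ] [MeasurableSingletonClass κ]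
    [IsFiniteMeasure μ] {g : X → κ} (hg : Measurable g) (s : Set X) :
    μ.real s = ∑ j, μ.real (s ∩ g ⁻¹' {j}) := by
  have h := sum_measureReal_preimage_singleton (μ := μ.restrict s) Finset.univ (f := g)
    fun j _ => hg (measurableSet_singleton j)
  simp only [measureReal_restrict_apply (hg (measurableSet_singleton _)), Finset.coe_univ,
    preimage_univ, measureReal_restrict_apply MeasurableSet.univ, univ_inter] at h
  simp only [← h, inter_comm]

lemma partitionEntropy_comp_of_injective (μ : Measure X) (f : X → ι) {e : ι → κ}
    (he : Function.Injective e) :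
    partitionEntropy μ (fun x => e (f x)) = partitionEntropy μ f := by
  refine (Fintype.sum_of_injective e he _ _ (fun j hj => ?_) fun i => ?_).symm
  · have : (fun x => e (f x)) ⁻¹' {j} = ∅ :=
      eq_empty_of_forall_notMem fun x hx => hj ⟨f x, hx⟩
    rw [this, measureReal_empty, Real.negMulLog_zero]
  · have : (fun x => e (f x)) ⁻¹' {e i} = f ⁻¹' {i} := by
      ext x
      exact he.eq_iff
    rw [this]

/-- The conditional entropy `H(f | g)` of the partition labelled by `f` given the one labelled by
`g`, defined by the chain rule `H(f, g) = H(g) + H(f | g)`. -/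
def condEntropy (μ : Measure X) (f : X → ι) (g : X → κ) : ℝ :=
  partitionEntropy μ (fun x => (f x, g x)) - partitionEntropy μ g

lemma condEntropy_comp_of_injective (μ : Measure X) (f : X → ι) (g : X → κ) {e : ι → τ}
    (he : Function.Injective e) :
    condEntropy μ (fun x => e (f x)) g = condEntropy μ f g := by
  rw [condEntropy, condEntropy, ← partitionEntropy_comp_of_injective μ (fun x => (f x, g x))
    (he.prodMap Function.injective_id)]
  rfl

lemma condEntropy_self (μ : Measure X) (f : X → ι) : condEntropy μ f f = 0 :=
  sub_eq_zero.2 <| partitionEntropy_comp_of_injective μ f (e := fun i => (i, i))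
    fun _ _ h => congrArg Prod.fst h

lemma condEntropy_of_subsingleton [Subsingleton ι] (μ : Measure X) (f : X → ι) (g : X → κ) :
    condEntropy μ f g = 0 :=
  sub_eq_zero.2 (partitionEntropy_comp_of_injective μ (fun x => (f x, g x)) (e := Prod.snd)
    fun _ _ h => Prod.ext (Subsingleton.elim _ _) h).symm

lemma condEntropy_eq_sum (μ : Measure X) (f : X → ι) (g : X → κ) :
    condEntropy μ f g = ∑ j, (∑ i, Real.negMulLog (μ.real (g ⁻¹' {j} ∩ f ⁻¹' {i}))
      - Real.negMulLog (μ.real (g ⁻¹' {j}))) := by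
  rw [condEntropy, partitionEntropy, partitionEntropy, Fintype.sum_prod_type_right,
    Finset.sum_sub_distrib]
  congr! 6 with j _ i _
  ext x
  simp [and_comm]

variable [MeasurableSpace ι] [MeasurableSingletonClass ι]

lemma partitionEntropy_comp_measurePreserving {ν : Measure Y} {T : X → Y}
    (hT : MeasurePreserving T μ ν) {f : Y → ι} (hf : Measurable f) :
    partitionEntropy μ (fun x => f (T x)) = partitionEntropy ν f :=
  Finset.sum_congr rfl fun i _ => congrArg _ <|
    hT.measureReal_preimage (hf (measurableSet_singleton i)).nullMeasurableSet

lemma partitionEntropy_comp_le [IsFiniteMeasure μ] {f : X → ι} (hf : Measurable f) (e : ι → κ) :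
    partitionEntropy μ (fun x => e (f x)) ≤ partitionEntropy μ f := by
  classical
  rw [partitionEntropy, partitionEntropy, ← Finset.sum_fiberwise Finset.univ e]
  refine Finset.sum_le_sum fun j _ => ?_
  have hfiber : μ.real ((fun x => e (f x)) ⁻¹' {j}) = ∑ i with e i = j, μ.real (f ⁻¹' {i}) := by
    rw [sum_measureReal_preimage_singleton _ fun i _ => hf (measurableSet_singleton i)]
    congr 1
    ext x
    simp
  rw [hfiber]
  exact negMulLog_sum_le _ fun i _ => measureReal_nonneg

variable [MeasurableSpace κ] [MeasurableSingletonClass κ]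

lemma condEntropy_comp_measurePreserving {ν : Measure Y} {T : X → Y}
    (hT : MeasurePreserving T μ ν) {f : Y → ι} (hf : Measurable f) {g : Y → κ}
    (hg : Measurable g) :
    condEntropy μ (fun x => f (T x)) (fun x => g (T x)) = condEntropy ν f g := by
  rw [condEntropy, condEntropy, partitionEntropy_comp_measurePreserving hT hg,
    ← partitionEntropy_comp_measurePreserving hT (hf.prodMk hg)]

lemma tendsto_partitionEntropy [IsFiniteMeasure μ] {f : X → ι} (hf : Measurable f)
    {g : ℕ → X → ι} (hg : ∀ n, Measurable (g n))
    (h : Tendsto (fun n => μ.real {x | f x ≠ g n x}) atTop (𝓝 0)) :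
    Tendsto (fun n => partitionEntropy μ (g n)) atTop (𝓝 (partitionEntropy μ f)) := by
  refine tendsto_finsetSum _ fun i _ => (Real.continuous_negMulLog.tendsto _).comp ?_
  rw [tendsto_iff_dist_tendsto_zero]
  refine squeeze_zero (fun _ => dist_nonneg) (fun n => ?_) h
  refine (abs_measureReal_sub_le_measureReal_symmDiff
    (hg n (measurableSet_singleton i)).nullMeasurableSet
    (hf (measurableSet_singleton i)).nullMeasurableSet).trans (measureReal_mono fun x hx => ?_)
  rintro (hfg : f x = g n x)
  simp [mem_symmDiff, hfg] at hx

lemma tendsto_condEntropy_zero [IsFiniteMeasure μ] {f : X → ι} (hf : Measurable f)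
    {g : ℕ → X → ι} (hg : ∀ n, Measurable (g n))
    (h : Tendsto (fun n => μ.real {x | f x ≠ g n x}) atTop (𝓝 0)) :
    Tendsto (fun n => condEntropy μ f (g n)) atTop (𝓝 0) := by
  rw [← condEntropy_self μ f]
  refine (tendsto_partitionEntropy (hf.prodMk hf) (fun n => hf.prodMk (hg n)) ?_).sub
    (tendsto_partitionEntropy hf hg h)
  simpa using h

lemma condEntropy_prodMk_le_condEntropy [IsFiniteMeasure μ] {f : X → ι} (hf : Measurable f)
    (g : X → τ) {k : X → κ} (hk : Measurable k) :
    condEntropy μ f (fun x => (g x, k x)) ≤ condEntropy μ f g := by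
  rw [condEntropy_eq_sum, condEntropy_eq_sum, Fintype.sum_prod_type]
  refine Finset.sum_le_sum fun j _ => ?_
  set p : κ → ι → ℝ := fun l i => μ.real (g ⁻¹' {j} ∩ k ⁻¹' {l} ∩ f ⁻¹' {i})
  have hgk : ∀ l, (fun x => (g x, k x)) ⁻¹' {(j, l)} = g ⁻¹' {j} ∩ k ⁻¹' {l} := fun l => by
    ext x
    simp
  have hgk_sum : ∀ l, μ.real (g ⁻¹' {j} ∩ k ⁻¹' {l}) = ∑ i, p l i := fun l =>
    measureReal_eq_sum_inter_fiber hf _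
  have hgf_sum : ∀ i, μ.real (g ⁻¹' {j} ∩ f ⁻¹' {i}) = ∑ l, p l i := fun i => by
    simp only [p, inter_right_comm _ (k ⁻¹' _) (f ⁻¹' _)]
    exact measureReal_eq_sum_inter_fiber hk _
  have hg_sum : μ.real (g ⁻¹' {j}) = ∑ l, ∑ i, p l i := by
    rw [measureReal_eq_sum_inter_fiber hk]
    exact Finset.sum_congr rfl fun l _ => hgk_sum l
  simp only [hgk, hgf_sum, hg_sum, hgk_sum, Finset.sum_sub_distrib]
  linarith [sum_negMulLog_add_negMulLog_sum_le (p := p) fun _ _ => measureReal_nonneg]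

lemma condEntropy_le_condEntropy_comp [IsFiniteMeasure μ] {f : X → ι} (hf : Measurable f)
    {k : X → κ} (hk : Measurable k) (e : κ → τ) :
    condEntropy μ f k ≤ condEntropy μ f (fun x => e (k x)) := by
  refine le_of_eq_of_le ?_ (condEntropy_prodMk_le_condEntropy hf (fun x => e (k x)) hk)
  have he : Function.Injective fun l => (e l, l) := fun _ _ h => congrArg Prod.snd h
  rw [condEntropy, condEntropy, partitionEntropy_comp_of_injective μ k he,
    ← partitionEntropy_comp_of_injective μ (fun x => (f x, k x))
      (Function.injective_id.prodMap he)]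
  rfl

lemma condEntropy_prodMk_le_add [IsFiniteMeasure μ] {f : X → ι} (hf : Measurable f) {g : X → κ}
    (hg : Measurable g) (k : X → τ) :
    condEntropy μ (fun x => (f x, g x)) k ≤ condEntropy μ f k + condEntropy μ g k := by
  have hfkg := condEntropy_prodMk_le_condEntropy (μ := μ) hf k hg
  have hassoc := partitionEntropy_comp_of_injective μ (fun x => ((f x, g x), k x))
    (e := fun q => (q.1.1, q.2, q.1.2)) (by rintro ⟨⟨a, b⟩, c⟩ ⟨⟨a', b'⟩, c'⟩ h; simp_all)
  have hswap := partitionEntropy_comp_of_injective μ (fun x => (k x, g x)) Prod.swap_injective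
  simp only [condEntropy, Prod.swap_prod_mk] at hfkg hswap ⊢
  linarith

end Partition

section UniformBound

variable {X ι κ : Type*} [MeasurableSpace X] {μ : Measure X} {f : X → ι} {g : X → κ}
  {s : κ → Finset ι} {N : ℕ}

lemma sum_measureReal_fiber [Fintype κ] [MeasurableSpace κ] [MeasurableSingletonClass κ]
    [IsProbabilityMeasure μ] (hg : Measurable g) : ∑ j, μ.real (g ⁻¹' {j}) = 1 := by
  simpa using (measureReal_eq_sum_inter_fiber (μ := μ) hg univ).symm

lemma sum_comp_measureReal_inter_fiber_eq [Fintype ι] (hs : ∀ x, f x ∈ s (g x)) {φ : ℝ → ℝ}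
    (hφ : φ 0 = 0) (j : κ) : ∑ i, φ (μ.real (g ⁻¹' {j} ∩ f ⁻¹' {i}))
      = ∑ i ∈ s j, φ (μ.real (g ⁻¹' {j} ∩ f ⁻¹' {i})) := by
  refine (Finset.sum_subset (Finset.subset_univ _) fun i _ hi => ?_).symm
  have : g ⁻¹' {j} ∩ f ⁻¹' {i} = ∅ := by
    refine eq_empty_of_forall_notMem ?_
    rintro x ⟨rfl, rfl⟩
    exact hi (hs x)
  rw [this, measureReal_empty, hφ]

variable [MeasurableSpace ι] [MeasurableSingletonClass ι]

lemma sum_measureReal_inter_fiber_of_mem [Finite ι] [IsFiniteMeasure μ] (hf : Measurable f)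
    (hs : ∀ x, f x ∈ s (g x)) (j : κ) :
    ∑ i ∈ s j, μ.real (g ⁻¹' {j} ∩ f ⁻¹' {i}) = μ.real (g ⁻¹' {j}) := by
  have := Fintype.ofFinite ι
  rw [measureReal_eq_sum_inter_fiber hf (g ⁻¹' {j})]
  exact (sum_comp_measureReal_inter_fiber_eq hs (φ := id) rfl j).symm

variable [Fintype ι]

lemma sum_negMulLog_inter_fiber_sub_le [IsFiniteMeasure μ] (hf : Measurable f)
    (hs : ∀ x, f x ∈ s (g x)) (hN : ∀ j, (s j).card = N) (j : κ) :
    ∑ i, Real.negMulLog (μ.real (g ⁻¹' {j} ∩ f ⁻¹' {i})) - Real.negMulLog (μ.real (g ⁻¹' {j}))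
      ≤ μ.real (g ⁻¹' {j}) * Real.log N := by
  have h := sum_negMulLog_le (s j) (p := fun i => μ.real (g ⁻¹' {j} ∩ f ⁻¹' {i}))
    fun _ _ => measureReal_nonneg
  rw [sum_measureReal_inter_fiber_of_mem hf hs, hN] at h
  rw [sum_comp_measureReal_inter_fiber_eq hs Real.negMulLog_zero]
  linarith

variable [Fintype κ] [MeasurableSpace κ] [MeasurableSingletonClass κ] [IsProbabilityMeasure μ]

lemma condEntropy_le_log (hf : Measurable f) (hg : Measurable g) (hs : ∀ x, f x ∈ s (g x))
    (hN : ∀ j, (s j).card = N) : condEntropy μ f g ≤ Real.log N := by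
  rw [condEntropy_eq_sum, ← one_mul (Real.log N), ← sum_measureReal_fiber (μ := μ) hg,
    Finset.sum_mul]
  exact Finset.sum_le_sum fun j _ => sum_negMulLog_inter_fiber_sub_le hf hs hN j

lemma measureReal_inter_fiber_eq_of_log_le_condEntropy (hf : Measurable f) (hg : Measurable g)
    (hs : ∀ x, f x ∈ s (g x)) (hN : ∀ j, (s j).card = N) (h : Real.log N ≤ condEntropy μ f g)
    {i : ι} {j : κ} (hij : i ∈ s j) :
    μ.real (g ⁻¹' {j} ∩ f ⁻¹' {i}) = μ.real (g ⁻¹' {j}) / N := by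
  by_contra hne
  refine h.not_gt ?_
  rw [condEntropy_eq_sum, ← one_mul (Real.log N), ← sum_measureReal_fiber (μ := μ) hg,
    Finset.sum_mul]
  refine Finset.sum_lt_sum (fun j _ => sum_negMulLog_inter_fiber_sub_le hf hs hN j)
    ⟨j, Finset.mem_univ j, ?_⟩
  have hlt := sum_negMulLog_lt (p := fun i => μ.real (g ⁻¹' {j} ∩ f ⁻¹' {i}))
    (fun _ _ => measureReal_nonneg) hij
    (by rwa [sum_measureReal_inter_fiber_of_mem hf hs, hN])
  rw [sum_measureReal_inter_fiber_of_mem hf hs, hN] at hlt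
  rw [sum_comp_measureReal_inter_fiber_eq hs Real.negMulLog_zero]
  linarith

lemma measureReal_fiber_eq_of_log_le_condEntropy (hf : Measurable f) (hg : Measurable g)
    (hs : ∀ x, f x ∈ s (g x)) (hN : ∀ j, (s j).card = N) (h : Real.log N ≤ condEntropy μ f g)
    (i : ι) : μ.real (f ⁻¹' {i}) = μ.real {x | i ∈ s (g x)} / N := by
  rw [measureReal_eq_sum_inter_fiber hg (f ⁻¹' {i}),
    measureReal_eq_sum_inter_fiber hg {x | i ∈ s (g x)}, Finset.sum_div]
  refine Finset.sum_congr rfl fun j _ => ?_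
  by_cases hij : i ∈ s j
  · have hinter : {x | i ∈ s (g x)} ∩ g ⁻¹' {j} = g ⁻¹' {j} :=
      inter_eq_right.2 fun x hx => by rwa [← mem_singleton_iff.1 hx] at hij
    rw [hinter, inter_comm, measureReal_inter_fiber_eq_of_log_le_condEntropy hf hg hs hN h hij]
  · have hleft : f ⁻¹' {i} ∩ g ⁻¹' {j} = ∅ := by
      refine eq_empty_of_forall_notMem ?_
      rintro x ⟨rfl, rfl⟩
      exact hij (hs x)
    have hright : {x | i ∈ s (g x)} ∩ g ⁻¹' {j} = ∅ := by
      refine eq_empty_of_forall_notMem ?_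
      rintro x ⟨hx, rfl⟩
      exact hij hx
    rw [hleft, hright, measureReal_empty, zero_div]

end UniformBound

section UniformFibers

variable {X ι : Type*} [MeasurableSpace X] [MeasurableSpace ι] [MeasurableSingletonClass ι]
  {μ : Measure X} [IsProbabilityMeasure μ] {f : X → ι} {N : ℝ}

lemma partitionEntropy_eq_log [Fintype ι] (hf : Measurable f)
    (h : ∀ x, μ.real (f ⁻¹' {f x}) = N⁻¹) : partitionEntropy μ f = Real.log N := by
  have hterm : ∀ i, Real.negMulLog (μ.real (f ⁻¹' {i})) = μ.real (f ⁻¹' {i}) * Real.log N := by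
    intro i
    by_cases hi : i ∈ range f
    · obtain ⟨x, rfl⟩ := hi
      rw [h, Real.negMulLog, Real.log_inv]
      ring
    · rw [preimage_singleton_eq_empty.2 hi, measureReal_empty, Real.negMulLog_zero, zero_mul]
  rw [partitionEntropy, Finset.sum_congr rfl fun i _ => hterm i, ← Finset.sum_mul,
    sum_measureReal_fiber hf, one_mul]

lemma ncard_range_eq [Finite ι] (hf : Measurable f) (h : ∀ x, μ.real (f ⁻¹' {f x}) = N⁻¹) :
    ((range f).ncard : ℝ) = N := by
  have hfin := (range f).toFinite
  have hsum := sum_measureReal_preimage_singleton (μ := μ) hfin.toFinset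
    fun i _ => hf (measurableSet_singleton i)
  have hconst : ∀ i ∈ hfin.toFinset, μ.real (f ⁻¹' {i}) = N⁻¹ := by
    simpa using h
  rw [hfin.coe_toFinset, preimage_range, probReal_univ, Finset.sum_congr rfl hconst,
    Finset.sum_const, ← ncard_eq_toFinset_card _ hfin, nsmul_eq_mul] at hsum
  refine (mul_inv_eq_one₀ ?_).1 hsum
  rintro rfl
  simp at hsum

end UniformFibers

/-! ### Kolmogorov–Sinai entropy -/

section Itinerary

variable {X ι κ : Type*} {T : X → X}

/-- The sets determined by finitely many terms of the itinerary: the algebra generated by the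
iterated preimages of the partition labelled by `α`. -/
def itinerarySets (T : X → X) (α : X → κ) : Set (Set X) :=
  {s | ∃ (r : ℕ) (S : Set (Fin r → κ)), s = itinerary T α r ⁻¹' S}

lemma itinerary_preimage_eq_of_le (T : X → X) (α : X → κ) {r r' : ℕ} (h : r ≤ r')
    (S : Set (Fin r → κ)) : itinerary T α r ⁻¹' S
      = itinerary T α r' ⁻¹' {w | (fun i => w (Fin.castLE h i)) ∈ S} := rfl

lemma isSetAlgebra_itinerarySets (T : X → X) (α : X → κ) : IsSetAlgebra (itinerarySets T α) where
  empty_mem := ⟨0, ∅, rfl⟩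
  compl_mem := by
    rintro _ ⟨r, S, rfl⟩
    exact ⟨r, Sᶜ, rfl⟩
  union_mem := by
    rintro _ _ ⟨r, S, rfl⟩ ⟨r', S', rfl⟩
    rw [itinerary_preimage_eq_of_le T α (le_max_left r r') S,
      itinerary_preimage_eq_of_le T α (le_max_right r r') S', ← preimage_union]
    exact ⟨_, _, rfl⟩

variable [m : MeasurableSpace X] {μ : Measure X}

lemma measurable_itinerary [MeasurableSpace ι] (hT : Measurable T) {f : X → ι} (hf : Measurable f)
    (n : ℕ) : Measurable (itinerary T f n) :=
  measurable_pi_iff.2 fun i => hf.comp (hT.iterate i)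

lemma exists_itinerary_approx [IsFiniteMeasure μ] {α : X → κ}
    (hgen : m = MeasurableSpace.generateFrom (itinerarySets T α)) {s : Set X}
    (hs : MeasurableSet s) {δ : ℝ} (hδ : 0 < δ) :
    ∃ (r : ℕ) (S : Set (Fin r → κ)), μ.real (symmDiff s (itinerary T α r ⁻¹' S)) ≤ δ := by
  have hdense := Measure.MeasureDense.of_generateFrom_isSetAlgebra_finite μ
    (isSetAlgebra_itinerarySets T α) hgen
  obtain ⟨_, ⟨r, S, rfl⟩, h⟩ := hdense.approx _ hs (measure_ne_top μ _) δ hδ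
  exact ⟨r, S, ENNReal.toReal_le_of_le_ofReal hδ.le h.le⟩

variable [Fintype ι] [MeasurableSpace ι] [MeasurableSingletonClass ι]

lemma exists_measureReal_ne_itinerary_le [Nonempty ι] [IsFiniteMeasure μ] {α : X → κ}
    (hgen : m = MeasurableSpace.generateFrom (itinerarySets T α)) {f : X → ι} (hf : Measurable f)
    {δ : ℝ} (hδ : 0 < δ) : ∃ (r : ℕ) (G : (Fin r → κ) → ι),
      μ.real {x | f x ≠ G (itinerary T α r x)} ≤ Fintype.card ι * δ := by
  classical
  choose r S hS using fun i =>
    exists_itinerary_approx (μ := μ) hgen (hf (measurableSet_singleton i)) hδ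
  have hR : ∀ i, r i ≤ Finset.univ.sup r := fun i => Finset.le_sup (Finset.mem_univ i)
  let P : (Fin (Finset.univ.sup r) → κ) → ι → Prop := fun w i =>
    (fun j => w (Fin.castLE (hR i) j)) ∈ S i
  refine ⟨_, fun w => if h : ∃ i, P w i then h.choose else Classical.arbitrary ι, ?_⟩
  have hsub : {x | f x ≠ (if h : ∃ i, P (itinerary T α _ x) i then h.choose
      else Classical.arbitrary ι)}
      ⊆ ⋃ i ∈ (Finset.univ : Finset ι), symmDiff (f ⁻¹' {i}) (itinerary T α (r i) ⁻¹' S i) := by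
    refine fun x hx => by_contra fun hx' => hx ?_
    have hmem : ∀ i, P (itinerary T α _ x) i ↔ f x = i := fun i => by
      have : x ∉ symmDiff (f ⁻¹' {i}) (itinerary T α (r i) ⁻¹' S i) := fun h =>
        hx' (mem_biUnion (Finset.mem_univ i) h)
      rw [mem_symmDiff, mem_preimage, mem_singleton_iff, mem_preimage] at this
      change _ ∈ S i ↔ _
      tauto
    have hex : ∃ i, P (itinerary T α _ x) i := ⟨f x, (hmem _).2 rfl⟩
    rw [dif_pos hex]
    exact (hmem _).1 hex.choose_spec
  calc μ.real _ ≤ μ.real (⋃ i ∈ Finset.univ, symmDiff (f ⁻¹' {i}) (itinerary T α (r i) ⁻¹' S i)) :=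
        measureReal_mono hsub (measure_ne_top μ _)
    _ ≤ ∑ i, μ.real (symmDiff (f ⁻¹' {i}) (itinerary T α (r i) ⁻¹' S i)) :=
        measureReal_biUnion_finset_le _ _
    _ ≤ ∑ _i : ι, δ := Finset.sum_le_sum fun i _ => hS i
    _ = Fintype.card ι * δ := by rw [Finset.sum_const, Finset.card_univ, nsmul_eq_mul]

variable [Fintype κ] [MeasurableSpace κ] [MeasurableSingletonClass κ]

lemma exists_condEntropy_itinerary_le [IsProbabilityMeasure μ] (hT : Measurable T) {α : X → κ}
    (hα : Measurable α) (hgen : m = MeasurableSpace.generateFrom (itinerarySets T α)) {f : X → ι}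
    (hf : Measurable f) {ε : ℝ} (hε : 0 < ε) : ∃ r, condEntropy μ f (itinerary T α r) ≤ ε := by
  have : Nonempty ι := μ.nonempty_of_neZero.map f
  choose r G hG using fun n : ℕ =>
    exists_measureReal_ne_itinerary_le (μ := μ) hgen hf (Nat.one_div_pos_of_nat (n := n) (α := ℝ))
  have hlim : Tendsto (fun n => μ.real {x | f x ≠ G n (itinerary T α (r n) x)}) atTop (𝓝 0) := by
    refine squeeze_zero (fun _ => measureReal_nonneg) hG ?_
    simpa using tendsto_one_div_add_atTop_nhds_zero_nat.const_mul (Fintype.card ι : ℝ)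
  have hα_itin := fun n => measurable_itinerary hT hα (r n)
  obtain ⟨n, hn⟩ := ((tendsto_condEntropy_zero hf
    (fun n => (measurable_of_finite (G n)).comp (hα_itin n)) hlim).eventually
      (Iic_mem_nhds hε)).exists
  exact ⟨r n, (condEntropy_le_condEntropy_comp hf (hα_itin n) (G n)).trans hn⟩

lemma condEntropy_itinerary_le [IsFiniteMeasure μ] (hT : MeasurePreserving T μ μ) {f : X → ι}
    (hf : Measurable f) {α : X → κ} (hα : Measurable α) (n r : ℕ) :
    condEntropy μ (itinerary T f n) (itinerary T α (n + r))
      ≤ n * condEntropy μ f (itinerary T α r) := by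
  have hf_itin := measurable_itinerary hT.measurable hf
  have hα_itin := measurable_itinerary hT.measurable hα
  induction n with
  | zero => simp [condEntropy_of_subsingleton]
  | succ n ih =>
    set k := itinerary T α (n + 1 + r)
    have hk : Measurable k := hα_itin _
    have hhead : condEntropy μ f k ≤ condEntropy μ f (itinerary T α r) :=
      condEntropy_le_condEntropy_comp hf hk fun w (i : Fin r) => w (Fin.castLE (by omega) i)
    have htail : condEntropy μ (fun x => itinerary T f n (T x)) k
        ≤ condEntropy μ (itinerary T f n) (itinerary T α (n + r)) := by
      rw [← condEntropy_comp_measurePreserving hT (hf_itin n) (hα_itin (n + r))]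
      exact condEntropy_le_condEntropy_comp ((hf_itin n).comp hT.measurable) hk
        fun w (i : Fin (n + r)) => w ⟨i + 1, by omega⟩
    calc condEntropy μ (itinerary T f (n + 1)) k
        = condEntropy μ (fun x => (f x, itinerary T f n (T x))) k :=
          (condEntropy_comp_of_injective μ _ _
            (Fin.consEquiv fun _ : Fin (n + 1) => ι).symm.injective).symm
      _ ≤ condEntropy μ f k + condEntropy μ (fun x => itinerary T f n (T x)) k :=
          condEntropy_prodMk_le_add hf ((hf_itin n).comp hT.measurable) k
      _ ≤ (n + 1 : ℕ) * condEntropy μ f (itinerary T α r) := by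
          push_cast
          linarith

lemma partitionEntropy_itinerary_le [IsFiniteMeasure μ] (hT : MeasurePreserving T μ μ) {f : X → ι}
    (hf : Measurable f) {α : X → κ} (hα : Measurable α) (n r : ℕ) :
    partitionEntropy μ (itinerary T f n)
      ≤ partitionEntropy μ (itinerary T α (n + r)) + n * condEntropy μ f (itinerary T α r) := by
  have hfst : partitionEntropy μ (itinerary T f n) ≤ _ := partitionEntropy_comp_le
    ((measurable_itinerary hT.measurable hf n).prodMk
      (measurable_itinerary hT.measurable hα (n + r))) Prod.fst
  have hcond := condEntropy_itinerary_le hT hf hα n r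
  rw [condEntropy] at hcond
  linarith

lemma partitionEntropy_itinerary_succ (hT : MeasurePreserving T μ μ) {α : X → κ}
    (hα : Measurable α) (n : ℕ) : partitionEntropy μ (itinerary T α (n + 1))
      = partitionEntropy μ (itinerary T α n)
        + condEntropy μ α (fun x => itinerary T α n (T x)) := by
  rw [condEntropy, partitionEntropy_comp_measurePreserving hT
    (measurable_itinerary hT.measurable hα n), add_sub_cancel]
  exact (partitionEntropy_comp_of_injective μ _
    (Fin.consEquiv fun _ : Fin (n + 1) => κ).symm.injective).symm

lemma partitionEntropy_itinerary_add_le [IsFiniteMeasure μ] (hT : MeasurePreserving T μ μ)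
    {α : X → κ} (hα : Measurable α) (n k : ℕ) : partitionEntropy μ (itinerary T α (n + k))
      ≤ partitionEntropy μ (itinerary T α n)
        + k * condEntropy μ α (fun x => itinerary T α n (T x)) := by
  induction k with
  | zero => simp
  | succ k ih =>
    have hmono : condEntropy μ α (fun x => itinerary T α (n + k) (T x))
        ≤ condEntropy μ α (fun x => itinerary T α n (T x)) :=
      condEntropy_le_condEntropy_comp hα
        ((measurable_itinerary hT.measurable hα (n + k)).comp hT.measurable)
        fun w i => w (Fin.castLE (Nat.le_add_right n k) i)
    rw [← add_assoc, partitionEntropy_itinerary_succ hT hα]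
    push_cast
    linarith

lemma ksEntropy_le_of_generator [IsProbabilityMeasure μ] (hT : MeasurePreserving T μ μ)
    {α : X → κ} (hα : Measurable α)
    (hgen : m = MeasurableSpace.generateFrom (itinerarySets T α)) {C L : ℝ}
    (h : ∀ n : ℕ, partitionEntropy μ (itinerary T α n) ≤ C + n * L) : ksEntropy μ T ≤ L := by
  refine iSup_le fun k => iSup_le fun f => iSup_le fun hf => ?_
  refine EReal.le_of_forall_lt_iff_le.1 fun z hz => ?_
  have hz : 0 < z - L := sub_pos.2 (by exact_mod_cast hz)
  obtain ⟨r, hr⟩ := exists_condEntropy_itinerary_le (μ := μ) hT.measurable hα hgen hf hz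
  have hlim : Tendsto (fun n : ℕ => (((C + r * L) / n + z : ℝ) : EReal)) atTop (𝓝 (z : EReal)) := by
    rw [EReal.tendsto_coe]
    simpa using (tendsto_const_div_atTop_nhds_zero_nat (C + r * L)).add_const z
  rw [← hlim.limsup_eq]
  refine limsup_le_limsup ?_
  filter_upwards [eventually_gt_atTop 0] with n hn
  have hn : (0 : ℝ) < n := by exact_mod_cast hn
  have hfα := partitionEntropy_itinerary_le hT hf hα n r
  have hαn := h (n + r)
  have hrn := mul_le_mul_of_nonneg_left hr hn.le
  push_cast at hαn
  rw [EReal.coe_le_coe_iff, div_add' _ _ _ hn.ne', div_le_div_iff_of_pos_right hn]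
  linarith

lemma ksEntropy_le_condEntropy_itinerary [IsProbabilityMeasure μ] (hT : MeasurePreserving T μ μ)
    {α : X → κ} (hα : Measurable α)
    (hgen : m = MeasurableSpace.generateFrom (itinerarySets T α)) (n : ℕ) :
    ksEntropy μ T ≤ condEntropy μ α (fun x => itinerary T α n (T x)) := by
  refine ksEntropy_le_of_generator (C := partitionEntropy μ (itinerary T α n)) hT hα hgen
    fun k => ?_
  refine le_trans ?_ (partitionEntropy_itinerary_add_le hT hα n k)
  exact partitionEntropy_comp_le (measurable_itinerary hT.measurable hα (n + k))
    fun w i => w (Fin.castLE (Nat.le_add_left k n) i)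

end Itinerary

lemma entropyOfPartition_le_ksEntropy {X κ : Type*} [MeasurableSpace X] [Fintype κ]
    [MeasurableSpace κ] [MeasurableSingletonClass κ] (μ : Measure X) (T : X → X) {α : X → κ}
    (hα : Measurable α) : entropyOfPartition μ T α ≤ ksEntropy μ T := by
  have h : entropyOfPartition μ T α = entropyOfPartition μ T (Fintype.equivFin κ ∘ α) := by
    rw [entropyOfPartition, entropyOfPartition]
    congr with n
    rw [← partitionEntropy_comp_of_injective μ (itinerary T α n)
      ((Fintype.equivFin κ).injective.comp_left (α := Fin n))]
    rfl
  rw [h]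
  exact le_iSup₂_of_le (Fintype.card κ) (Fintype.equivFin κ ∘ α)
    (le_iSup_of_le ((measurable_of_finite _).comp hα) le_rfl)

lemma ksEntropy_le_of_semiconj {X Y : Type*} [MeasurableSpace X] [MeasurableSpace Y]
    {μ : Measure X} {ν : Measure Y} {T : X → X} {S : Y → Y} {φ : X → Y}
    (hφ : MeasurePreserving φ μ ν) (hsemi : Function.Semiconj φ T S) (hS : Measurable S) :
    ksEntropy ν S ≤ ksEntropy μ T := by
  refine iSup_le fun k => iSup_le fun f => iSup_le fun hf => ?_
  refine le_trans (le_of_eq ?_) (entropyOfPartition_le_ksEntropy μ T (hf.comp hφ.measurable))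
  rw [entropyOfPartition, entropyOfPartition]
  congr with n
  rw [← partitionEntropy_comp_measurePreserving hφ (measurable_itinerary hS hf n)]
  congr 3 with x i
  simp only [itinerary, Function.comp_apply, (hsemi.iterate_right i).eq]

/-! ### Topological entropy -/

section TopologicalEntropy

variable {X : Type*} {T : X → X}

lemma exists_iterate_ne_of_iterate_eq {x y : X} (hxy : x ≠ y) {n : ℕ} (h : T^[n] x = T^[n] y) :
    ∃ k < n, T^[k] x ≠ T^[k] y ∧ T (T^[k] x) = T (T^[k] y) := by
  induction n with
  | zero => exact absurd h hxy
  | succ n ih =>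
    by_cases h' : T^[n] x = T^[n] y
    · obtain ⟨k, hk, hk'⟩ := ih h'
      exact ⟨k, by omega, hk'⟩
    · rw [Function.iterate_succ_apply', Function.iterate_succ_apply'] at h
      exact ⟨n, by omega, h', h⟩

lemma exists_finset_card_pow_iterate_eq {N : ℕ}
    (hpre : ∀ y, ∃ t : Finset X, t.card = N ∧ ∀ x ∈ t, T x = y) (n : ℕ) (y : X) :
    ∃ t : Finset X, t.card = N ^ n ∧ ∀ x ∈ t, T^[n] x = y := by
  classical
  choose t ht hT using hpre
  induction n with
  | zero => exact ⟨{y}, by simp, by simp⟩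
  | succ n ih =>
    obtain ⟨s, hs, hsy⟩ := ih
    refine ⟨s.biUnion t, ?_, fun x hx => ?_⟩
    · rw [Finset.card_biUnion, Finset.sum_congr rfl fun z _ => ht z, Finset.sum_const, hs,
        smul_eq_mul, pow_succ]
      exact fun z _ w _ hzw => Finset.disjoint_left.2 fun x hxz hxw =>
        hzw ((hT z x hxz).symm.trans (hT w x hxw))
    · obtain ⟨z, hz, hxz⟩ := Finset.mem_biUnion.1 hx
      rw [Function.iterate_succ_apply, hT z x hxz, hsy z hz]

variable [PseudoMetricSpace X]

lemma isDynNetIn_of_iterate_eq {ε : ℝ} (hsep : ∀ x y, x ≠ y → T x = T y → ε ≤ dist x y) {n : ℕ}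
    {s : Set X} {z : X} (hs : ∀ x ∈ s, T^[n] x = z) :
    Dynamics.IsDynNetIn T univ {p | dist p.1 p.2 < ε / 2} n s := by
  refine ⟨subset_univ _, fun x hx y hy hxy => disjoint_left.2 fun w hwx hwy => ?_⟩
  obtain ⟨k, hk, hne, heq⟩ := exists_iterate_ne_of_iterate_eq hxy ((hs x hx).trans (hs y hy).symm)
  have hx : dist (T^[k] x) (T^[k] w) < ε / 2 := Dynamics.mem_ball_dynEntourage.1 hwx k hk
  have hy : dist (T^[k] y) (T^[k] w) < ε / 2 := Dynamics.mem_ball_dynEntourage.1 hwy k hk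
  linarith [hsep _ _ hne heq, dist_triangle_right (T^[k] x) (T^[k] y) (T^[k] w)]

theorem log_le_coverEntropy [Nonempty X] {ε : ℝ} (hε : 0 < ε)
    (hsep : ∀ x y, x ≠ y → T x = T y → ε ≤ dist x y) {N : ℕ}
    (hpre : ∀ y, ∃ t : Finset X, t.card = N ∧ ∀ x ∈ t, T x = y) :
    ENNReal.log N ≤ Dynamics.coverEntropy T univ := by
  refine le_trans ?_ (Dynamics.netEntropyEntourage_le_coverEntropy (T := T) univ
    (Metric.uniformity_basis_dist.mem_of_mem (half_pos hε)))
  rw [← ExpGrowth.expGrowthSup_pow]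
  refine ExpGrowth.expGrowthSup_monotone fun n => ?_
  obtain ⟨t, ht, htz⟩ := exists_finset_card_pow_iterate_eq hpre n (Classical.arbitrary X)
  have hcard := ENat.toENNReal_mono (isDynNetIn_of_iterate_eq hsep htz).card_le_netMaxcard
  rwa [ht, ENat.toENNReal_coe, Nat.cast_pow] at hcard

theorem coverEntropy_le_log {F : Set X} {N : ℝ≥0∞}
    (h : ∀ ε > 0, ∃ C ≠ ∞, ∀ n,
      (Dynamics.coverMincard T F {p | dist p.1 p.2 < ε} n : ℝ≥0∞) ≤ C * N ^ n) :
    Dynamics.coverEntropy T F ≤ ENNReal.log N := by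
  rw [Dynamics.coverEntropy_eq_iSup_basis Metric.uniformity_basis_dist]
  refine iSup₂_le fun ε hε => ?_
  obtain ⟨C, hC, hle⟩ := h ε hε
  rw [← ExpGrowth.expGrowthSup_pow]
  exact ExpGrowth.expGrowthSup_le_of_eventually_le hC (Eventually.of_forall hle)

lemma coverMincard_le_ncard_range_itinerary {Ω ι : Type*} [Finite ι] {S : Ω → Ω} {φ : Ω → X}
    (hφ : Function.Surjective φ) (hsemi : Function.Semiconj φ S T) (f : Ω → ι) {ε : ℝ} {k : ℕ}
    (h : ∀ ω η, itinerary S f k ω = itinerary S f k η → dist (φ ω) (φ η) < ε) (n : ℕ) :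
    Dynamics.coverMincard T univ {p | dist p.1 p.2 < ε} n
      ≤ (range (itinerary S f (n + k))).ncard := by
  classical
  have := Fintype.ofFinite (range (itinerary S f (n + k)))
  let r := rangeSplitting (itinerary S f (n + k))
  have hr (ω : Ω) : itinerary S f (n + k) (r ⟨_, mem_range_self ω⟩) = itinerary S f (n + k) ω :=
    apply_rangeSplitting _ _
  have hcover : Dynamics.IsDynCoverOf T univ {p | dist p.1 p.2 < ε} n
      (Finset.univ.image (φ ∘ r) : Finset X) := by
    intro x _
    obtain ⟨ω, rfl⟩ := hφ x
    refine ⟨φ (r ⟨_, mem_range_self ω⟩), by simp, Dynamics.mem_dynEntourage.2 fun j hj => ?_⟩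
    rw [← hsemi.iterate_right j, ← hsemi.iterate_right j]
    refine h _ _ (funext fun i => ?_)
    have hij := congrFun (hr ω).symm ⟨i + j, by omega⟩
    rwa [itinerary, itinerary, Function.iterate_add_apply, Function.iterate_add_apply] at hij
  refine hcover.coverMincard_le_card.trans ?_
  rw [← Nat.card_coe_set_eq, Nat.card_eq_fintype_card]
  exact_mod_cast Finset.card_image_le

end TopologicalEntropy

lemma ennrealLog_natCast {n : ℕ} (hn : n ≠ 0) : ENNReal.log n = (Real.log n : EReal) := by
  rw [ENNReal.log_pos_real (by simpa using hn) (ENNReal.natCast_ne_top n), ENNReal.toReal_natCast]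

/-! ### Angles on the circle -/

lemma circleExp_two_pi_sub (t : ℝ) : Circle.exp (2 * Real.pi - t) = (Circle.exp t)⁻¹ := by
  rw [Circle.exp_sub, Circle.exp_two_pi, one_div]

lemma exists_mem_Ico_circleExp_eq (s : ℝ) (x : Circle) :
    ∃ t ∈ Ico s (s + 2 * Real.pi), Circle.exp t = x := by
  refine ⟨toIcoMod Real.two_pi_pos s (Complex.arg x), toIcoMod_mem_Ico _ _ _, ?_⟩
  rw [← self_sub_toIcoDiv_zsmul, Circle.exp_sub]
  simp [Circle.exp_arg x]

lemma norm_circleExp_sub_circleExp (s t : ℝ) :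
    ‖(Circle.exp s : ℂ) - Circle.exp t‖ = |2 * Real.sin ((s - t) / 2)| := by
  have hfactor : (Circle.exp s : ℂ) - Circle.exp t
      = Circle.exp t * (Complex.exp (Complex.I * (s - t : ℝ)) - 1) := by
    rw [mul_sub, mul_one, mul_comm Complex.I, ← Circle.coe_exp, ← Circle.coe_mul, ← Circle.exp_add,
      add_sub_cancel]
  rw [hfactor, norm_mul, Circle.norm_coe, one_mul, Complex.norm_exp_I_mul_ofReal_sub_one,
    Real.norm_eq_abs]

lemma sin_le_sin_of_le_of_le_pi_sub {s t : ℝ} (hs : 0 ≤ s) (hst : s ≤ t)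
    (hts : t ≤ Real.pi - s) : Real.sin s ≤ Real.sin t := by
  rcases le_total t (Real.pi / 2) with h | h
  · exact Real.sin_le_sin_of_le_of_le_pi_div_two (by linarith) h hst
  · rw [← Real.sin_pi_sub t]
    exact Real.sin_le_sin_of_le_of_le_pi_div_two (by linarith) (by linarith) (by linarith)

/-! ### Weighted averages -/

section WeightedAverage

lemma tendsto_tsum_mul_of_tendsto_cofinite {ι κ : Type*} {F : Filter κ} {p : κ → ι → ℝ}
    {a : ι → ℝ} {l : ℝ} (ha : Tendsto a cofinite (𝓝 l)) (hp : ∀ k i, 0 ≤ p k i)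
    (hsum : ∀ᶠ k in F, HasSum (p k) 1) (hzero : ∀ i, Tendsto (p · i) F (𝓝 0)) :
    Tendsto (fun k => ∑' i, p k i * a i) F (𝓝 l) := by
  classical
  rw [Metric.tendsto_nhds]
  intro ε hε
  have hlarge : {i | ¬ dist (a i) l < ε / 2}.Finite := Metric.tendsto_nhds.1 ha _ (half_pos hε)
  set s := hlarge.toFinset with hs
  have hfinite : Tendsto (fun k => ∑ i ∈ s, p k i * |a i - l|) F (𝓝 0) := by
    simpa using tendsto_finsetSum s fun i _ => (hzero i).mul_const |a i - l|
  filter_upwards [hsum, hfinite.eventually_lt_const (half_pos hε)] with k hk hsmall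
  let b : ι → ℝ := fun i => (if i ∈ s then p k i * |a i - l| else 0) + p k i * (ε / 2)
  have hb : HasSum b (∑ i ∈ s, p k i * |a i - l| + 1 * (ε / 2)) := by
    refine HasSum.add ?_ (hk.mul_right _)
    rw [← Finset.sum_congr rfl fun i hi => if_pos hi]
    exact hasSum_sum_of_ne_finset_zero fun i hi => if_neg hi
  have hle : ∀ i, ‖p k i * (a i - l)‖ ≤ b i := fun i => by
    rw [norm_mul, Real.norm_eq_abs, Real.norm_eq_abs, abs_of_nonneg (hp k i)]
    by_cases hi : i ∈ s
    · simp only [b, if_pos hi]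
      exact le_add_of_nonneg_right (mul_nonneg (hp k i) (half_pos hε).le)
    · have hdist : dist (a i) l < ε / 2 := by simpa [hs] using hi
      simp only [b, if_neg hi, zero_add]
      exact mul_le_mul_of_nonneg_left hdist.le (hp k i)
  have hdiff : ∑' i, p k i * a i = ∑' i, p k i * (a i - l) + l := by
    have h := (Summable.of_norm_bounded hb.summable hle).hasSum.add (hk.mul_right l)
    simp only [← mul_add, sub_add_cancel, one_mul] at h
    exact h.tsum_eq
  rw [hdiff, dist_eq_norm, add_sub_cancel_right]
  linarith [tsum_of_norm_bounded hb hle]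

variable {X ι : Type*} [MeasurableSpace X]

lemma isFiniteMeasure_sum_smul (κ : ι → Measure X) [∀ i, IsProbabilityMeasure (κ i)] {u : ι → ℝ}
    (hu : Summable u) : IsFiniteMeasure (Measure.sum fun i => ENNReal.ofReal (u i) • κ i) := by
  refine ⟨?_⟩
  rw [Measure.sum_apply _ MeasurableSet.univ]
  simpa using hu.tsum_ofReal_lt_top

lemma integral_normalized_sum_smul {κ : ι → Measure X} {u : ι → ℝ} (hu : ∀ i, 0 ≤ u i)
    (hsum : Summable u) {f : X → ℝ}
    (hf : Integrable f (Measure.sum fun i => ENNReal.ofReal (u i) • κ i)) :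
    ∫ x, f x ∂((∑' i, ENNReal.ofReal (u i))⁻¹ • Measure.sum fun i => ENNReal.ofReal (u i) • κ i)
      = ∑' i, u i / (∑' j, u j) * ∫ x, f x ∂κ i := by
  rw [integral_smul_measure, ENNReal.toReal_inv, ← ENNReal.ofReal_tsum_of_nonneg hu hsum,
    ENNReal.toReal_ofReal (tsum_nonneg hu), smul_eq_mul, ← (hasSum_integral_measure hf).tsum_eq,
    ← tsum_mul_left]
  refine tsum_congr fun i => ?_
  rw [integral_smul_measure, ENNReal.toReal_ofReal (hu i), smul_eq_mul]
  ring

lemma summable_iff_tsum_ofReal_ne_top {f : ι → ℝ} (hf : ∀ i, 0 ≤ f i) :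
    Summable f ↔ ∑' i, ENNReal.ofReal (f i) ≠ ∞ :=
  ⟨fun h => h.tsum_ofReal_lt_top.ne,
    fun h => (ENNReal.summable_toReal h).congr fun i => ENNReal.toReal_ofReal (hf i)⟩

end WeightedAverage

namespace BowenSeries

/-! ### The geodesics of the generators -/

section Geometry

variable {d : ℕ}

/-- Position of the arc `I_a` in counter-clockwise order, starting at `1`. -/
def letterIndex (a : Letter d) : ℕ := if a.2 then a.1 else 2 * d - 1 - a.1

lemma letterIndex_lt (a : Letter d) : letterIndex a < 2 * d := by
  have := a.1.2
  unfold letterIndex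
  split_ifs <;> omega

lemma letterIndex_injective : Function.Injective (letterIndex (d := d)) := by
  rintro ⟨i, s⟩ ⟨j, t⟩ h
  have hi := i.2
  have hj := j.2
  have hval : i.1 = j.1 ∧ s = t := by
    cases s <;> cases t <;> simp [letterIndex] at h ⊢ <;> omega
  exact Prod.ext (Fin.ext hval.1) hval.2

lemma exists_letterIndex_eq {k : ℕ} (hk : k < 2 * d) : ∃ a : Letter d, letterIndex a = k := by
  by_cases h : k < d
  · exact ⟨(⟨k, h⟩, true), rfl⟩
  · exact ⟨(⟨2 * d - 1 - k, by omega⟩, false), by simp [letterIndex]; omega⟩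

@[simp] lemma Letter.neg_neg (a : Letter d) : a.neg.neg = a := by simp [Letter.neg]

lemma Letter.neg_injective : Function.Injective (Letter.neg (d := d)) :=
  Function.LeftInverse.injective Letter.neg_neg

lemma Letter.neg_ne (a : Letter d) : a.neg ≠ a := fun h => by
  simpa [Letter.neg] using congrArg Prod.snd h

lemma letterIndex_neg_add (a : Letter d) :
    (letterIndex a.neg : ℝ) + letterIndex a + 1 = 2 * d := by
  have : letterIndex a.neg + letterIndex a + 1 = 2 * d := by
    have := a.1.2
    obtain ⟨i, _ | _⟩ := a <;> simp [letterIndex, Letter.neg] at * <;> omega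
  exact_mod_cast this

/-- Initial point of the arc `I_a`, in counter-clockwise order. -/
def arcStart (a : Letter d) : Circle := vertex d (letterIndex a)

/-- Final point of the arc `I_a`, in counter-clockwise order. -/
def arcEnd (a : Letter d) : Circle := vertex d (letterIndex a + 1)

/-- Half of the angle under which an arc `I_a` is seen from the origin. -/
def halfAngle (d : ℕ) : ℝ := Real.pi / (2 * d)

/-- Argument of the midpoint of the arc `I_a`, normalised to lie in `[0, 2π)`. -/
def midAngle (a : Letter d) : ℝ := (2 * letterIndex a + 1) * halfAngle d

/-- Centre of the Euclidean circle containing the geodesic with the same end points as `I_a`. -/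
def center (a : Letter d) : ℂ :=
  if a.2 then geodesicCenter d a.1 else starRingEnd ℂ (geodesicCenter d a.1)

lemma center_neg (a : Letter d) : center a.neg = starRingEnd ℂ (center a) := by
  obtain ⟨i, _ | _⟩ := a <;> simp [center, Letter.neg]

lemma halfAngle_pos (hd : 2 ≤ d) : 0 < halfAngle d := (angle_mem hd).1

lemma natCast_mul_halfAngle (hd : 2 ≤ d) : (d : ℝ) * halfAngle d = Real.pi / 2 := by
  have : (0 : ℝ) < d := by positivity
  rw [halfAngle]; field_simp

lemma halfAngle_le (hd : 2 ≤ d) : halfAngle d ≤ Real.pi / 4 := by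
  have h2 : (2 : ℝ) ≤ d := by exact_mod_cast hd
  nlinarith [halfAngle_pos hd, natCast_mul_halfAngle hd]

lemma cos_halfAngle_pos (hd : 2 ≤ d) : 0 < Real.cos (halfAngle d) := cos_angle_pos hd

lemma geodesicRadius_eq_sin_div_cos :
    geodesicRadius d = Real.sin (halfAngle d) / Real.cos (halfAngle d) :=
  Real.tan_eq_sin_div_cos _

lemma vertex_eq (j : ℕ) : vertex d j = Circle.exp (2 * j * halfAngle d) := by
  rw [vertex, halfAngle]
  congr 1
  by_cases h : (d : ℝ) = 0
  · simp [h]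
  · field_simp

lemma midAngle_neg (hd : 2 ≤ d) (a : Letter d) : midAngle a.neg = 2 * Real.pi - midAngle a := by
  rw [midAngle, midAngle]
  linear_combination (2 * halfAngle d) * letterIndex_neg_add a + 4 * natCast_mul_halfAngle hd

lemma center_eq (hd : 2 ≤ d) (a : Letter d) :
    center a = (Circle.exp (midAngle a) : ℂ) / (Real.cos (halfAngle d) : ℂ) := by
  have center_true (i : Fin d) : center (i, true)
      = (Circle.exp (midAngle (i, true)) : ℂ) / (Real.cos (halfAngle d) : ℂ) := by
    simp only [center, if_true, geodesicCenter, midAngle, letterIndex, halfAngle]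
    congr 3
    ring
  obtain ⟨i, _ | _⟩ := a
  · change center (Letter.neg (i, true)) = (Circle.exp (midAngle (Letter.neg (i, true))) : ℂ) / _
    rw [center_neg, center_true, midAngle_neg hd, circleExp_two_pi_sub, Circle.coe_inv_eq_conj,
      map_div₀, Complex.conj_ofReal]
  · exact center_true i

lemma normSq_center (hd : 2 ≤ d) (a : Letter d) : ‖center a‖ ^ 2 = 1 + geodesicRadius d ^ 2 := by
  rw [← normSq_geodesicCenter hd a.1, center]
  split_ifs
  · rfl
  · rw [RCLike.norm_conj]

lemma ne_center (hd : 2 ≤ d) (a : Letter d) {z : ℂ} (hz : ‖z‖ ≤ 1) : z ≠ center a := by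
  rintro rfl
  nlinarith [norm_nonneg (center a), normSq_center hd a, geodesicRadius_pos hd]

lemma dist_center_center (hd : 2 ≤ d) (a b : Letter d) :
    dist (center a) (center b)
      = |2 * Real.sin (((letterIndex a : ℝ) - letterIndex b) * halfAngle d)|
        / Real.cos (halfAngle d) := by
  have hangle : (midAngle a - midAngle b) / 2
      = ((letterIndex a : ℝ) - letterIndex b) * halfAngle d := by
    rw [midAngle, midAngle]; ring
  rw [center_eq hd, center_eq hd, Complex.dist_eq, ← sub_div, norm_div, Complex.norm_real,
    Real.norm_eq_abs, abs_of_pos (cos_halfAngle_pos hd), norm_circleExp_sub_circleExp, hangle]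

lemma two_mul_geodesicRadius_le_dist (hd : 2 ≤ d) {a b : Letter d} (hab : a ≠ b) :
    2 * geodesicRadius d ≤ dist (center a) (center b) := by
  wlog hlt : letterIndex b < letterIndex a generalizing a b
  · rw [dist_comm]
    exact this hab.symm (lt_of_le_of_ne (not_lt.1 hlt) (letterIndex_injective.ne hab))
  have h0 := halfAngle_pos hd
  have hba : (letterIndex b : ℝ) + 1 ≤ letterIndex a := by exact_mod_cast hlt
  have had : (letterIndex a : ℝ) + 1 ≤ 2 * d := by exact_mod_cast letterIndex_lt a
  have hsin := sin_le_sin_of_le_of_le_pi_sub h0.le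
    (t := ((letterIndex a : ℝ) - letterIndex b) * halfAngle d) (by nlinarith)
    (by nlinarith [natCast_mul_halfAngle hd])
  rw [dist_center_center hd, geodesicRadius_eq_sin_div_cos, ← mul_div_assoc]
  exact div_le_div_of_nonneg_right ((by linarith : _ ≤ _).trans (le_abs_self _))
    (cos_halfAngle_pos hd).le

lemma dist_center_eq_of_ne (hd : 2 ≤ d) {a b : Letter d} (hab : a ≠ b) {z : ℂ}
    (ha : dist z (center a) ≤ geodesicRadius d) (hb : dist z (center b) ≤ geodesicRadius d) :
    dist z (center a) = geodesicRadius d := by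
  linarith [two_mul_geodesicRadius_le_dist hd hab, dist_triangle_left (center a) (center b) z]

lemma eq_midpoint_center_of_ne (hd : 2 ≤ d) {a b : Letter d} (hab : a ≠ b) {z : ℂ}
    (ha : dist z (center a) ≤ geodesicRadius d) (hb : dist z (center b) ≤ geodesicRadius d) :
    z = midpoint ℝ (center a) (center b) := by
  have ha' := dist_center_eq_of_ne hd hab ha hb
  have hb' := dist_center_eq_of_ne hd hab.symm hb ha
  have hle := two_mul_geodesicRadius_le_dist hd hab
  have htri := dist_triangle_left (center a) (center b) z
  apply eq_midpoint_of_dist_eq_half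
  · rw [dist_comm, ha']; linarith
  · rw [hb']; linarith

lemma le_dist_center_of_ne (hd : 2 ≤ d) {a b : Letter d} (hab : a ≠ b) {z : ℂ}
    (ha : dist z (center a) ≤ geodesicRadius d) : geodesicRadius d ≤ dist z (center b) := by
  linarith [two_mul_geodesicRadius_le_dist hd hab, dist_triangle_left (center a) (center b) z]

lemma center_injective (hd : 2 ≤ d) : Function.Injective (center (d := d)) := by
  intro a b h
  by_contra hab
  have := two_mul_geodesicRadius_le_dist hd hab
  rw [h, dist_self] at this
  linarith [geodesicRadius_pos hd]

lemma eq_of_dist_center_le_three (hd : 2 ≤ d) {a b c : Letter d} (hab : a ≠ b) (hac : a ≠ c)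
    {z : ℂ} (ha : dist z (center a) ≤ geodesicRadius d)
    (hb : dist z (center b) ≤ geodesicRadius d) (hc : dist z (center c) ≤ geodesicRadius d) :
    b = c := by
  have hmid := (eq_midpoint_center_of_ne hd hab ha hb).symm.trans
    (eq_midpoint_center_of_ne hd hac ha hc)
  rw [midpoint_eq_midpoint_iff_vsub_eq_vsub, vsub_self, vsub_eq_sub] at hmid
  exact center_injective hd (sub_eq_zero.1 hmid.symm).symm

/-! ### Arcs -/

lemma mem_arc_neg (a : Letter d) (x : Circle) : x ∈ arc a.neg ↔ x⁻¹ ∈ arc a := by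
  have : (fun t : ℝ => Circle.exp (if a.neg.2 then t else -t))
      = fun t => (Circle.exp (if a.2 then t else -t))⁻¹ := by
    obtain ⟨i, _ | _⟩ := a <;> simp [Letter.neg, Circle.exp_neg]
  simp only [arc, this, mem_image, inv_eq_iff_eq_inv]
  rfl

lemma mem_arc_iff_exists (hd : 2 ≤ d) (a : Letter d) (x : Circle) :
    x ∈ arc a ↔ ∃ t, |t - midAngle a| ≤ halfAngle d ∧ Circle.exp t = x := by
  have hangle : ∀ j : ℝ, Real.pi * j / d = 2 * j * halfAngle d := by
    intro j; rw [halfAngle]; field_simp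
  have mem_arc_true (i : Fin d) (x : Circle) : x ∈ arc (i, true) ↔
      ∃ t, |t - midAngle (i, true)| ≤ halfAngle d ∧ Circle.exp t = x := by
    simp only [arc, if_true, mem_image, mem_Icc, hangle, midAngle, letterIndex, abs_le]
    refine exists_congr fun t => and_congr_left fun _ => ?_
    constructor <;> rintro ⟨h₁, h₂⟩ <;> constructor <;> linarith
  obtain ⟨i, _ | _⟩ := a
  · change x ∈ arc (Letter.neg (i, true)) ↔ ∃ t, |t - midAngle (Letter.neg (i, true))| ≤ _ ∧ _
    rw [mem_arc_neg, mem_arc_true, midAngle_neg hd]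
    refine ⟨fun ⟨t, ht, hx⟩ => ⟨2 * Real.pi - t, ?_, ?_⟩,
      fun ⟨t, ht, hx⟩ => ⟨2 * Real.pi - t, ?_, ?_⟩⟩
    · rwa [sub_sub_sub_cancel_left, abs_sub_comm]
    · rw [circleExp_two_pi_sub, hx, inv_inv]
    · rwa [abs_sub_comm, show midAngle (i, true) - (2 * Real.pi - t)
        = t - (2 * Real.pi - midAngle (i, true)) by ring]
    · rw [circleExp_two_pi_sub, hx]
  · exact mem_arc_true i x

lemma sq_dist_exp_center (hd : 2 ≤ d) (a : Letter d) (t : ℝ) :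
    dist (Circle.exp t : ℂ) (center a) ^ 2 - geodesicRadius d ^ 2
      = 2 * (Real.cos (halfAngle d) - Real.cos (t - midAngle a)) / Real.cos (halfAngle d) := by
  have hc := cos_halfAngle_pos hd
  have hcenter : center a
      = ((Real.cos (halfAngle d))⁻¹ : ℝ) * (Circle.exp (midAngle a) : ℂ) := by
    rw [center_eq hd]; push_cast; field_simp
  rw [Complex.dist_eq, ← Complex.normSq_eq_norm_sq, Complex.normSq_apply,
    geodesicRadius_eq_sin_div_cos, hcenter, Circle.coe_exp, Circle.coe_exp]
  simp only [Complex.sub_re, Complex.exp_ofReal_mul_I_re, Complex.sub_im,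
    Complex.exp_ofReal_mul_I_im, Complex.re_ofReal_mul, Complex.im_ofReal_mul]
  rw [Real.cos_sub]
  field_simp
  linear_combination Real.sin_sq_add_cos_sq (midAngle a) +
    Real.cos (halfAngle d) ^ 2 * Real.sin_sq_add_cos_sq t - Real.sin_sq_add_cos_sq (halfAngle d)

lemma dist_exp_center_le_iff (hd : 2 ≤ d) (a : Letter d) (t : ℝ) :
    dist (Circle.exp t : ℂ) (center a) ≤ geodesicRadius d ↔
      Real.cos (halfAngle d) ≤ Real.cos |t - midAngle a| := by
  have hc := cos_halfAngle_pos hd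
  rw [← sq_le_sq₀ dist_nonneg (geodesicRadius_pos hd).le, ← sub_nonpos, sq_dist_exp_center hd,
    div_le_iff₀ hc, Real.cos_abs]
  constructor <;> intro h <;> linarith

lemma mem_arc_iff (hd : 2 ≤ d) (a : Letter d) (x : Circle) :
    x ∈ arc a ↔ dist (x : ℂ) (center a) ≤ geodesicRadius d := by
  have h0 := halfAngle_pos hd
  have hle := halfAngle_le hd
  rw [mem_arc_iff_exists hd]
  constructor
  · rintro ⟨t, ht, rfl⟩
    rw [dist_exp_center_le_iff hd]
    exact Real.cos_le_cos_of_nonneg_of_le_pi (abs_nonneg _) (by linarith) ht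
  · intro h
    obtain ⟨t, ht, rfl⟩ := exists_mem_Ico_circleExp_eq (midAngle a - Real.pi) x
    have htπ : |t - midAngle a| ≤ Real.pi := abs_le.2 ⟨by linarith [ht.1], by linarith [ht.2]⟩
    rw [dist_exp_center_le_iff hd, Real.strictAntiOn_cos.le_iff_ge ⟨h0.le, by linarith⟩
      ⟨abs_nonneg _, htπ⟩] at h
    exact ⟨t, h, rfl⟩

lemma exp_midAngle_sub_halfAngle (a : Letter d) :
    Circle.exp (midAngle a - halfAngle d) = arcStart a := by
  rw [arcStart, vertex_eq, midAngle]; congr 1; ring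

lemma exp_midAngle_add_halfAngle (a : Letter d) :
    Circle.exp (midAngle a + halfAngle d) = arcEnd a := by
  rw [arcEnd, vertex_eq, midAngle]; congr 1; push_cast; ring

lemma eq_arcStart_or_arcEnd (hd : 2 ≤ d) (a : Letter d) {x : Circle}
    (hx : dist (x : ℂ) (center a) = geodesicRadius d) : x = arcStart a ∨ x = arcEnd a := by
  have h0 := halfAngle_pos hd
  have hle := halfAngle_le hd
  obtain ⟨t, ht, rfl⟩ := (mem_arc_iff_exists hd a x).1 ((mem_arc_iff hd a x).2 hx.le)
  have hcos := sq_dist_exp_center hd a t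
  rw [hx, sub_self, eq_comm, div_eq_zero_iff, or_iff_left (cos_halfAngle_pos hd).ne',
    ← Real.cos_abs (t - _)] at hcos
  have habs : |t - midAngle a| = halfAngle d :=
    Real.injOn_cos ⟨abs_nonneg _, by linarith⟩ ⟨h0.le, by linarith⟩ (by linarith)
  rcases (abs_eq h0.le).1 habs with h | h
  · right; rw [← exp_midAngle_add_halfAngle]; congr 1; linarith
  · left; rw [← exp_midAngle_sub_halfAngle]; congr 1; linarith

lemma arcEnd_neg (hd : 2 ≤ d) (a : Letter d) : arcEnd a.neg = (arcStart a)⁻¹ := by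
  rw [← exp_midAngle_add_halfAngle, ← exp_midAngle_sub_halfAngle, ← circleExp_two_pi_sub,
    midAngle_neg hd]
  congr 1; ring

lemma arcStart_injective (hd : 2 ≤ d) : Function.Injective (arcStart (d := d)) := by
  intro a b h
  have hpi := natCast_mul_halfAngle hd
  have h0 := halfAngle_pos hd
  have hmem : ∀ c : Letter d, 2 * (letterIndex c : ℝ) * halfAngle d ∈ Ico 0 (2 * Real.pi) := by
    intro c
    have : (letterIndex c : ℝ) + 1 ≤ 2 * d := by exact_mod_cast letterIndex_lt c
    exact ⟨by positivity, by nlinarith⟩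
  rw [arcStart, arcStart, vertex_eq, vertex_eq] at h
  have hangle := Circle.exp_injOn_Ico (by simp) (hmem a) (hmem b) h
  have : (letterIndex a : ℝ) = letterIndex b := by nlinarith [mul_right_cancel₀ h0.ne' hangle]
  exact letterIndex_injective (by exact_mod_cast this)

lemma exists_mem_arc_ne_arcEnd (hd : 2 ≤ d) (x : Circle) :
    ∃ a : Letter d, x ∈ arc a ∧ x ≠ arcEnd a := by
  have hpi := natCast_mul_halfAngle hd
  have h0 := halfAngle_pos hd
  obtain ⟨t, ht, rfl⟩ := exists_mem_Ico_circleExp_eq 0 x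
  have hk0 : 0 ≤ t / (2 * halfAngle d) := div_nonneg ht.1 (by linarith)
  have hk : ⌊t / (2 * halfAngle d)⌋₊ < 2 * d := by
    rw [Nat.floor_lt hk0, div_lt_iff₀ (by linarith)]
    push_cast
    nlinarith [ht.2]
  obtain ⟨a, ha⟩ := exists_letterIndex_eq hk
  have hlow := Nat.floor_le hk0
  have hupp := Nat.lt_floor_add_one (t / (2 * halfAngle d))
  rw [← ha, le_div_iff₀ (by linarith)] at hlow
  rw [← ha, div_lt_iff₀ (by linarith)] at hupp
  have hmid : midAngle a = 2 * letterIndex a * halfAngle d + halfAngle d := by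
    rw [midAngle]; ring
  refine ⟨a, (mem_arc_iff_exists hd a _).2
    ⟨t, abs_le.2 ⟨by linarith, by linarith⟩, rfl⟩, fun h => ?_⟩
  rw [← exp_midAngle_add_halfAngle] at h
  have := Circle.exp_injOn_Icc (a := midAngle a - halfAngle d) (b := midAngle a + halfAngle d)
    (by linarith [halfAngle_le hd, Real.pi_pos]) ⟨by linarith, by linarith⟩
    ⟨by linarith, le_rfl⟩ h
  linarith

lemma eq_of_mem_arc_ne_arcEnd (hd : 2 ≤ d) {a b : Letter d} {x : Circle}
    (ha : x ∈ arc a) (ha' : x ≠ arcEnd a) (hb : x ∈ arc b) (hb' : x ≠ arcEnd b) : a = b := by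
  by_contra hab
  rw [mem_arc_iff hd] at ha hb
  have hxa := (eq_arcStart_or_arcEnd hd a (dist_center_eq_of_ne hd hab ha hb)).resolve_right ha'
  have hxb := (eq_arcStart_or_arcEnd hd b
    (dist_center_eq_of_ne hd (Ne.symm hab) hb ha)).resolve_right hb'
  exact hab (arcStart_injective hd (hxa.symm.trans hxb))

end Geometry

/-! ### The action of reduced words on the closed disc -/

section WordAction

variable {d : ℕ}

lemma inversion_conj (c z : ℂ) (R : ℝ) :
    EuclideanGeometry.inversion (starRingEnd ℂ c) R (starRingEnd ℂ z)
      = starRingEnd ℂ (EuclideanGeometry.inversion c R z) := by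
  have : dist (starRingEnd ℂ z) (starRingEnd ℂ c) = dist z c := Complex.dist_conj_conj z c
  simp [EuclideanGeometry.inversion, this]

lemma coe_piece (hd : 2 ≤ d) (a : Letter d) (z : ClosedDisc) :
    (piece hd a z : ℂ) = starRingEnd ℂ
      (EuclideanGeometry.inversion (center a) (geodesicRadius d) z) := by
  obtain ⟨j, _ | _⟩ := a
  · rw [piece_false, ← inversion_conj]
    simp only [center, Bool.false_eq_true, if_false, Complex.conj_conj]
    rfl
  · rfl

lemma piece_neg (hd : 2 ≤ d) (a : Letter d) : piece hd a.neg = (piece hd a)⁻¹ := by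
  obtain ⟨j, _ | _⟩ := a <;> simp [piece, Letter.neg]

@[simp] lemma piece_neg_piece (hd : 2 ≤ d) (a : Letter d) (z : ClosedDisc) :
    piece hd a.neg (piece hd a z) = z := by simp [piece_neg]

@[simp] lemma piece_piece_neg (hd : 2 ≤ d) (a : Letter d) (z : ClosedDisc) :
    piece hd a (piece hd a.neg z) = z := by simp [piece_neg]

lemma coe_ne_center (hd : 2 ≤ d) (a : Letter d) (z : ClosedDisc) : (z : ℂ) ≠ center a :=
  ne_center hd a (mem_closedBall_zero_iff.1 z.2)

lemma dist_piece_center (hd : 2 ≤ d) (a : Letter d) (z : ClosedDisc) :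
    dist (piece hd a z : ℂ) (center a.neg) = geodesicRadius d ^ 2 / dist (z : ℂ) (center a) := by
  rw [coe_piece, center_neg, Complex.dist_conj_conj, EuclideanGeometry.dist_inversion_center]

lemma dist_piece_piece (hd : 2 ≤ d) (a : Letter d) (y z : ClosedDisc) :
    dist (piece hd a y) (piece hd a z) = geodesicRadius d ^ 2 /
      (dist (y : ℂ) (center a) * dist (z : ℂ) (center a)) * dist y z := by
  rw [Subtype.dist_eq, coe_piece, coe_piece, Complex.dist_conj_conj,
    EuclideanGeometry.dist_inversion_inversion (coe_ne_center hd a y) (coe_ne_center hd a z),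
    Subtype.dist_eq]

lemma continuous_piece (hd : 2 ≤ d) (a : Letter d) : Continuous (piece hd a) := by
  refine Continuous.subtype_mk (f := fun z => (piece hd a z : ℂ)) ?_ (fun z => (piece hd a z).2)
  simp only [coe_piece]
  exact Complex.continuous_conj.comp (continuous_const.inversion continuous_const
    continuous_subtype_val fun z => coe_ne_center hd a z)

/-- The closed half disc bounded by `C_a` and `I_a`. -/
def halfDisc (a : Letter d) : Set ClosedDisc :=
  {z | dist (z : ℂ) (center a) ≤ geodesicRadius d}

lemma isClosed_halfDisc (a : Letter d) : IsClosed (halfDisc a) :=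
  isClosed_le (continuous_subtype_val.dist continuous_const) continuous_const

/-- The closed half disc on the other side of `C_a`. -/
def coHalfDisc (a : Letter d) : Set ClosedDisc :=
  {z | geodesicRadius d ≤ dist (z : ℂ) (center a)}

lemma halfDisc_subset_coHalfDisc (hd : 2 ≤ d) {a b : Letter d} (h : a ≠ b) :
    halfDisc a ⊆ coHalfDisc b := fun _ hz => le_dist_center_of_ne hd h hz

lemma piece_mem_halfDisc (hd : 2 ≤ d) {a : Letter d} {z : ClosedDisc} (hz : z ∈ coHalfDisc a) :
    piece hd a z ∈ halfDisc a.neg := by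
  have hR := geodesicRadius_pos hd
  rw [halfDisc, mem_ofPred_eq, dist_piece_center, div_le_iff₀ (hR.trans_le hz), sq]
  exact mul_le_mul_of_nonneg_left hz hR.le

lemma piece_mem_coHalfDisc (hd : 2 ≤ d) {a : Letter d} {z : ClosedDisc} (hz : z ∈ halfDisc a) :
    piece hd a z ∈ coHalfDisc a.neg := by
  have hR := geodesicRadius_pos hd
  have hpos : 0 < dist (z : ℂ) (center a) := dist_pos.2 (coe_ne_center hd a z)
  rw [coHalfDisc, mem_ofPred_eq, dist_piece_center, le_div_iff₀ hpos, sq]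
  exact mul_le_mul_of_nonneg_left hz hR.le

lemma dist_piece_le (hd : 2 ≤ d) {a : Letter d} {y z : ClosedDisc}
    (hy : y ∈ coHalfDisc a) (hz : z ∈ coHalfDisc a) :
    dist (piece hd a y) (piece hd a z) ≤ dist y z := by
  have hR := geodesicRadius_pos hd
  rw [dist_piece_piece]
  refine mul_le_of_le_one_left dist_nonneg
    ((div_le_one (mul_pos (hR.trans_le hy) (hR.trans_le hz))).2 ?_)
  rw [sq]
  exact mul_le_mul hy hz hR.le (hR.le.trans hy)

lemma dist_piece_lt (hd : 2 ≤ d) {a b : Letter d} (hba : b ≠ a) {y z : ClosedDisc}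
    (hy : y ∈ halfDisc b) (hz : z ∈ halfDisc b) (hyz : y ≠ z) :
    dist (piece hd a y) (piece hd a z) < dist y z := by
  have hR := geodesicRadius_pos hd
  have hy' := halfDisc_subset_coHalfDisc hd hba hy
  have hz' := halfDisc_subset_coHalfDisc hd hba hz
  rw [dist_piece_piece]
  refine mul_lt_of_lt_one_left (dist_pos.2 hyz)
    ((div_lt_one (mul_pos (hR.trans_le hy') (hR.trans_le hz'))).2 ?_)
  by_contra! hle
  rw [coHalfDisc, mem_ofPred_eq] at hy' hz'
  -- Without contraction both points would be the single point where the two half discs touch.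
  have hya : dist (y : ℂ) (center a) ≤ geodesicRadius d := by
    by_contra! hlt; nlinarith
  have hza : dist (z : ℂ) (center a) ≤ geodesicRadius d := by
    by_contra! hlt; nlinarith
  exact hyz (Subtype.ext ((eq_midpoint_center_of_ne hd hba hy hya).trans
    (eq_midpoint_center_of_ne hd hba hz hza).symm))

lemma exists_dist_piece_le_sub_of_ne (hd : 2 ≤ d) {a b : Letter d} (hba : b ≠ a) {ε : ℝ}
    (hε : 0 < ε) : ∃ δ > 0, ∀ y ∈ halfDisc b, ∀ z ∈ halfDisc b, ε ≤ dist y z →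
      dist (piece hd a y) (piece hd a z) ≤ dist y z - δ := by
  let K : Set (ClosedDisc × ClosedDisc) :=
    (halfDisc b ×ˢ halfDisc b) ∩ {q | ε ≤ dist q.1 q.2}
  have mem_K {y z} (hy : y ∈ halfDisc b) (hz : z ∈ halfDisc b) (hyz : ε ≤ dist y z) :
      (y, z) ∈ K := ⟨⟨hy, hz⟩, hyz⟩
  have hK : IsCompact K := (((isClosed_halfDisc b).prod (isClosed_halfDisc b)).inter
    (isClosed_le continuous_const continuous_dist)).isCompact
  have hgain : Continuous fun q : ClosedDisc × ClosedDisc =>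
      dist q.1 q.2 - dist (piece hd a q.1) (piece hd a q.2) := by
    have := continuous_piece hd a
    fun_prop
  rcases K.eq_empty_or_nonempty with hempty | hnonempty
  · refine ⟨1, one_pos, fun y hy z hz hyz => ?_⟩
    simpa only [hempty, mem_empty_iff_false] using mem_K hy hz hyz
  · obtain ⟨q, hq, hmin⟩ := hK.exists_isMinOn hnonempty hgain.continuousOn
    refine ⟨_, sub_pos.2 (dist_piece_lt hd hba hq.1.1 hq.1.2
      (dist_pos.1 (hε.trans_le hq.2))), fun y hy z hz hyz => ?_⟩
    exact le_sub_comm.1 (hmin (mem_K hy hz hyz))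

lemma exists_dist_piece_le_sub (hd : 2 ≤ d) {ε : ℝ} (hε : 0 < ε) :
    ∃ δ > 0, ∀ a b : Letter d, b ≠ a → ∀ y ∈ halfDisc b, ∀ z ∈ halfDisc b, ε ≤ dist y z →
      dist (piece hd a y) (piece hd a z) ≤ dist y z - δ := by
  have hpair : ∀ p : Letter d × Letter d, ∃ δ > 0, p.2 ≠ p.1 → ∀ y ∈ halfDisc p.2,
      ∀ z ∈ halfDisc p.2, ε ≤ dist y z →
        dist (piece hd p.1 y) (piece hd p.1 z) ≤ dist y z - δ := by
    intro p
    by_cases hp : p.2 = p.1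
    · exact ⟨1, one_pos, fun h => absurd hp h⟩
    · obtain ⟨δ, hδ, h⟩ := exists_dist_piece_le_sub_of_ne hd hp hε
      exact ⟨δ, hδ, fun _ => h⟩
  choose δ hδ h using hpair
  have : Nonempty (Letter d) := ⟨(⟨0, by omega⟩, true)⟩
  obtain ⟨p, hp⟩ := Finite.exists_min δ
  exact ⟨δ p, hδ p, fun a b hab y hy z hz hyz =>
    (h (a, b) hab y hy z hz hyz).trans (sub_le_sub_left (hp _) _)⟩

/-- The action of a word in the generators. -/
def wordAct (hd : 2 ≤ d) (L : List (Letter d)) : Equiv.Perm ClosedDisc :=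
  (L.map (piece hd)).prod

lemma marking_mk (hd : 2 ≤ d) (L : List (Letter d)) :
    marking hd (FreeGroup.mk L) = wordAct hd L := by
  rw [marking, FreeGroup.lift_mk, wordAct]
  congr 1
  refine List.map_congr_left fun a _ => ?_
  obtain ⟨j, _ | _⟩ := a <;> rfl

@[simp] lemma wordAct_nil (hd : 2 ≤ d) (z : ClosedDisc) : wordAct hd [] z = z := rfl

@[simp] lemma wordAct_cons (hd : 2 ≤ d) (a : Letter d) (L : List (Letter d)) (z : ClosedDisc) :
    wordAct hd (a :: L) z = piece hd a (wordAct hd L z) := by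
  simp [wordAct]

lemma wordAct_append (hd : 2 ≤ d) (L M : List (Letter d)) (z : ClosedDisc) :
    wordAct hd (L ++ M) z = wordAct hd L (wordAct hd M z) := by
  simp [wordAct]

lemma norm_wordAct (hd : 2 ≤ d) (L : List (Letter d)) {z : ClosedDisc} (hz : ‖(z : ℂ)‖ = 1) :
    ‖(wordAct hd L z : ℂ)‖ = 1 := by
  induction L with
  | nil => exact hz
  | cons a L ih => rw [wordAct_cons]; exact norm_piece hd a _ ih

lemma Letter.eq_neg_iff (a b : Letter d) : b = a.neg ↔ a.1 = b.1 ∧ a.2 ≠ b.2 := by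
  obtain ⟨i, s⟩ := a
  obtain ⟨j, t⟩ := b
  cases s <;> cases t <;> simp [Letter.neg, eq_comm]

lemma Letter.neg_eq_iff {a b : Letter d} : b.neg = a ↔ b = a.neg := by
  rw [← Letter.neg_injective.eq_iff, Letter.neg_neg]

lemma isReduced_cons_cons_iff {a b : Letter d} {L : List (Letter d)} :
    FreeGroup.IsReduced (a :: b :: L) ↔ b ≠ a.neg ∧ FreeGroup.IsReduced (b :: L) := by
  rw [FreeGroup.isReduced_cons_cons, Ne, Letter.eq_neg_iff]
  simp

lemma ne_neg_of_isReduced_append {L M : List (Letter d)} {a b : Letter d}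
    (h : FreeGroup.IsReduced (L ++ a :: M)) (hb : b ∈ L.getLast?) : a ≠ b.neg := by
  rw [FreeGroup.IsReduced, List.isChain_append] at h
  have := h.2.2 b hb a (by simp)
  rw [Ne, Letter.eq_neg_iff]
  tauto

/-- The points of the disc on which the last letter of the word `L` acts as a contraction. -/
def wordDomain (L : List (Letter d)) : Set ClosedDisc :=
  {z | ∀ b ∈ L.getLast?, z ∈ coHalfDisc b}

lemma wordDomain_cons_cons (a b : Letter d) (L : List (Letter d)) :
    wordDomain (a :: b :: L) = wordDomain (b :: L) := by
  simp [wordDomain, List.getLast?_cons_cons]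

/-- The base point of the disc. -/
def origin : ClosedDisc := ⟨0, by simp⟩

lemma origin_mem_coHalfDisc (hd : 2 ≤ d) (a : Letter d) : origin ∈ coHalfDisc a := by
  rw [coHalfDisc, mem_ofPred_eq, origin, dist_comm, dist_zero_right]
  nlinarith [normSq_center hd a, norm_nonneg (center a), geodesicRadius_pos hd]

lemma origin_mem_wordDomain (hd : 2 ≤ d) (L : List (Letter d)) : origin ∈ wordDomain L :=
  fun b _ => origin_mem_coHalfDisc hd b

lemma wordAct_mem_halfDisc (hd : 2 ≤ d) {a : Letter d} {L : List (Letter d)}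
    (hL : FreeGroup.IsReduced (a :: L)) {z : ClosedDisc} (hz : z ∈ wordDomain (a :: L)) :
    wordAct hd (a :: L) z ∈ halfDisc a.neg := by
  induction L generalizing a with
  | nil => exact piece_mem_halfDisc hd (hz a (by simp))
  | cons b L ih =>
    rw [isReduced_cons_cons_iff] at hL
    rw [wordDomain_cons_cons] at hz
    rw [wordAct_cons]
    exact piece_mem_halfDisc hd
      (halfDisc_subset_coHalfDisc hd (Letter.neg_eq_iff.not.2 hL.1) (ih hL.2 hz))

lemma dist_wordAct_le_two_sub (hd : 2 ≤ d) {ε δ : ℝ}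
    (hcontract : ∀ a b : Letter d, b ≠ a → ∀ y ∈ halfDisc b, ∀ z ∈ halfDisc b, ε ≤ dist y z →
      dist (piece hd a y) (piece hd a z) ≤ dist y z - δ)
    {a : Letter d} {L : List (Letter d)} (hL : FreeGroup.IsReduced (a :: L)) {y z : ClosedDisc}
    (hy : y ∈ wordDomain (a :: L)) (hz : z ∈ wordDomain (a :: L))
    (hε : ε ≤ dist (wordAct hd (a :: L) y) (wordAct hd (a :: L) z)) :
    dist (wordAct hd (a :: L) y) (wordAct hd (a :: L) z) ≤ 2 - δ * L.length := by
  induction L generalizing a with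
  | nil =>
    have hle := dist_le_norm_add_norm (wordAct hd [a] y : ℂ) (wordAct hd [a] z)
    have hy1 := mem_closedBall_zero_iff.1 (wordAct hd [a] y).2
    have hz1 := mem_closedBall_zero_iff.1 (wordAct hd [a] z).2
    rw [Subtype.dist_eq, List.length_nil, Nat.cast_zero, mul_zero, sub_zero]
    linarith
  | cons b L ih =>
    obtain ⟨hba, hbL⟩ := isReduced_cons_cons_iff.1 hL
    rw [wordDomain_cons_cons] at hy hz
    have hy' := wordAct_mem_halfDisc hd hbL hy
    have hz' := wordAct_mem_halfDisc hd hbL hz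
    have hne : b.neg ≠ a := Letter.neg_eq_iff.not.2 hba
    rw [wordAct_cons hd a, wordAct_cons hd a] at hε ⊢
    have hε' := hε.trans (dist_piece_le hd (halfDisc_subset_coHalfDisc hd hne hy')
      (halfDisc_subset_coHalfDisc hd hne hz'))
    have hstep := hcontract a b.neg hne _ hy' _ hz' hε'
    have htail := ih hbL hy hz hε'
    push_cast [List.length_cons]
    linarith

lemma exists_length_dist_wordAct_lt (hd : 2 ≤ d) {ε : ℝ} (hε : 0 < ε) :
    ∃ n : ℕ, ∀ L : List (Letter d), FreeGroup.IsReduced L → n ≤ L.length →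
      ∀ y ∈ wordDomain L, ∀ z ∈ wordDomain L,
        dist (wordAct hd L y) (wordAct hd L z) < ε := by
  obtain ⟨δ, hδ, hcontract⟩ := exists_dist_piece_le_sub hd hε
  obtain ⟨n, hn⟩ := exists_nat_gt (2 / δ)
  refine ⟨n + 1, fun L hL hlen y hy z hz => ?_⟩
  obtain _ | ⟨a, L⟩ := L
  · simp at hlen
  by_contra! hge
  have hle := dist_wordAct_le_two_sub hd hcontract hL hy hz hge
  have hlen' : (n : ℝ) ≤ L.length := by exact_mod_cast (by simpa using hlen : n ≤ L.length)
  rw [div_lt_iff₀ hδ] at hn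
  nlinarith

lemma wordAct_mem_wordDomain (hd : 2 ≤ d) {L M : List (Letter d)}
    (h : FreeGroup.IsReduced (L ++ M)) {z : ClosedDisc} (hM : M ≠ []) (hz : z ∈ wordDomain M) :
    wordAct hd M z ∈ wordDomain L := by
  obtain _ | ⟨a, M⟩ := M
  · exact absurd rfl hM
  · intro b hb
    exact halfDisc_subset_coHalfDisc hd (Letter.neg_eq_iff.not.2 (ne_neg_of_isReduced_append h hb))
      (wordAct_mem_halfDisc hd (h.infix (List.suffix_append _ _).isInfix) hz)

lemma wordAct_origin_mem_wordDomain (hd : 2 ≤ d) {L M : List (Letter d)}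
    (h : FreeGroup.IsReduced (L ++ M)) : wordAct hd M origin ∈ wordDomain L := by
  by_cases hM : M = []
  · subst hM
    exact origin_mem_wordDomain hd L
  · exact wordAct_mem_wordDomain hd h hM (origin_mem_wordDomain hd M)

end WordAction

/-! ### Rays in the Cayley tree -/

section Rays

variable {d : ℕ}

lemma exists_toWord_eq_append_singleton {g h : FreeGroup (Fin d)} (hdist : wordDist g h = 1)
    (hnorm : h.norm = g.norm + 1) : ∃ a : Letter d, h.toWord = g.toWord ++ [a] := by
  obtain ⟨a, ha⟩ := List.length_eq_one_iff.1 (hdist : (g⁻¹ * h).toWord.length = 1)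
  have hsub := FreeGroup.toWord_mul_sublist g (g⁻¹ * h)
  rw [mul_inv_cancel_left, ha] at hsub
  exact ⟨a, hsub.eq_of_length (by rw [List.length_append]; exact hnorm)⟩

namespace IsGeneralizedRay

variable {c : ℕ → FreeGroup (Fin d)} {R : ℕ∞}

lemma norm_eq (hc : IsGeneralizedRay c R) {n : ℕ} (hn : (n : ℕ∞) ≤ R) : (c n).norm = n := by
  have := hc.geodesic 0 n (by simpa using hn)
  rwa [zero_add, wordDist, hc.base, inv_one, one_mul] at this

lemma toWord_succ_or_eq (hc : IsGeneralizedRay c R) (n : ℕ) :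
    (∃ a, (c (n + 1)).toWord = (c n).toWord ++ [a]) ∨ c (n + 1) = c n := by
  rcases le_or_gt ((n + 1 : ℕ) : ℕ∞) R with h | h
  · left
    refine exists_toWord_eq_append_singleton (hc.geodesic n 1 h) ?_
    rw [hc.norm_eq h, hc.norm_eq (le_trans (by exact_mod_cast Nat.le_succ n) h)]
  · right
    refine hc.constant n 1 ?_
    rw [Nat.cast_add, Nat.cast_one] at h
    exact Order.le_of_lt_add_one h

lemma toWord_prefix (hc : IsGeneralizedRay c R) (m k : ℕ) :
    (c m).toWord <+: (c (m + k)).toWord := by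
  induction k with
  | zero => exact List.prefix_rfl
  | succ k ih =>
    rcases hc.toWord_succ_or_eq (m + k) with ⟨a, ha⟩ | h
    · rw [← add_assoc, ha]; exact ih.trans (List.prefix_append _ _)
    · rw [← add_assoc, h]; exact ih

lemma norm_eq_or_constant (hc : IsGeneralizedRay c R) (n : ℕ) :
    (c n).norm = n ∨ ∀ k, c (n + k) = c n := by
  rcases le_total (n : ℕ∞) R with h | h
  · exact Or.inl (hc.norm_eq h)
  · exact Or.inr fun k => hc.constant n k h

lemma norm_le (hc : IsGeneralizedRay c R) (n : ℕ) : (c n).norm ≤ n := by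
  rcases le_total (n : ℕ∞) R with h | h
  · exact (hc.norm_eq h).le
  · lift R to ℕ using (h.trans_lt (ENat.natCast_lt_top n)).ne
    have hRn : R ≤ n := by exact_mod_cast h
    obtain ⟨k, rfl⟩ := Nat.exists_eq_add_of_le hRn
    rw [hc.constant R k le_rfl, hc.norm_eq le_rfl]
    exact hRn

lemma toWord_eq_take (hc : IsGeneralizedRay c R) (m k : ℕ) :
    (c m).toWord = (c (m + k)).toWord.take m := by
  rcases hc.norm_eq_or_constant m with h | h
  · have := List.prefix_iff_eq_take.1 (hc.toWord_prefix m k)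
    rwa [show (c m).toWord.length = m from h] at this
  · rw [h k, List.take_of_length_le (hc.norm_le m)]

end IsGeneralizedRay

instance (d : ℕ) : T2Space (Compactification d) := inferInstanceAs (T2Space (Subtype _))

instance (d : ℕ) : TopologicalSpace.MetrizableSpace (Compactification d) :=
  have : SecondCountableTopology (Compactification d) :=
    TopologicalSpace.Subtype.secondCountableTopology
      {c : ℕ → FreeGroup (Fin d) | ∃ R, IsGeneralizedRay c R}
  have : T3Space (Compactification d) := inferInstanceAs (T3Space (Subtype _))
  TopologicalSpace.metrizableSpace_of_t3_secondCountable _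

instance (d : ℕ) : T2Space (Boundary d) := inferInstanceAs (T2Space (Subtype _))

lemma ofVertex_apply (g : FreeGroup (Fin d)) {n : ℕ} (hn : g.norm ≤ n) :
    (ofVertex g).1 n = g := by
  change FreeGroup.mk (g.toWord.take n) = g
  rw [List.take_of_length_le hn, FreeGroup.mk_toWord]

lemma tendsto_ofVertex (c : Compactification d) :
    Tendsto (fun n => ofVertex (c.1 n)) atTop (𝓝 c) := by
  obtain ⟨c, R, hc⟩ := c
  refine (IsEmbedding.subtypeVal (p := fun c : ℕ → FreeGroup (Fin d) =>
    ∃ R, IsGeneralizedRay c R)).tendsto_nhds_iff.2 (tendsto_pi_nhds.2 fun m => ?_)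
  refine tendsto_const_nhds.congr' ?_
  filter_upwards [eventually_ge_atTop m] with n hn
  obtain ⟨k, rfl⟩ := Nat.exists_eq_add_of_le hn
  change c m = FreeGroup.mk ((c (m + k)).toWord.take m)
  rw [← hc.toWord_eq_take m k, FreeGroup.mk_toWord]

lemma denseRange_ofVertex (d : ℕ) : DenseRange (ofVertex (d := d)) := fun c =>
  mem_closure_of_tendsto (tendsto_ofVertex c) (Eventually.of_forall fun _ => mem_range_self _)

lemma isEmbedding_ofBoundary (d : ℕ) : IsEmbedding (ofBoundary (d := d)) := by
  refine IsEmbedding.of_comp (g := Subtype.val) ?_ continuous_subtype_val ?_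
  · exact Continuous.subtype_mk (f := fun ξ : Boundary d => ξ.1) continuous_subtype_val
      fun ξ => ⟨⊤, ξ.2⟩
  · exact IsEmbedding.subtypeVal

end Rays

/-! ### The Cannon–Thurston map -/

section CannonThurston

variable {d : ℕ}

/-- The orbit of the base point of the disc along a ray. -/
def rayOrbit (hd : 2 ≤ d) (n : ℕ) (c : Compactification d) : ClosedDisc :=
  marking hd (c.1 n) origin

lemma continuous_rayOrbit (hd : 2 ≤ d) (n : ℕ) : Continuous (rayOrbit hd n) :=
  (continuous_of_discreteTopology (f := fun g => marking hd g origin)).comp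
    ((continuous_apply n).comp continuous_subtype_val)

lemma marking_eq_wordAct (hd : 2 ≤ d) (g : FreeGroup (Fin d)) :
    marking hd g = wordAct hd g.toWord := by
  conv_lhs => rw [← FreeGroup.mk_toWord (x := g)]
  exact marking_mk hd _

lemma exists_dist_rayOrbit_lt (hd : 2 ≤ d) {ε : ℝ} (hε : 0 < ε) :
    ∃ N : ℕ, ∀ n ≥ N, ∀ c : Compactification d, ∀ k,
      dist (rayOrbit hd (n + k) c) (rayOrbit hd n c) < ε := by
  obtain ⟨N, hN⟩ := exists_length_dist_wordAct_lt hd hε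
  refine ⟨N, fun n hn c k => ?_⟩
  obtain ⟨c, R, hc⟩ := c
  rcases hc.norm_eq_or_constant n with hnorm | hconst
  · obtain ⟨M, hM⟩ := hc.toWord_prefix n k
    have hred : FreeGroup.IsReduced ((c n).toWord ++ M) := hM ▸ FreeGroup.isReduced_toWord
    simp only [rayOrbit, marking_eq_wordAct]
    rw [← hM, wordAct_append]
    exact hN _ FreeGroup.isReduced_toWord (hn.trans hnorm.ge) _
      (wordAct_origin_mem_wordDomain hd hred) _ (origin_mem_wordDomain hd _)
  · simp only [rayOrbit, hconst k, dist_self, hε]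

lemma exists_tendsto_rayOrbit (hd : 2 ≤ d) (c : Compactification d) :
    ∃ z, Tendsto (fun n => rayOrbit hd n c) atTop (𝓝 z) := by
  refine cauchySeq_tendsto_of_complete (Metric.cauchySeq_iff'.2 fun ε hε => ?_)
  obtain ⟨N, hN⟩ := exists_dist_rayOrbit_lt hd hε
  refine ⟨N, fun n hn => ?_⟩
  obtain ⟨k, rfl⟩ := Nat.exists_eq_add_of_le hn
  exact hN N le_rfl c k

/-- The continuous extension of the orbit map `g ↦ g · 0` to the compactification. -/
def orbitExtension (hd : 2 ≤ d) (c : Compactification d) : ClosedDisc :=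
  (exists_tendsto_rayOrbit hd c).choose

lemma tendsto_rayOrbit (hd : 2 ≤ d) (c : Compactification d) :
    Tendsto (fun n => rayOrbit hd n c) atTop (𝓝 (orbitExtension hd c)) :=
  (exists_tendsto_rayOrbit hd c).choose_spec

lemma continuous_orbitExtension (hd : 2 ≤ d) : Continuous (orbitExtension hd) := by
  refine TendstoUniformly.continuous (F := rayOrbit hd) (p := atTop) ?_
    (Frequently.of_forall fun n => continuous_rayOrbit hd n)
  rw [Metric.tendstoUniformly_iff]
  intro ε hε
  obtain ⟨N, hN⟩ := exists_dist_rayOrbit_lt hd (half_pos hε)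
  filter_upwards [eventually_ge_atTop N] with n hn c
  refine lt_of_le_of_lt ?_ (half_lt_self hε)
  refine le_of_tendsto ((tendsto_rayOrbit hd c).dist tendsto_const_nhds) ?_
  filter_upwards [eventually_ge_atTop n] with m hm
  obtain ⟨k, rfl⟩ := Nat.exists_eq_add_of_le hm
  exact (hN n hn c k).le

lemma orbitExtension_ofVertex (hd : 2 ≤ d) (g : FreeGroup (Fin d)) :
    orbitExtension hd (ofVertex g) = marking hd g origin := by
  refine tendsto_nhds_unique (tendsto_rayOrbit hd _) (tendsto_const_nhds.congr' ?_)
  filter_upwards [eventually_ge_atTop g.norm] with n hn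
  rw [rayOrbit, ofVertex_apply g hn]

end CannonThurston

/-! ### The identification of the shift space with the boundary -/

section ShiftBoundary

variable {d : ℕ}

lemma ShiftSpace.ne_neg (ω : ShiftSpace d) (k : ℕ) : ω.1 (k + 1) ≠ (ω.1 k).neg := by
  intro h
  have := ω.2 k
  rw [transitionMatrix, if_pos h] at this
  exact zero_ne_one this

/-- The element of the shift space given by an admissible sequence. -/
def ShiftSpace.ofAdmissible (w : ℕ → Letter d) (h : ∀ k, w (k + 1) ≠ (w k).neg) : ShiftSpace d :=
  ⟨w, fun k => by rw [transitionMatrix, if_neg (h k)]⟩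

lemma inversePrefix_succ_eq_append (ω : ShiftSpace d) (n : ℕ) :
    inversePrefix ω (n + 1) = inversePrefix ω n ++ [(ω.1 n).neg] := by
  simp [inversePrefix, List.range_succ]

lemma inversePrefix_succ_eq_cons (ω : ShiftSpace d) (n : ℕ) :
    inversePrefix ω (n + 1) = (ω.1 0).neg :: inversePrefix (shift ω) n := by
  simp [inversePrefix, List.range_succ_eq_map, shift, Function.comp_def]

lemma length_inversePrefix (ω : ShiftSpace d) (n : ℕ) : (inversePrefix ω n).length = n := by
  simp [inversePrefix]

lemma toWord_mk_inversePrefix (ω : ShiftSpace d) (n : ℕ) :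
    (FreeGroup.mk (inversePrefix ω n)).toWord = inversePrefix ω n := by
  rw [FreeGroup.toWord_mk, (isReduced_inversePrefix ω n).reduce_eq]

lemma inversePrefix_eq_iff (ω η : ShiftSpace d) (n : ℕ) :
    inversePrefix ω n = inversePrefix η n ↔ ω ∈ cylinder η n := by
  rw [inversePrefix, inversePrefix, List.map_inj_left]
  simp [cylinder, Letter.neg_injective.eq_iff]

lemma mk_inversePrefix_eq_iff (ω η : ShiftSpace d) (n : ℕ) :
    FreeGroup.mk (inversePrefix ω n) = FreeGroup.mk (inversePrefix η n) ↔ ω ∈ cylinder η n := by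
  rw [← inversePrefix_eq_iff, ← FreeGroup.toWord_inj, toWord_mk_inversePrefix,
    toWord_mk_inversePrefix]

lemma continuous_coord (n : ℕ) : Continuous fun ω : ShiftSpace d => ω.1 n :=
  (continuous_apply n).comp continuous_subtype_val

lemma continuous_mk_inversePrefix (n : ℕ) :
    Continuous fun ω : ShiftSpace d => FreeGroup.mk (inversePrefix ω n) := by
  induction n with
  | zero => exact continuous_const (y := FreeGroup.mk [])
  | succ n ih =>
    simp only [inversePrefix_succ_eq_append, ← FreeGroup.mul_mk]
    have hmul : Continuous fun p : FreeGroup (Fin d) × Letter d => p.1 * FreeGroup.mk [p.2.neg] :=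
      continuous_of_discreteTopology
    exact hmul.comp (ih.prodMk (continuous_coord n))

lemma continuous_toBoundary (d : ℕ) : Continuous (toBoundary (d := d)) :=
  Continuous.subtype_mk (continuous_pi continuous_mk_inversePrefix) fun ω => (toBoundary ω).2

lemma injective_toBoundary (d : ℕ) : Function.Injective (toBoundary (d := d)) := by
  intro ω η h
  refine Subtype.ext (funext fun k => ?_)
  have hprefix : FreeGroup.mk (inversePrefix ω (k + 1)) = FreeGroup.mk (inversePrefix η (k + 1)) :=
    congrFun (congrArg Subtype.val h) (k + 1)
  exact (mk_inversePrefix_eq_iff ω η (k + 1)).1 hprefix k (Nat.lt_succ_self k)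

lemma Boundary.exists_toWord_succ (ξ : Boundary d) (n : ℕ) :
    ∃ a, (ξ.1 (n + 1)).toWord = (ξ.1 n).toWord ++ [a] := by
  refine (ξ.2.toWord_succ_or_eq n).resolve_right fun h => ?_
  have := ξ.2.norm_eq (n := n + 1) le_top
  rw [h, ξ.2.norm_eq le_top] at this
  omega

lemma surjective_toBoundary (d : ℕ) : Function.Surjective (toBoundary (d := d)) := by
  intro ξ
  choose a ha using ξ.exists_toWord_succ
  change ℕ → Letter d at a
  have hadm : ∀ k, Letter.neg (a (k + 1)) ≠ (Letter.neg (a k)).neg := by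
    intro k h
    have hred : FreeGroup.IsReduced ((ξ.1 k).toWord ++ [a k] ++ [a (k + 1)]) := by
      rw [← ha, ← ha]; exact FreeGroup.isReduced_toWord
    exact ne_neg_of_isReduced_append hred (b := a k) (by simp) (Letter.neg_injective h)
  let ω := ShiftSpace.ofAdmissible (fun k => Letter.neg (a k)) hadm
  have hprefix : ∀ n, inversePrefix ω n = (ξ.1 n).toWord := by
    intro n
    induction n with
    | zero => simp [inversePrefix, ξ.2.base]
    | succ n ih => rw [inversePrefix_succ_eq_append, ih, ha]; simp [ω, ShiftSpace.ofAdmissible]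
  refine ⟨ω, Subtype.ext (funext fun n => ?_)⟩
  change FreeGroup.mk (inversePrefix ω n) = ξ.1 n
  rw [hprefix, FreeGroup.mk_toWord]

instance (d : ℕ) : CompactSpace (ShiftSpace d) := by
  have : IsClosed {ω : ℕ → Letter d | ∀ k, transitionMatrix d (ω k) (ω (k + 1)) = 1} := by
    simp only [ofPred_forall]
    refine isClosed_iInter fun k => ?_
    have hc : Continuous fun ω : ℕ → Letter d => (ω k, ω (k + 1)) :=
      (continuous_apply k).prodMk (continuous_apply (k + 1))
    exact IsClosed.preimage (t := {p | transitionMatrix d p.1 p.2 = 1}) hc (isClosed_discrete _)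
  exact isCompact_iff_compactSpace.1 this.isCompact

theorem isHomeomorph_toBoundary (d : ℕ) : IsHomeomorph (toBoundary (d := d)) :=
  isHomeomorph_iff_continuous_bijective.2
    ⟨continuous_toBoundary d, injective_toBoundary d, surjective_toBoundary d⟩

end ShiftBoundary

/-! ### The coding map -/

section Coding

variable {d : ℕ}

/-- The image of the infinite word `ω` under the Cannon–Thurston map, as a point of the disc. -/
def discCoding (hd : 2 ≤ d) (ω : ShiftSpace d) : ClosedDisc :=
  orbitExtension hd (ofBoundary (toBoundary ω))

lemma continuous_discCoding (hd : 2 ≤ d) : Continuous (discCoding hd) :=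
  (continuous_orbitExtension hd).comp
    ((isEmbedding_ofBoundary d).continuous.comp (continuous_toBoundary d))

lemma tendsto_discCoding (hd : 2 ≤ d) (ω : ShiftSpace d) :
    Tendsto (fun n => wordAct hd (inversePrefix ω n) origin) atTop (𝓝 (discCoding hd ω)) :=
  (tendsto_rayOrbit hd _).congr fun n =>
    congrFun (congrArg DFunLike.coe (marking_mk hd (inversePrefix ω n))) origin

lemma halfDisc_subset_wordDomain (hd : 2 ≤ d) (ω : ShiftSpace d) (n : ℕ) :
    halfDisc (ω.1 n) ⊆ wordDomain (inversePrefix ω n) := by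
  intro z hz b hb
  have hred := isReduced_inversePrefix ω (n + 1)
  rw [inversePrefix_succ_eq_append] at hred
  have hne : ω.1 n ≠ b := Letter.neg_injective.ne_iff.1 (ne_neg_of_isReduced_append hred hb)
  exact halfDisc_subset_coHalfDisc hd hne hz

lemma tendsto_wordAct (hd : 2 ≤ d) (ω : ShiftSpace d) {z : ℕ → ClosedDisc}
    (hz : ∀ n, z n ∈ halfDisc (ω.1 n)) :
    Tendsto (fun n => wordAct hd (inversePrefix ω n) (z n)) atTop (𝓝 (discCoding hd ω)) := by
  refine tendsto_of_tendsto_of_dist (tendsto_discCoding hd ω) ?_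
  rw [Metric.tendsto_atTop]
  intro ε hε
  obtain ⟨N, hN⟩ := exists_length_dist_wordAct_lt hd hε
  refine ⟨N, fun n hn => ?_⟩
  rw [Real.dist_0_eq_abs, abs_of_nonneg dist_nonneg]
  exact hN _ (isReduced_inversePrefix ω n) (by rwa [length_inversePrefix]) _
    (origin_mem_wordDomain hd _) _ (halfDisc_subset_wordDomain hd ω n (hz n))

lemma arcStart_mem_arc (hd : 2 ≤ d) (a : Letter d) : arcStart a ∈ arc a :=
  (mem_arc_iff_exists hd a _).2 ⟨midAngle a - halfAngle d,
    by rw [sub_sub_cancel_left, abs_neg, abs_of_pos (halfAngle_pos hd)],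
    exp_midAngle_sub_halfAngle a⟩

lemma circleToDisc_mem_halfDisc (hd : 2 ≤ d) {a : Letter d} {x : Circle} :
    circleToDisc x ∈ halfDisc a ↔ x ∈ arc a := (mem_arc_iff hd a x).symm

lemma norm_discCoding (hd : 2 ≤ d) (ω : ShiftSpace d) : ‖(discCoding hd ω : ℂ)‖ = 1 := by
  have htends := tendsto_wordAct hd ω (z := fun n => circleToDisc (arcStart (ω.1 n)))
    fun n => (circleToDisc_mem_halfDisc hd).2 (arcStart_mem_arc hd _)
  refine tendsto_nhds_unique
    (((continuous_norm.comp continuous_subtype_val).tendsto _).comp htends)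
    (tendsto_const_nhds.congr fun n => ?_)
  exact (norm_wordAct hd _ (Circle.norm_coe _)).symm

/-- The image of the infinite word `ω` under the Cannon–Thurston map, as a point of the circle. -/
def coding (hd : 2 ≤ d) (ω : ShiftSpace d) : Circle :=
  ⟨discCoding hd ω, mem_sphere_zero_iff_norm.2 (norm_discCoding hd ω)⟩

lemma circleToDisc_coding (hd : 2 ≤ d) (ω : ShiftSpace d) :
    circleToDisc (coding hd ω) = discCoding hd ω := rfl

lemma circleToDisc_injective : Function.Injective circleToDisc := fun _ _ h =>
  Circle.ext (congrArg (fun z : ClosedDisc => (z : ℂ)) h)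

lemma continuous_circleToDisc : Continuous circleToDisc :=
  Continuous.subtype_mk (continuous_subtype_val (p := (· ∈ Submonoid.unitSphere ℂ))) _

lemma continuous_coding (hd : 2 ≤ d) : Continuous (coding hd) :=
  Continuous.subtype_mk (continuous_subtype_val.comp (continuous_discCoding hd)) _

lemma discCoding_eq_piece (hd : 2 ≤ d) (ω : ShiftSpace d) :
    discCoding hd ω = piece hd (ω.1 0).neg (discCoding hd (shift ω)) := by
  have hshift := ((continuous_piece hd (ω.1 0).neg).tendsto _).comp
    (tendsto_discCoding hd (shift ω))
  refine tendsto_nhds_unique ((tendsto_discCoding hd ω).comp (tendsto_add_atTop_nat 1))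
    (hshift.congr fun n => ?_)
  simp only [Function.comp, inversePrefix_succ_eq_cons, wordAct_cons]

lemma coding_mem_arc (hd : 2 ≤ d) (ω : ShiftSpace d) : coding hd ω ∈ arc (ω.1 0) := by
  rw [← circleToDisc_mem_halfDisc hd, circleToDisc_coding]
  refine (isClosed_halfDisc _).mem_of_tendsto
    ((tendsto_discCoding hd ω).comp (tendsto_add_atTop_nat 1)) (Eventually.of_forall fun n => ?_)
  have hred := isReduced_inversePrefix ω (n + 1)
  simp only [Function.comp, inversePrefix_succ_eq_cons] at hred ⊢
  have := wordAct_mem_halfDisc hd hred (origin_mem_wordDomain hd _)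
  rwa [Letter.neg_neg] at this

lemma circleToDisc_bowenSeries (hd : 2 ≤ d) {a : Letter d} {x : Circle} (hx : x ∈ arc a) :
    circleToDisc (bowenSeries hd x) = piece hd a (circleToDisc x) :=
  Subtype.ext (bowenSeries_eq_piece hd a x hx)

lemma semiconj_coding (hd : 2 ≤ d) :
    Function.Semiconj (coding hd) shift (bowenSeries hd) := fun ω => by
  apply circleToDisc_injective
  rw [circleToDisc_bowenSeries hd (coding_mem_arc hd ω), circleToDisc_coding, circleToDisc_coding,
    discCoding_eq_piece hd ω, piece_piece_neg]

lemma eq_coding_of_forall_mem_arc (hd : 2 ≤ d) (ω : ShiftSpace d) {x : Circle}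
    (hx : ∀ n, (bowenSeries hd)^[n] x ∈ arc (ω.1 n)) : x = coding hd ω := by
  apply circleToDisc_injective
  have htends := tendsto_wordAct hd ω (z := fun n => circleToDisc ((bowenSeries hd)^[n] x))
    fun n => (circleToDisc_mem_halfDisc hd).2 (hx n)
  refine tendsto_nhds_unique (tendsto_const_nhds.congr fun n => ?_) htends
  induction n with
  | zero => simp [inversePrefix]
  | succ n ih =>
    rw [ih, inversePrefix_succ_eq_append, wordAct_append, Function.iterate_succ_apply',
      wordAct_cons, wordAct_nil, circleToDisc_bowenSeries hd (hx n), piece_neg_piece]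

theorem isCannonThurston_iff (hd : 2 ≤ d) (ψ : Boundary d → Circle) :
    IsCannonThurston hd ψ ↔ ψ ∘ toBoundary = coding hd := by
  constructor
  · rintro ⟨Φ, hΦ, hvertex, hboundary⟩
    have hext : Φ = orbitExtension hd := (denseRange_ofVertex d).equalizer hΦ
      (continuous_orbitExtension hd)
      (funext fun g => (hvertex g).trans (orbitExtension_ofVertex hd g).symm)
    funext ω
    apply circleToDisc_injective
    rw [Function.comp, ← hboundary, hext, circleToDisc_coding, discCoding]
  · intro h
    refine ⟨orbitExtension hd, continuous_orbitExtension hd, orbitExtension_ofVertex hd,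
      (surjective_toBoundary d).forall.2 fun ω => ?_⟩
    exact congrArg circleToDisc (congrFun h ω).symm

lemma IsCannonThurston.continuous {hd : 2 ≤ d} {ψ : Boundary d → Circle}
    (h : IsCannonThurston hd ψ) : Continuous ψ := by
  rw [(isHomeomorph_toBoundary d).isQuotientMap.continuous_iff, (isCannonThurston_iff hd ψ).1 h]
  exact continuous_coding hd

theorem existsUnique_isCannonThurston (hd : 2 ≤ d) :
    ∃! ψ : Boundary d → Circle, IsCannonThurston hd ψ := by
  let e := (isHomeomorph_toBoundary d).homeomorph
  simp only [isCannonThurston_iff]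
  exact ⟨coding hd ∘ e.symm, funext fun ω => congrArg (coding hd) (e.symm_apply_apply ω),
    fun ψ hψ => (Equiv.eq_comp_symm e.toEquiv ψ (coding hd)).2 hψ⟩

end Coding

/-! ### The symbolic coding of the Bowen–Series map -/

section SymbolicCoding

variable {d : ℕ}

lemma isEmbedding_circleToDisc : IsEmbedding circleToDisc :=
  (continuous_circleToDisc.isClosedEmbedding circleToDisc_injective).isEmbedding

lemma isClosed_arc (hd : 2 ≤ d) (a : Letter d) : IsClosed (arc a) := by
  have harc : arc a = circleToDisc ⁻¹' halfDisc a :=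
    Set.ext fun x => (circleToDisc_mem_halfDisc hd).symm
  exact harc ▸ (isClosed_halfDisc a).preimage continuous_circleToDisc

lemma continuous_bowenSeries (hd : 2 ≤ d) : Continuous (bowenSeries hd) := by
  refine (locallyFinite_of_finite (arc (d := d))).continuous ?_ (isClosed_arc hd) fun a => ?_
  · refine Set.eq_univ_of_forall fun x => mem_iUnion.2 ?_
    exact (exists_mem_arc_ne_arcEnd hd x).imp fun _ => And.left
  · rw [isEmbedding_circleToDisc.continuousOn_iff]
    exact ((continuous_piece hd a).comp continuous_circleToDisc).continuousOn.congr
      fun x hx => circleToDisc_bowenSeries hd hx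

/-- The label of the arc containing `x`, the one starting at `x` if there are two of them. -/
def ccwLabel (hd : 2 ≤ d) (x : Circle) : Letter d :=
  (exists_mem_arc_ne_arcEnd hd x).choose

lemma mem_arc_ccwLabel (hd : 2 ≤ d) (x : Circle) : x ∈ arc (ccwLabel hd x) :=
  (exists_mem_arc_ne_arcEnd hd x).choose_spec.1

lemma ne_arcEnd_ccwLabel (hd : 2 ≤ d) (x : Circle) : x ≠ arcEnd (ccwLabel hd x) :=
  (exists_mem_arc_ne_arcEnd hd x).choose_spec.2

lemma ccwLabel_eq_iff (hd : 2 ≤ d) (x : Circle) (a : Letter d) :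
    ccwLabel hd x = a ↔ x ∈ arc a ∧ x ≠ arcEnd a := by
  constructor
  · rintro rfl
    exact ⟨mem_arc_ccwLabel hd x, ne_arcEnd_ccwLabel hd x⟩
  · exact fun h =>
      eq_of_mem_arc_ne_arcEnd hd (mem_arc_ccwLabel hd x) (ne_arcEnd_ccwLabel hd x) h.1 h.2

lemma measurable_ccwLabel (hd : 2 ≤ d) : Measurable (ccwLabel hd) := by
  refine measurable_to_countable' fun a => ?_
  have hfiber : ccwLabel hd ⁻¹' {a} = arc a \ {arcEnd a} :=
    Set.ext fun x => ccwLabel_eq_iff hd x a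
  rw [hfiber]
  exact (isClosed_arc hd a).measurableSet.diff (measurableSet_singleton _)

lemma bowenSeries_of_dist_eq (hd : 2 ≤ d) {a : Letter d} {x : Circle}
    (hx : dist (x : ℂ) (center a) = geodesicRadius d) : bowenSeries hd x = x⁻¹ := by
  refine Circle.ext ?_
  rw [Circle.coe_inv_eq_conj, bowenSeries_eq_piece hd a x ((mem_arc_iff hd a x).2 hx.le),
    coe_piece]
  exact congrArg _ (EuclideanGeometry.inversion_of_mem_sphere hx)

lemma dist_center_eq_of_piece_mem (hd : 2 ≤ d) {a : Letter d} {z : ClosedDisc}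
    (hz : z ∈ halfDisc a) (h : piece hd a z ∈ halfDisc a.neg) :
    dist (z : ℂ) (center a) = geodesicRadius d := by
  have hpos : 0 < dist (z : ℂ) (center a) := dist_pos.2 (coe_ne_center hd a z)
  have hpiece : dist (piece hd a z : ℂ) (center a.neg) = geodesicRadius d :=
    le_antisymm h (piece_mem_coHalfDisc hd hz)
  rw [dist_piece_center, div_eq_iff hpos.ne', sq] at hpiece
  exact (mul_left_cancel₀ (geodesicRadius_pos hd).ne' hpiece).symm

/-- Only the end points of `I_a` are mapped into `I_{-a}`, and the half-open labelling sends the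
initial one to the excluded end point of `I_{-a}`. -/
lemma ccwLabel_bowenSeries_ne (hd : 2 ≤ d) (x : Circle) :
    ccwLabel hd (bowenSeries hd x) ≠ (ccwLabel hd x).neg := by
  set a := ccwLabel hd x
  intro h
  rw [ccwLabel_eq_iff, arcEnd_neg hd] at h
  have hx : x ∈ arc a := mem_arc_ccwLabel hd x
  have himage := (circleToDisc_mem_halfDisc hd).2 h.1
  rw [circleToDisc_bowenSeries hd hx] at himage
  have hdist : dist (x : ℂ) (center a) = geodesicRadius d :=
    dist_center_eq_of_piece_mem hd ((circleToDisc_mem_halfDisc hd).2 hx) himage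
  have hstart : x = arcStart a :=
    (eq_arcStart_or_arcEnd hd a hdist).resolve_right (ne_arcEnd_ccwLabel hd x)
  exact h.2 (by rw [bowenSeries_of_dist_eq hd hdist, ← hstart])

/-- The itinerary of a point of the circle under the Bowen–Series map, read off with `ccwLabel`:
a measurable section of `coding`. -/
def ccwItinerary (hd : 2 ≤ d) (x : Circle) : ShiftSpace d :=
  ShiftSpace.ofAdmissible (fun n => ccwLabel hd ((bowenSeries hd)^[n] x)) fun n => by
    rw [Function.iterate_succ_apply']
    exact ccwLabel_bowenSeries_ne hd _

lemma ccwItinerary_apply (hd : 2 ≤ d) (x : Circle) (n : ℕ) :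
    (ccwItinerary hd x).1 n = ccwLabel hd ((bowenSeries hd)^[n] x) := rfl

lemma coding_ccwItinerary (hd : 2 ≤ d) (x : Circle) : coding hd (ccwItinerary hd x) = x :=
  (eq_coding_of_forall_mem_arc hd (ccwItinerary hd x) fun _ => mem_arc_ccwLabel hd _).symm

lemma surjective_coding (hd : 2 ≤ d) : Function.Surjective (coding hd) :=
  fun x => ⟨_, coding_ccwItinerary hd x⟩

lemma shift_ccwItinerary (hd : 2 ≤ d) (x : Circle) :
    shift (ccwItinerary hd x) = ccwItinerary hd (bowenSeries hd x) :=
  Subtype.ext (funext fun n => by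
    simp only [shift, ccwItinerary_apply, Function.iterate_succ_apply])

lemma measurable_shiftSpace {X : Type*} [MeasurableSpace X] {f : X → ShiftSpace d}
    (hf : ∀ n, Measurable fun x => (f x).1 n) : Measurable f := by
  have hborel : borel (ShiftSpace d) = MeasurableSpace.comap Subtype.val MeasurableSpace.pi := by
    rw [(inferInstance : BorelSpace (ℕ → Letter d)).measurable_eq]
    exact borel_comap
  refine Measurable.mono (measurable_comap_iff.2 (measurable_pi_iff.2 hf)) le_rfl ?_
  exact hborel.le

lemma measurable_coord (n : ℕ) : Measurable fun ω : ShiftSpace d => ω.1 n :=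
  (continuous_coord n).measurable

lemma continuous_shift : Continuous (shift (d := d)) :=
  Continuous.subtype_mk (continuous_pi fun k => continuous_coord (k + 1)) _

lemma measurable_ccwItinerary (hd : 2 ≤ d) : Measurable (ccwItinerary hd) :=
  measurable_shiftSpace fun n =>
    (measurable_ccwLabel hd).comp ((continuous_bowenSeries hd).measurable.iterate n)

lemma shift_iterate_apply (ω : ShiftSpace d) (n k : ℕ) :
    (shift^[n] ω).1 k = ω.1 (k + n) := by
  induction n generalizing k with
  | zero => rfl
  | succ n ih => rw [Function.iterate_succ_apply', shift, ih, add_right_comm, add_assoc]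

lemma arcEnd_mem_closure (hd : 2 ≤ d) (a : Letter d) : arcEnd a ∈ closure (arc a \ {arcEnd a}) := by
  have hpos := halfAngle_pos hd
  have hmem : midAngle a + halfAngle d ∈ closure (Ico (midAngle a) (midAngle a + halfAngle d)) := by
    rw [closure_Ico (by linarith)]
    exact right_mem_Icc.2 (by linarith)
  rw [← exp_midAngle_add_halfAngle]
  refine map_mem_closure Circle.exp.continuous hmem fun t ht => ⟨?_, fun hexp => ?_⟩
  · exact (mem_arc_iff_exists hd a _).2
      ⟨t, abs_le.2 ⟨by linarith [ht.1], by linarith [ht.2]⟩, rfl⟩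
  · refine ht.2.ne (Circle.exp_injOn_Icc ?_ (Ico_subset_Icc_self ht)
      (right_mem_Icc.2 (by linarith)) hexp)
    linarith [halfAngle_le hd, Real.pi_pos]

lemma coding_image_cylinder (hd : 2 ≤ d) (a : Letter d) :
    coding hd '' {ω | ω.1 0 = a} = arc a := by
  have hclosed : IsClosed (coding hd '' {ω | ω.1 0 = a}) :=
    (((isClosed_discrete {a}).preimage (continuous_coord 0)).isCompact.image
      (continuous_coding hd)).isClosed
  have hsub : arc a \ {arcEnd a} ⊆ coding hd '' {ω | ω.1 0 = a} := fun x hx =>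
    ⟨ccwItinerary hd x, (ccwLabel_eq_iff hd x a).2 hx, coding_ccwItinerary hd x⟩
  refine Subset.antisymm ?_ fun x hx => ?_
  · rintro _ ⟨ω, rfl, rfl⟩
    exact coding_mem_arc hd ω
  · obtain rfl | hne := eq_or_ne x (arcEnd a)
    · exact closure_minimal hsub hclosed (arcEnd_mem_closure hd a)
    · exact hsub ⟨hx, hne⟩

theorem isSymbolicCoding_iff (hd : 2 ≤ d) (ψ : ShiftSpace d → Circle) :
    IsSymbolicCoding hd ψ ↔ ψ = coding hd := by
  constructor
  · intro h
    funext ω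
    refine eq_coding_of_forall_mem_arc hd ω fun n => ?_
    rw [← h.semiconj.iterate_right n ω, ← h.image_cylinder]
    exact ⟨_, by simp [shift_iterate_apply], rfl⟩
  · rintro rfl
    exact ⟨continuous_coding hd, surjective_coding hd, semiconj_coding hd,
      coding_image_cylinder hd⟩

end SymbolicCoding

/-! ### The Parry measure -/

section Parry

variable {d : ℕ}

instance (d : ℕ) : SecondCountableTopology (ShiftSpace d) :=
  TopologicalSpace.Subtype.secondCountableTopology _

lemma isOpen_cylinder (ω : ShiftSpace d) (n : ℕ) : IsOpen (cylinder ω n) := by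
  have hcylinder : cylinder ω n = ⋂ k ∈ Finset.range n, {η : ShiftSpace d | η.1 k = ω.1 k} := by
    ext η; simp [cylinder]
  rw [hcylinder]
  exact isOpen_biInter_finset fun k _ => (isOpen_discrete {ω.1 k}).preimage (continuous_coord k)

lemma measurableSet_cylinder (ω : ShiftSpace d) (n : ℕ) : MeasurableSet (cylinder ω n) :=
  (isOpen_cylinder ω n).measurableSet

lemma mem_cylinder_self (ω : ShiftSpace d) (n : ℕ) : ω ∈ cylinder ω n := fun _ _ => rfl

lemma cylinder_eq_of_mem {ω η : ShiftSpace d} {n : ℕ} (h : η ∈ cylinder ω n) :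
    cylinder η n = cylinder ω n := by
  ext ζ
  exact ⟨fun hζ k hk => (hζ k hk).trans (h k hk), fun hζ k hk => (hζ k hk).trans (h k hk).symm⟩

lemma cylinder_zero (ω : ShiftSpace d) : cylinder ω 0 = univ := by
  simp [cylinder]

lemma isTopologicalBasis_cylinder (d : ℕ) :
    TopologicalSpace.IsTopologicalBasis {s | ∃ ω n, s = cylinder (d := d) ω n} := by
  refine TopologicalSpace.isTopologicalBasis_of_isOpen_of_nhds ?_ fun ω u hω hu => ?_
  · rintro _ ⟨ω, n, rfl⟩
    exact isOpen_cylinder ω n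
  · obtain ⟨v, hv, rfl⟩ := hu
    obtain ⟨_, ⟨x, n, rfl⟩, hx, hsub⟩ :=
      (PiNat.isTopologicalBasis_cylinders fun _ => Letter d).exists_subset_of_mem_open hω hv
    exact ⟨cylinder ω n, ⟨ω, n, rfl⟩, mem_cylinder_self ω n, fun η hη =>
      hsub fun k hk => (hη k hk).trans (hx k hk)⟩

lemma isPiSystem_cylinder (d : ℕ) : IsPiSystem {s | ∃ ω n, s = cylinder (d := d) ω n} := by
  rintro _ ⟨ω, n, rfl⟩ _ ⟨η, k, rfl⟩ ⟨ζ, hζω, hζη⟩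
  refine ⟨ζ, max n k, ?_⟩
  rw [← cylinder_eq_of_mem hζω, ← cylinder_eq_of_mem hζη]
  ext ξ
  simp only [cylinder, mem_inter_iff, mem_ofPred_eq, lt_max_iff, or_imp, forall_and]

lemma ext_of_cylinder {m m' : Measure (ShiftSpace d)} [IsProbabilityMeasure m]
    [IsProbabilityMeasure m'] (h : ∀ ω n, m (cylinder ω (n + 1)) = m' (cylinder ω (n + 1))) :
    m = m' := by
  refine ext_of_generate_finite _ (isTopologicalBasis_cylinder d).borel_eq_generateFrom
    (isPiSystem_cylinder d) ?_ (by simp)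
  rintro _ ⟨ω, _ | n, rfl⟩
  · simp [cylinder_zero]
  · exact h ω n

lemma IsParryMeasure.unique {P Q : Measure (ShiftSpace d)} (hP : IsParryMeasure P)
    (hQ : IsParryMeasure Q) : P = Q := by
  have := hP.isProbabilityMeasure
  have := hQ.isProbabilityMeasure
  exact ext_of_cylinder fun ω n => (hP.measure_cylinder ω n).trans (hQ.measure_cylinder ω n).symm

lemma card_letter (d : ℕ) : Fintype.card (Letter d) = 2 * d := by
  simp [mul_comm]

lemma card_filter_ne (a : Letter d) :
    (Finset.univ.filter fun b : Letter d => b ≠ a).card = 2 * d - 1 := by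
  rw [Finset.filter_ne', Finset.card_erase_of_mem (Finset.mem_univ a), Finset.card_univ,
    card_letter]

/-- An enumeration of the letters that may follow `a`. -/
def successor (a : Letter d) : Fin (2 * d - 1) ≃ {b : Letter d // b ≠ a.neg} :=
  Fintype.equivOfCardEq (by rw [Fintype.card_fin, Fintype.card_subtype, card_filter_ne])

/-- The admissible word with first letter `a` whose `(k + 1)`-st letter is the `x k`-th of the
letters that may follow the `k`-th one. -/
def wordOfSuccessors (a : Letter d) (x : ℕ → Fin (2 * d - 1)) : ℕ → Letter d
  | 0 => a
  | k + 1 => (successor (wordOfSuccessors a x k) (x k)).1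

/-- The parametrization of the shift space by independent choices of the successive letters. -/
def ofSuccessors (p : Letter d × (ℕ → Fin (2 * d - 1))) : ShiftSpace d :=
  ShiftSpace.ofAdmissible (wordOfSuccessors p.1 p.2) fun k =>
    (successor (wordOfSuccessors p.1 p.2 k) (p.2 k)).2

lemma measurable_ofSuccessors (d : ℕ) : Measurable (ofSuccessors (d := d)) := by
  refine measurable_shiftSpace fun n => ?_
  change Measurable fun p : Letter d × (ℕ → Fin (2 * d - 1)) => wordOfSuccessors p.1 p.2 n
  induction n with
  | zero => exact measurable_fst
  | succ n ih =>
    have hsuccessor : Measurable (Function.uncurry fun (a : Letter d) i => (successor a i).1) :=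
      measurable_of_countable _
    have hx : Measurable fun p : Letter d × (ℕ → Fin (2 * d - 1)) => p.2 n :=
      (measurable_pi_apply n).comp measurable_snd
    simp only [wordOfSuccessors]
    generalize hF : (Function.uncurry fun (a : Letter d) i => (successor a i).1) = F at hsuccessor
    have hF' : ∀ a i, (successor a i).1 = F (a, i) := fun a i => hF ▸ rfl
    simp only [hF']
    exact hsuccessor.comp (ih.prodMk hx)

lemma ofSuccessors_preimage_cylinder (ω : ShiftSpace d) (n : ℕ) :
    ofSuccessors ⁻¹' cylinder ω (n + 1) = {ω.1 0} ×ˢ Set.pi (Finset.range n)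
      fun k => {(successor (ω.1 k)).symm ⟨ω.1 (k + 1), ω.ne_neg k⟩} := by
  ext ⟨a, x⟩
  simp only [mem_preimage, mem_prod, mem_singleton_iff, Set.mem_pi, Finset.coe_range, mem_Iio,
    Equiv.eq_symm_apply, Subtype.ext_iff]
  change (∀ k < n + 1, wordOfSuccessors a x k = ω.1 k) ↔ _
  constructor
  · intro h
    refine ⟨h 0 (by omega), fun k hk => ?_⟩
    have hsucc := h (k + 1) (by omega)
    rwa [wordOfSuccessors, h k (by omega)] at hsucc
  · rintro ⟨hzero, hsucc⟩ k hk
    induction k with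
    | zero => exact hzero
    | succ k ih =>
      rw [wordOfSuccessors, ih (by omega)]
      exact hsucc k (by omega)

lemma natCast_two_mul_sub_one (hd : 2 ≤ d) : ((2 * d - 1 : ℕ) : ℝ) = 2 * d - 1 := by
  rw [Nat.cast_sub (by omega)]
  push_cast
  ring

lemma ofReal_parryMass (hd : 2 ≤ d) (n : ℕ) :
    ENNReal.ofReal (1 / (2 * d * (2 * d - 1) ^ n))
      = ((2 * d : ℕ) : ℝ≥0∞)⁻¹ * (((2 * d - 1 : ℕ) : ℝ≥0∞)⁻¹) ^ n := by
  have hpos : (0 : ℝ) < (2 * d - 1 : ℕ) := by exact_mod_cast (by omega : 0 < 2 * d - 1)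
  have hpos' : (0 : ℝ) < (2 * d : ℕ) := by exact_mod_cast (by omega : 0 < 2 * d)
  rw [← natCast_two_mul_sub_one hd, one_div, mul_inv, ← inv_pow, ENNReal.ofReal_mul (by positivity),
    ENNReal.ofReal_pow (by positivity), ENNReal.ofReal_inv_of_pos hpos, ENNReal.ofReal_natCast,
    show (2 * d : ℝ) = (2 * d : ℕ) by push_cast; ring, ENNReal.ofReal_inv_of_pos hpos',
    ENNReal.ofReal_natCast]

theorem exists_isParryMeasure (hd : 2 ≤ d) : ∃ P : Measure (ShiftSpace d), IsParryMeasure P := by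
  have : Nonempty (Letter d) := ⟨(⟨0, by omega⟩, true)⟩
  have : Nonempty (Fin (2 * d - 1)) := ⟨⟨0, by omega⟩⟩
  let U : Measure (Letter d) := (PMF.uniformOfFintype (Letter d)).toMeasure
  let V : Measure (Fin (2 * d - 1)) := (PMF.uniformOfFintype (Fin (2 * d - 1))).toMeasure
  let W : Measure (Letter d × (ℕ → Fin (2 * d - 1))) := U.prod (Measure.infinitePi fun _ => V)
  have hU : ∀ a, U {a} = ((2 * d : ℕ) : ℝ≥0∞)⁻¹ := fun a => by
    rw [PMF.toMeasure_apply_singleton _ _ (measurableSet_singleton _),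
      PMF.uniformOfFintype_apply, card_letter]
  have hV : ∀ i, V {i} = ((2 * d - 1 : ℕ) : ℝ≥0∞)⁻¹ := fun i => by
    rw [PMF.toMeasure_apply_singleton _ _ (measurableSet_singleton _),
      PMF.uniformOfFintype_apply, Fintype.card_fin]
  refine ⟨W.map ofSuccessors,
    Measure.isProbabilityMeasure_map (measurable_ofSuccessors d).aemeasurable, fun ω n => ?_⟩
  rw [Measure.map_apply (measurable_ofSuccessors d) (measurableSet_cylinder ω _),
    ofSuccessors_preimage_cylinder, Measure.prod_prod,
    Measure.infinitePi_pi _ fun _ _ => measurableSet_singleton _, ofReal_parryMass hd]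
  simp only [hU, hV, Finset.prod_const, Finset.card_range]

/-- The word `a ω`, for a letter `a` that may precede `ω`. -/
def ShiftSpace.cons (a : Letter d) (ω : ShiftSpace d) (h : ω.1 0 ≠ a.neg) : ShiftSpace d :=
  ShiftSpace.ofAdmissible (fun n => Nat.casesOn n a ω.1) fun k =>
    match k with
    | 0 => h
    | k + 1 => ω.ne_neg k

lemma mem_cylinder_cons {a : Letter d} {ω : ShiftSpace d} {h : ω.1 0 ≠ a.neg} {n : ℕ}
    {η : ShiftSpace d} :
    η ∈ cylinder (ω.cons a h) (n + 1) ↔ η.1 0 = a ∧ shift η ∈ cylinder ω n := by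
  constructor
  · exact fun hη => ⟨hη 0 (by omega), fun k hk => hη (k + 1) (by omega)⟩
  · rintro ⟨hzero, hshift⟩ (_ | k) hk
    · exact hzero
    · exact hshift k (by omega)

lemma ne_neg_comm {a b : Letter d} : a ≠ b.neg ↔ b ≠ a.neg := by
  rw [Ne, Ne, ← Letter.neg_eq_iff, eq_comm]

lemma shift_preimage_cylinder (ω : ShiftSpace d) (n : ℕ) :
    shift ⁻¹' cylinder ω (n + 1)
      = ⋃ a : {a : Letter d // a ≠ (ω.1 0).neg},
        cylinder (ω.cons a.1 (ne_neg_comm.1 a.2)) (n + 2) := by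
  ext η
  simp only [mem_preimage, mem_iUnion, mem_cylinder_cons]
  constructor
  · intro h
    have hfirst : η.1 1 = ω.1 0 := h 0 (by omega)
    exact ⟨⟨η.1 0, hfirst ▸ ne_neg_comm.1 (η.ne_neg 0)⟩, rfl, h⟩
  · rintro ⟨a, -, h⟩
    exact h

lemma IsParryMeasure.measurePreserving_shift (hd : 2 ≤ d) {P : Measure (ShiftSpace d)}
    (hP : IsParryMeasure P) : MeasurePreserving shift P P := by
  have := hP.isProbabilityMeasure
  have hne : ((2 * d - 1 : ℕ) : ℝ≥0∞) ≠ 0 := by exact_mod_cast (by omega : 2 * d - 1 ≠ 0)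
  refine ⟨continuous_shift.measurable, IsParryMeasure.unique ⟨?_, fun ω n => ?_⟩ hP⟩
  · exact Measure.isProbabilityMeasure_map continuous_shift.measurable.aemeasurable
  rw [Measure.map_apply continuous_shift.measurable (measurableSet_cylinder ω _),
    shift_preimage_cylinder, measure_iUnion _ fun _ => measurableSet_cylinder _ _]
  · simp only [hP.measure_cylinder, ofReal_parryMass hd]
    rw [tsum_fintype, Finset.sum_const, Finset.card_univ, Fintype.card_subtype, card_filter_ne,
      nsmul_eq_mul, pow_succ, mul_left_comm, mul_left_comm _ (_ ^ n),
      ENNReal.mul_inv_cancel hne (ENNReal.natCast_ne_top _), mul_one]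
  · intro a b hab
    refine Set.disjoint_left.2 fun η ha hb => hab (Subtype.ext ?_)
    exact (mem_cylinder_cons.1 ha).1.symm.trans (mem_cylinder_cons.1 hb).1

lemma IsParryMeasure.measure_singleton (hd : 2 ≤ d) {P : Measure (ShiftSpace d)}
    (hP : IsParryMeasure P) (ω : ShiftSpace d) : P {ω} = 0 := by
  have hlt : ((2 * d - 1 : ℕ) : ℝ≥0∞)⁻¹ < 1 :=
    ENNReal.inv_lt_one.2 (by exact_mod_cast (by omega : 1 < 2 * d - 1))
  have hne : ((2 * d : ℕ) : ℝ≥0∞)⁻¹ ≠ ∞ :=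
    ENNReal.inv_ne_top.2 (by exact_mod_cast (by omega : 2 * d ≠ 0))
  have hlim := ENNReal.Tendsto.const_mul (ENNReal.tendsto_pow_atTop_nhds_zero_of_lt_one hlt)
    (Or.inr hne)
  rw [mul_zero] at hlim
  refine le_antisymm (ge_of_tendsto' hlim fun n => ?_) bot_le
  rw [← ofReal_parryMass hd, ← hP.measure_cylinder ω n]
  exact measure_mono (singleton_subset_iff.2 (mem_cylinder_self ω _))

end Parry

/-! ### Patterson–Sullivan measures -/

section PattersonSullivan

variable {d : ℕ}

/-- The vertex at distance `n` from the base point on the ray coded by `ω`. -/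
def rayVertex (n : ℕ) (ω : ShiftSpace d) : FreeGroup (Fin d) :=
  FreeGroup.mk (inversePrefix ω n)

lemma norm_rayVertex (n : ℕ) (ω : ShiftSpace d) : (rayVertex n ω).norm = n := by
  rw [FreeGroup.norm, rayVertex, toWord_mk_inversePrefix, length_inversePrefix]

lemma continuous_rayVertex (n : ℕ) : Continuous (rayVertex (d := d) n) :=
  continuous_mk_inversePrefix n

lemma continuous_ofVertex_rayVertex (n : ℕ) :
    Continuous fun ω : ShiftSpace d => ofVertex (rayVertex n ω) :=
  Continuous.comp (g := ofVertex) continuous_of_discreteTopology (continuous_rayVertex n)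

-- A reduced word is continued by repeating its last letter.
lemma exists_rayVertex_eq (hd : 2 ≤ d) (g : FreeGroup (Fin d)) :
    ∃ ω : ShiftSpace d, rayVertex g.norm ω = g := by
  have : Inhabited (Letter d) := ⟨(⟨0, by omega⟩, true)⟩
  set L : List (Letter d) := g.toWord with hL
  let w : ℕ → Letter d := fun k => Letter.neg (L.getD (min k (L.length - 1)) default)
  have hadmissible : ∀ k, w (k + 1) ≠ (w k).neg := by
    intro k h
    replace h : L.getD (min (k + 1) (L.length - 1)) default
      = Letter.neg (L.getD (min k (L.length - 1)) default) := Letter.neg_injective h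
    by_cases hk : k + 1 < L.length
    · rw [min_eq_left (by omega), min_eq_left (by omega), List.getD_eq_getElem _ _ hk,
        List.getD_eq_getElem _ _ (by omega), Letter.eq_neg_iff] at h
      have hreduced : FreeGroup.IsReduced L := FreeGroup.isReduced_toWord
      rw [FreeGroup.IsReduced, List.isChain_iff_getElem] at hreduced
      exact h.2 (hreduced k hk h.1)
    · rw [min_eq_right (by omega), min_eq_right (by omega)] at h
      exact Letter.neg_ne _ h.symm
  refine ⟨ShiftSpace.ofAdmissible w hadmissible, ?_⟩
  have hprefix : inversePrefix (ShiftSpace.ofAdmissible w hadmissible) g.norm = L := by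
    refine List.ext_getElem (length_inversePrefix _ _) fun k _ hk => ?_
    simp only [inversePrefix, List.getElem_map, List.getElem_range, ShiftSpace.ofAdmissible,
      w, Letter.neg_neg]
    rw [min_eq_left (by omega), List.getD_eq_getElem _ _ hk]
  rw [rayVertex, hprefix, hL, FreeGroup.mk_toWord]

/-- The number of vertices at distance `n` from the base point. -/
def sphereCard (d : ℕ) : ℕ → ℕ
  | 0 => 1
  | n + 1 => 2 * d * (2 * d - 1) ^ n

lemma sphereCard_pos (hd : 2 ≤ d) (n : ℕ) : 0 < sphereCard d n := by
  have : 0 < 2 * d - 1 := by omega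
  cases n <;> simp only [sphereCard] <;> positivity

lemma IsParryMeasure.measure_cylinder_eq_inv (hd : 2 ≤ d) {P : Measure (ShiftSpace d)}
    (hP : IsParryMeasure P) (ω : ShiftSpace d) (n : ℕ) :
    P (cylinder ω n) = (sphereCard d n : ℝ≥0∞)⁻¹ := by
  have := hP.isProbabilityMeasure
  cases n with
  | zero => simp [cylinder_zero, sphereCard]
  | succ n =>
    rw [hP.measure_cylinder, ofReal_parryMass hd, sphereCard, Nat.cast_mul (2 * d), Nat.cast_pow,
      ENNReal.mul_inv, ENNReal.inv_pow]
    · exact Or.inr (ENNReal.pow_ne_top (ENNReal.natCast_ne_top _))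
    · exact Or.inl (ENNReal.natCast_ne_top _)

lemma IsParryMeasure.measure_rayVertex_eq (hd : 2 ≤ d) {P : Measure (ShiftSpace d)}
    (hP : IsParryMeasure P) (g : FreeGroup (Fin d)) :
    P {ω | rayVertex g.norm ω = g} = (sphereCard d g.norm : ℝ≥0∞)⁻¹ := by
  obtain ⟨η, hη⟩ := exists_rayVertex_eq hd g
  have hcylinder : {ω | rayVertex g.norm ω = g} = cylinder η g.norm := by
    ext ω
    nth_rw 2 [← hη]
    exact mk_inversePrefix_eq_iff ω η g.norm
  rw [hcylinder, hP.measure_cylinder_eq_inv hd]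

/-- The image on the sphere of radius `n` of a measure `P` on the shift space; for the Parry
measure this is the uniform probability on the sphere. -/
def sphereMeasure (P : Measure (ShiftSpace d)) (n : ℕ) : Measure (Compactification d) :=
  P.map fun ω => ofVertex (rayVertex n ω)

instance (P : Measure (ShiftSpace d)) [IsProbabilityMeasure P] (n : ℕ) :
    IsProbabilityMeasure (sphereMeasure P n) :=
  Measure.isProbabilityMeasure_map (continuous_ofVertex_rayVertex n).measurable.aemeasurable

lemma sphereMeasure_apply (P : Measure (ShiftSpace d)) (n : ℕ)
    {S : Set (Compactification d)} (hS : MeasurableSet S) :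
    sphereMeasure P n S
      = ∑' g : FreeGroup (Fin d), P {ω | rayVertex n ω = g} * Measure.dirac (ofVertex g) S := by
  rw [sphereMeasure, Measure.map_apply (continuous_ofVertex_rayVertex n).measurable hS]
  have hpreimage : (fun ω : ShiftSpace d => ofVertex (rayVertex n ω)) ⁻¹' S
      = ⋃ g : FreeGroup (Fin d), {ω | rayVertex n ω = g ∧ ofVertex g ∈ S} := by
    ext ω
    simp
  have hfiber : ∀ g : FreeGroup (Fin d), MeasurableSet {ω | rayVertex n ω = g} := fun g =>
    ((isOpen_discrete {g}).preimage (continuous_rayVertex n)).measurableSet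
  rw [hpreimage, measure_iUnion]
  · refine tsum_congr fun g => ?_
    rw [Measure.dirac_apply' _ hS]
    by_cases h : ofVertex g ∈ S <;> simp [h]
  · exact fun g h hgh => Set.disjoint_left.2 fun ω hg hh => hgh (hg.1.symm.trans hh.1)
  · intro g
    by_cases h : ofVertex g ∈ S <;> simp [h, hfiber g]

lemma sum_dirac_eq_sum_sphereMeasure (hd : 2 ≤ d) {P : Measure (ShiftSpace d)}
    (hP : IsParryMeasure P) (c : ℕ → ℝ≥0∞) :
    Measure.sum (fun g : FreeGroup (Fin d) => c g.norm • Measure.dirac (ofVertex g))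
      = Measure.sum fun n => (c n * sphereCard d n) • sphereMeasure P n := by
  ext S hS
  rw [Measure.sum_apply _ hS, Measure.sum_apply _ hS]
  simp only [Measure.smul_apply, smul_eq_mul, sphereMeasure_apply P _ hS, ← ENNReal.tsum_mul_left]
  rw [ENNReal.tsum_comm]
  refine tsum_congr fun g => ?_
  rw [tsum_eq_single g.norm]
  · have hcard : (sphereCard d g.norm : ℝ≥0∞) ≠ 0 := by exact_mod_cast (sphereCard_pos hd _).ne'
    rw [hP.measure_rayVertex_eq hd, ← mul_assoc, mul_assoc (c _),
      ENNReal.mul_inv_cancel hcard (ENNReal.natCast_ne_top _), mul_one]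
  · intro n hn
    have hempty : {ω : ShiftSpace d | rayVertex n ω = g} = ∅ :=
      eq_empty_of_forall_notMem fun ω hω => hn (by rw [← norm_rayVertex n ω, hω])
    simp [hempty]

lemma tendsto_integral_sphereMeasure {P : Measure (ShiftSpace d)} [IsProbabilityMeasure P]
    (f : Compactification d →ᵇ ℝ) :
    Tendsto (fun n => ∫ x, f x ∂sphereMeasure P n) atTop
      (𝓝 (∫ x, f x ∂((P.map toBoundary).map ofBoundary))) := by
  have hray : Continuous fun ω : ShiftSpace d => ofBoundary (toBoundary ω) :=
    (isEmbedding_ofBoundary d).continuous.comp (continuous_toBoundary d)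
  have hsphere : ∀ n, ∫ x, f x ∂sphereMeasure P n = ∫ ω, f (ofVertex (rayVertex n ω)) ∂P :=
    fun n => integral_map (continuous_ofVertex_rayVertex n).measurable.aemeasurable
      f.continuous.aestronglyMeasurable
  have hboundary : ∫ x, f x ∂((P.map toBoundary).map ofBoundary)
      = ∫ ω, f (ofBoundary (toBoundary ω)) ∂P := by
    rw [Measure.map_map (isEmbedding_ofBoundary d).continuous.measurable
      (continuous_toBoundary d).measurable]
    exact integral_map hray.measurable.aemeasurable f.continuous.aestronglyMeasurable
  simp only [hsphere, hboundary]
  refine tendsto_integral_of_dominated_convergence (fun _ => ‖f‖)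
    (fun n => (f.continuous.comp (continuous_ofVertex_rayVertex n)).aestronglyMeasurable)
    (integrable_const _) (fun n => ae_of_all _ fun ω => f.norm_coe_le_norm _)
    (ae_of_all _ fun ω => ?_)
  exact (f.continuous.tendsto _).comp (tendsto_ofVertex (ofBoundary (toBoundary ω)))

lemma tsum_norm_eq (hd : 2 ≤ d) (c : ℕ → ℝ≥0∞) :
    ∑' g : FreeGroup (Fin d), c g.norm = ∑' n, c n * sphereCard d n := by
  obtain ⟨P, hP⟩ := exists_isParryMeasure hd
  have := hP.isProbabilityMeasure
  simpa [Measure.sum_apply] using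
    congrArg (fun m => m univ) (sum_dirac_eq_sum_sphereMeasure hd hP c)

lemma orbitMeasure_eq (hd : 2 ≤ d) {P : Measure (ShiftSpace d)} (hP : IsParryMeasure P)
    {w : ℕ → ℝ} (hw : ∀ n, 0 ≤ w n) :
    orbitMeasure d w = (∑' n, ENNReal.ofReal (w n * sphereCard d n))⁻¹ •
      Measure.sum fun n => ENNReal.ofReal (w n * sphereCard d n) • sphereMeasure P n := by
  simp only [ENNReal.ofReal_mul (hw _), ENNReal.ofReal_natCast]
  rw [orbitMeasure, tsum_norm_eq hd fun n => ENNReal.ofReal (w n),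
    sum_dirac_eq_sum_sphereMeasure hd hP fun n => ENNReal.ofReal (w n)]

lemma tendstoWeakly_orbitMeasure (hd : 2 ≤ d) {P : Measure (ShiftSpace d)}
    (hP : IsParryMeasure P) {w : ℕ → ℕ → ℝ} {w' : ℕ → ℝ} (hw : ∀ k n, 0 ≤ w k n)
    (hsum : ∀ k, Summable fun n => w k n * sphereCard d n)
    (hmass : Tendsto (fun k => ∑' n, w k n * sphereCard d n) atTop atTop)
    (hlim : ∀ n, Tendsto (w · n) atTop (𝓝 (w' n))) :
    TendstoWeakly (fun k => orbitMeasure d (w k)) (P.map toBoundary) := by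
  have := hP.isProbabilityMeasure
  intro f
  have hnonneg : ∀ k n, 0 ≤ w k n * sphereCard d n := fun k n =>
    mul_nonneg (hw k n) (Nat.cast_nonneg _)
  have hintegral : ∀ k, ∫ x, f x ∂orbitMeasure d (w k)
      = ∑' n, w k n * sphereCard d n / (∑' i, w k i * sphereCard d i)
        * ∫ x, f x ∂sphereMeasure P n := fun k => by
    have := isFiniteMeasure_sum_smul (sphereMeasure P) (hsum k)
    rw [orbitMeasure_eq hd hP (hw k)]
    exact integral_normalized_sum_smul (hnonneg k) (hsum k) (f.integrable _)
  simp only [hintegral]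
  refine tendsto_tsum_mul_of_tendsto_cofinite ?_
    (fun k n => div_nonneg (hnonneg k n) (tsum_nonneg (hnonneg k))) ?_
    fun n => ((hlim n).mul_const _).div_atTop hmass
  · rw [Nat.cofinite_eq_atTop]
    exact tendsto_integral_sphereMeasure f
  · filter_upwards [hmass.eventually_gt_atTop 0] with k hk
    have h := (hsum k).hasSum.div_const (∑' i, w k i * sphereCard d i)
    rwa [div_self hk.ne'] at h

lemma three_le_two_mul_sub_one (hd : 2 ≤ d) : (3 : ℝ) ≤ 2 * d - 1 := by
  have : (2 : ℝ) ≤ d := by exact_mod_cast hd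
  linarith

lemma natCast_sphereCard_succ (hd : 2 ≤ d) (n : ℕ) :
    (sphereCard d (n + 1) : ℝ) = 2 * d * (2 * d - 1) ^ n := by
  rw [sphereCard, Nat.cast_mul, Nat.cast_pow, natCast_two_mul_sub_one hd]
  push_cast
  ring

lemma exp_neg_mul_sphereCard_succ (hd : 2 ≤ d) (s : ℝ) (n : ℕ) :
    Real.exp (-s * (n + 1 : ℕ)) * sphereCard d (n + 1)
      = 2 * d * Real.exp (-s) * ((2 * d - 1) * Real.exp (-s)) ^ n := by
  have hexp : Real.exp (-s * (n + 1 : ℕ)) = Real.exp (-s) ^ (n + 1) := by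
    rw [← Real.exp_nat_mul, mul_comm]
  rw [natCast_sphereCard_succ hd, hexp, mul_pow]
  ring

lemma two_mul_sub_one_mul_exp_neg_lt_one_iff (hd : 2 ≤ d) (s : ℝ) :
    (2 * d - 1) * Real.exp (-s) < 1 ↔ Real.log (2 * d - 1) < s := by
  rw [Real.exp_neg, ← div_eq_mul_inv, div_lt_one (Real.exp_pos s),
    Real.log_lt_iff_lt_exp (by linarith [three_le_two_mul_sub_one hd])]

lemma two_mul_sub_one_mul_exp_neg_nonneg (hd : 2 ≤ d) (s : ℝ) :
    0 ≤ (2 * d - 1) * Real.exp (-s) :=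
  mul_nonneg (by linarith [three_le_two_mul_sub_one hd]) (Real.exp_pos _).le

lemma summable_exp_mul_sphereCard_iff (hd : 2 ≤ d) (s : ℝ) :
    (Summable fun n : ℕ => Real.exp (-s * n) * sphereCard d n) ↔ Real.log (2 * d - 1) < s := by
  rw [← summable_nat_add_iff 1]
  simp only [exp_neg_mul_sphereCard_succ hd]
  rw [summable_mul_left_iff (by positivity), summable_geometric_iff_norm_lt_one, Real.norm_eq_abs,
    abs_of_nonneg (two_mul_sub_one_mul_exp_neg_nonneg hd s),
    two_mul_sub_one_mul_exp_neg_lt_one_iff hd]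

theorem criticalExponent_eq (hd : 2 ≤ d) : criticalExponent d = Real.log (2 * d - 1) := by
  have hsummable : {s : ℝ | Summable fun g : FreeGroup (Fin d) => Real.exp (-s * g.norm)}
      = Ioi (Real.log (2 * d - 1)) := by
    ext s
    rw [mem_ofPred_eq, mem_Ioi, ← summable_exp_mul_sphereCard_iff hd,
      summable_iff_tsum_ofReal_ne_top fun _ => (Real.exp_pos _).le,
      summable_iff_tsum_ofReal_ne_top fun n => by positivity,
      tsum_norm_eq hd fun n => ENNReal.ofReal (Real.exp (-s * n))]
    simp only [ENNReal.ofReal_mul (Real.exp_pos _).le, ENNReal.ofReal_natCast]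
  rw [criticalExponent, hsummable, csInf_Ioi]

lemma tsum_exp_mul_sphereCard (hd : 2 ≤ d) {s : ℝ} (hs : Real.log (2 * d - 1) < s) :
    ∑' n : ℕ, Real.exp (-s * n) * sphereCard d n
      = 1 + 2 * d * Real.exp (-s) * (1 - (2 * d - 1) * Real.exp (-s))⁻¹ := by
  rw [((summable_exp_mul_sphereCard_iff hd s).2 hs).tsum_eq_zero_add]
  simp only [exp_neg_mul_sphereCard_succ hd]
  rw [tsum_mul_left, tsum_geometric_of_lt_one (two_mul_sub_one_mul_exp_neg_nonneg hd s)
    ((two_mul_sub_one_mul_exp_neg_lt_one_iff hd s).2 hs)]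
  simp [sphereCard]

lemma tendsto_tsum_exp_mul_sphereCard (hd : 2 ≤ d) :
    Tendsto (fun s : ℝ => ∑' n : ℕ, Real.exp (-s * n) * sphereCard d n)
      (𝓝[>] Real.log (2 * d - 1)) atTop := by
  set δ := Real.log (2 * d - 1)
  have hpos : (0 : ℝ) < 2 * d - 1 := by linarith [three_le_two_mul_sub_one hd]
  have hexp : Tendsto (fun s : ℝ => Real.exp (-s)) (𝓝[>] δ) (𝓝 (Real.exp (-δ))) :=
    (Real.continuous_exp.comp continuous_neg).continuousWithinAt
  have hratio : Tendsto (fun s : ℝ => 1 - (2 * d - 1) * Real.exp (-s)) (𝓝[>] δ) (𝓝[>] 0) := by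
    refine tendsto_nhdsWithin_iff.2 ⟨?_, ?_⟩
    · have h := (hexp.const_mul (2 * d - 1 : ℝ)).const_sub 1
      rwa [Real.exp_neg, Real.exp_log hpos, mul_inv_cancel₀ hpos.ne', sub_self] at h
    · filter_upwards [self_mem_nhdsWithin] with s hs
      exact sub_pos.2 ((two_mul_sub_one_mul_exp_neg_lt_one_iff hd s).2 hs)
  have hlim : Tendsto (fun s : ℝ =>
      1 + 2 * d * Real.exp (-s) * (1 - (2 * d - 1) * Real.exp (-s))⁻¹) (𝓝[>] δ) atTop :=
    tendsto_atTop_add_const_left _ _ <|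
      (hexp.const_mul (2 * d : ℝ)).pos_mul_atTop (by positivity)
        (tendsto_inv_nhdsGT_zero.comp hratio)
  refine hlim.congr' ?_
  filter_upwards [self_mem_nhdsWithin] with s hs
  exact (tsum_exp_mul_sphereCard hd hs).symm

theorem tendstoWeakly_poincareSeries (hd : 2 ≤ d) {P : Measure (ShiftSpace d)}
    (hP : IsParryMeasure P) {s : ℕ → ℝ} (hs : ∀ k, criticalExponent d < s k)
    (hlim : Tendsto s atTop (𝓝 (criticalExponent d))) :
    TendstoWeakly (fun k => orbitMeasure d fun r => Real.exp (-s k * r)) (P.map toBoundary) := by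
  rw [criticalExponent_eq hd] at hs hlim
  refine tendstoWeakly_orbitMeasure hd hP (w := fun k n => Real.exp (-s k * n))
    (fun k n => (Real.exp_pos _).le)
    (fun k => (summable_exp_mul_sphereCard_iff hd _).2 (hs k)) ?_
    fun n => (Real.continuous_exp.tendsto _).comp (hlim.neg.mul_const _)
  exact (tendsto_tsum_exp_mul_sphereCard hd).comp
    (tendsto_nhdsWithin_iff.2 ⟨hlim, Eventually.of_forall hs⟩)

/-- The weight of each vertex of the sphere of radius `i` in `sphereAverage d n`. -/
def ballWeight (d n i : ℕ) : ℝ := if i ≤ n then 1 / (2 * d - 1) ^ i else 0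

lemma ballWeight_nonneg (hd : 2 ≤ d) (n i : ℕ) : 0 ≤ ballWeight d n i := by
  have : (0 : ℝ) ≤ 2 * d - 1 := by linarith [three_le_two_mul_sub_one hd]
  rw [ballWeight]
  split_ifs <;> positivity

lemma ballWeight_succ_mul_sphereCard (hd : 2 ≤ d) {n i : ℕ} (hi : i < n) :
    ballWeight d n (i + 1) * sphereCard d (i + 1) = 2 * d / (2 * d - 1) := by
  have hne : (2 * d - 1 : ℝ) ≠ 0 := by linarith [three_le_two_mul_sub_one hd]
  have := pow_ne_zero i hne
  rw [ballWeight, if_pos (Nat.succ_le_of_lt hi), natCast_sphereCard_succ hd, pow_succ]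
  field_simp

lemma hasSum_ballWeight_mul_sphereCard (hd : 2 ≤ d) (n : ℕ) :
    HasSum (fun i => ballWeight d n i * sphereCard d i) (1 + 2 * d * n / (2 * d - 1)) := by
  have hball : ∑ i ∈ Finset.range (n + 1), ballWeight d n i * sphereCard d i
      = 1 + 2 * d * n / (2 * d - 1) := by
    rw [Finset.sum_range_succ', Finset.sum_congr rfl fun i hi =>
      ballWeight_succ_mul_sphereCard hd (Finset.mem_range.1 hi), Finset.sum_const,
      Finset.card_range, nsmul_eq_mul]
    simp only [ballWeight, sphereCard, Nat.zero_le, if_true, pow_zero, Nat.cast_one]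
    ring
  rw [← hball]
  refine hasSum_sum_of_ne_finset_zero fun i hi => ?_
  rw [Finset.mem_range] at hi
  rw [ballWeight, if_neg (by omega), zero_mul]

lemma sphereAverage_eq_orbitMeasure (hd : 2 ≤ d) (n : ℕ) :
    sphereAverage d n = orbitMeasure d (ballWeight d n) := by
  have hweight : ∀ i, ENNReal.ofReal (ballWeight d n i)
      = if i ≤ n then ENNReal.ofReal (1 / (2 * d - 1) ^ i) else 0 := fun i => by
    rw [ballWeight, apply_ite ENNReal.ofReal, ENNReal.ofReal_zero]
  have hmass : ∑' g : FreeGroup (Fin d), ENNReal.ofReal (ballWeight d n g.norm)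
      = ENNReal.ofReal (1 + 2 * d * n / (2 * d - 1)) := by
    rw [tsum_norm_eq hd fun i => ENNReal.ofReal (ballWeight d n i),
      ← (hasSum_ballWeight_mul_sphereCard hd n).tsum_eq, ENNReal.ofReal_tsum_of_nonneg
        (fun i => mul_nonneg (ballWeight_nonneg hd n i) (Nat.cast_nonneg _))
        (hasSum_ballWeight_mul_sphereCard hd n).summable]
    simp only [ENNReal.ofReal_mul (ballWeight_nonneg hd n _), ENNReal.ofReal_natCast]
  rw [sphereAverage, orbitMeasure, hmass]
  simp only [hweight]

theorem tendstoWeakly_sphereAverage (hd : 2 ≤ d) {P : Measure (ShiftSpace d)}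
    (hP : IsParryMeasure P) : TendstoWeakly (sphereAverage d) (P.map toBoundary) := by
  have hpos : (0 : ℝ) < 2 * d - 1 := by linarith [three_le_two_mul_sub_one hd]
  rw [funext fun n => sphereAverage_eq_orbitMeasure hd n]
  refine tendstoWeakly_orbitMeasure hd hP (w' := fun i => 1 / (2 * d - 1) ^ i)
    (ballWeight_nonneg hd) (fun n => (hasSum_ballWeight_mul_sphereCard hd n).summable) ?_
    fun i => ?_
  · simp only [(hasSum_ballWeight_mul_sphereCard hd _).tsum_eq]
    exact tendsto_atTop_add_const_left _ _ <|
      (tendsto_natCast_atTop_atTop.const_mul_atTop (by positivity)).atTop_div_const hpos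
  · refine tendsto_const_nhds.congr' ?_
    filter_upwards [eventually_ge_atTop i] with n hn
    rw [ballWeight, if_pos hn]

lemma TendstoWeakly.unique {m : ℕ → Measure (Compactification d)} {μ μ' : Measure (Boundary d)}
    [IsProbabilityMeasure μ] [IsProbabilityMeasure μ'] (h : TendstoWeakly m μ)
    (h' : TendstoWeakly m μ') : μ = μ' := by
  have : CompactSpace (Boundary d) := (isHomeomorph_toBoundary d).homeomorph.compactSpace
  have hembedding : IsClosedEmbedding (ofBoundary (d := d)) :=
    (isEmbedding_ofBoundary d).continuous.isClosedEmbedding (isEmbedding_ofBoundary d).injective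
  have hmeasurable := hembedding.continuous.measurable
  have := Measure.isProbabilityMeasure_map (μ := μ) hmeasurable.aemeasurable
  have := Measure.isProbabilityMeasure_map (μ := μ') hmeasurable.aemeasurable
  have hmap : μ.map ofBoundary = μ'.map ofBoundary :=
    ext_of_forall_integral_eq_of_IsFiniteMeasure fun f => tendsto_nhds_unique (h f) (h' f)
  simpa only [hembedding.measurableEmbedding.comap_map] using
    congrArg (Measure.comap ofBoundary) hmap

theorem isPattersonSullivan_iff (hd : 2 ≤ d) {P : Measure (ShiftSpace d)}
    (hP : IsParryMeasure P) (μ : Measure (Boundary d)) :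
    IsPattersonSullivan μ ↔ μ = P.map toBoundary := by
  have := hP.isProbabilityMeasure
  have hprobability : IsProbabilityMeasure (P.map toBoundary) :=
    Measure.isProbabilityMeasure_map (continuous_toBoundary d).measurable.aemeasurable
  constructor
  · rintro ⟨_, s, hs, hlim, hweak⟩
    exact hweak.unique (tendstoWeakly_poincareSeries hd hP hs hlim)
  · rintro rfl
    obtain ⟨s, -, hs, hlim⟩ := exists_seq_strictAnti_tendsto (criticalExponent d)
    exact ⟨hprobability, s, hs, hlim, tendstoWeakly_poincareSeries hd hP hs hlim⟩

lemma map_toBoundary_injective :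
    Function.Injective (Measure.map (toBoundary (d := d))) := fun P Q h => by
  have hembedding : MeasurableEmbedding (toBoundary (d := d)) :=
    (isHomeomorph_toBoundary d).homeomorph.measurableEmbedding
  simpa only [hembedding.comap_map] using congrArg (Measure.comap toBoundary) h

end PattersonSullivan

/-! ### Entropy of shift-invariant measures -/

section ShiftEntropy

variable {d : ℕ}

/-- The first letter of an admissible word: the labelling of the generating partition of the shift
into cylinders of rank one. -/
def firstLetter (ω : ShiftSpace d) : Letter d := ω.1 0

lemma measurable_firstLetter : Measurable (firstLetter (d := d)) := measurable_coord 0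

lemma itinerary_firstLetter (n : ℕ) (ω : ShiftSpace d) (i : Fin n) :
    itinerary shift firstLetter n ω i = ω.1 i := by
  simp [itinerary, firstLetter, shift_iterate_apply]

lemma itinerary_preimage_eq_cylinder (n : ℕ) (ω : ShiftSpace d) :
    itinerary shift firstLetter n ⁻¹' {itinerary shift firstLetter n ω} = cylinder ω n := by
  ext η
  simp only [mem_preimage, mem_singleton_iff, funext_iff, itinerary_firstLetter]
  exact ⟨fun h k hk => h ⟨k, hk⟩, fun h i => h i i.2⟩

lemma borel_eq_generateFrom_itinerarySets (d : ℕ) :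
    borel (ShiftSpace d) = MeasurableSpace.generateFrom (itinerarySets shift firstLetter) := by
  refine le_antisymm ?_ ?_
  · rw [(isTopologicalBasis_cylinder d).borel_eq_generateFrom]
    refine MeasurableSpace.generateFrom_mono ?_
    rintro _ ⟨ω, n, rfl⟩
    exact ⟨n, _, (itinerary_preimage_eq_cylinder n ω).symm⟩
  · refine MeasurableSpace.generateFrom_le ?_
    rintro _ ⟨n, S, rfl⟩
    exact measurable_itinerary continuous_shift.measurable measurable_firstLetter n
      S.toFinite.measurableSet

lemma cylinder_succ (ω : ShiftSpace d) (n : ℕ) : cylinder ω (n + 1)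
    = shift ⁻¹' cylinder (shift ω) n ∩ firstLetter ⁻¹' {firstLetter ω} := by
  ext η
  constructor
  · exact fun h => ⟨fun k hk => h (k + 1) (by omega), h 0 (by omega)⟩
  · rintro ⟨hshift, hzero⟩ (_ | k) hk
    · exact hzero
    · exact hshift k (by omega)

/-- The word formed by the letters number `2, …, n + 1`. -/
def futureWord (n : ℕ) (ω : ShiftSpace d) : Fin n → Letter d :=
  itinerary shift firstLetter n (shift ω)

lemma measurable_futureWord (n : ℕ) : Measurable (futureWord (d := d) n) :=
  (measurable_itinerary continuous_shift.measurable measurable_firstLetter n).comp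
    continuous_shift.measurable

/-- The letters that may precede the word `w` in an admissible word. -/
def predecessors {n : ℕ} (w : Fin (n + 1) → Letter d) : Finset (Letter d) :=
  Finset.univ.filter (· ≠ (w 0).neg)

lemma mem_predecessors_futureWord {n : ℕ} {a : Letter d} {ω : ShiftSpace d} :
    a ∈ predecessors (futureWord (n + 1) ω) ↔ firstLetter (shift ω) ≠ a.neg := by
  rw [predecessors, Finset.mem_filter_univ, ne_neg_comm]
  rfl

lemma firstLetter_mem_predecessors (n : ℕ) (ω : ShiftSpace d) :
    firstLetter ω ∈ predecessors (futureWord (n + 1) ω) :=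
  mem_predecessors_futureWord.2 (ω.ne_neg 0)

lemma card_predecessors {n : ℕ} (w : Fin (n + 1) → Letter d) :
    (predecessors w).card = 2 * d - 1 :=
  card_filter_ne _

variable {m : Measure (ShiftSpace d)} [IsProbabilityMeasure m]

lemma ksEntropy_shift_le_condEntropy (hm : MeasurePreserving shift m m) (n : ℕ) :
    ksEntropy m shift ≤ condEntropy m firstLetter (futureWord n) :=
  ksEntropy_le_condEntropy_itinerary hm measurable_firstLetter
    (borel_eq_generateFrom_itinerarySets d) n

theorem ksEntropy_shift_le (hd : 2 ≤ d) (hm : MeasurePreserving shift m m) :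
    ksEntropy m shift ≤ (Real.log (2 * d - 1) : EReal) := by
  refine (ksEntropy_shift_le_condEntropy hm 1).trans (EReal.coe_le_coe_iff.2 ?_)
  rw [← natCast_two_mul_sub_one hd]
  exact condEntropy_le_log measurable_firstLetter (measurable_futureWord 1)
    (firstLetter_mem_predecessors 0) card_predecessors

lemma log_le_condEntropy_futureWord (hd : 2 ≤ d) (hm : MeasurePreserving shift m m)
    (h : (Real.log (2 * d - 1) : EReal) ≤ ksEntropy m shift) (n : ℕ) :
    Real.log (2 * d - 1 : ℕ) ≤ condEntropy m firstLetter (futureWord n) := by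
  rw [natCast_two_mul_sub_one hd]
  exact EReal.coe_le_coe_iff.1 (h.trans (ksEntropy_shift_le_condEntropy hm n))

lemma measureReal_firstLetter_eq (hd : 2 ≤ d) (hm : MeasurePreserving shift m m)
    (h : (Real.log (2 * d - 1) : EReal) ≤ ksEntropy m shift) (a : Letter d) :
    m.real (firstLetter ⁻¹' {a}) = (1 - m.real (firstLetter ⁻¹' {a.neg})) / (2 * d - 1) := by
  have hmeas := measurable_firstLetter (measurableSet_singleton a.neg)
  have hset : {ω | a ∈ predecessors (futureWord 1 ω)}
      = shift ⁻¹' (firstLetter ⁻¹' {a.neg})ᶜ := by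
    ext ω
    exact mem_predecessors_futureWord
  rw [measureReal_fiber_eq_of_log_le_condEntropy measurable_firstLetter (measurable_futureWord 1)
    (firstLetter_mem_predecessors 0) card_predecessors (log_le_condEntropy_futureWord hd hm h 1),
    hset, hm.measureReal_preimage hmeas.compl.nullMeasurableSet, probReal_compl_eq_one_sub hmeas,
    natCast_two_mul_sub_one hd]

lemma measureReal_firstLetter (hd : 2 ≤ d) (hm : MeasurePreserving shift m m)
    (h : (Real.log (2 * d - 1) : EReal) ≤ ksEntropy m shift) (a : Letter d) :
    m.real (firstLetter ⁻¹' {a}) = 1 / (2 * d) := by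
  have hthree := three_le_two_mul_sub_one hd
  have hN : (2 * d - 1 : ℝ) ≠ 0 := by linarith
  have ha := measureReal_firstLetter_eq hd hm h a
  have hneg := measureReal_firstLetter_eq hd hm h a.neg
  rw [Letter.neg_neg, eq_div_iff hN] at hneg
  rw [eq_div_iff hN] at ha
  have hsymm : m.real (firstLetter ⁻¹' {a.neg}) = m.real (firstLetter ⁻¹' {a}) :=
    mul_left_cancel₀ (by linarith : (2 * d - 2 : ℝ) ≠ 0) (by linear_combination hneg - ha)
  rw [eq_div_iff (by linarith)]
  linear_combination ha - hsymm

lemma measureReal_cylinder_add_two (hd : 2 ≤ d) (hm : MeasurePreserving shift m m)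
    (h : (Real.log (2 * d - 1) : EReal) ≤ ksEntropy m shift) (ω : ShiftSpace d) (n : ℕ) :
    m.real (cylinder ω (n + 2)) = m.real (cylinder (shift ω) (n + 1)) / (2 * d - 1) := by
  have hfiber : futureWord (n + 1) ⁻¹' {futureWord (n + 1) ω}
      = shift ⁻¹' cylinder (shift ω) (n + 1) := by
    rw [← itinerary_preimage_eq_cylinder]
    rfl
  have heq := measureReal_inter_fiber_eq_of_log_le_condEntropy measurable_firstLetter
    (measurable_futureWord (n + 1)) (firstLetter_mem_predecessors n) card_predecessors
    (log_le_condEntropy_futureWord hd hm h (n + 1)) (firstLetter_mem_predecessors n ω)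
  rwa [hfiber, ← cylinder_succ, hm.measureReal_preimage
    (measurableSet_cylinder _ _).nullMeasurableSet, natCast_two_mul_sub_one hd] at heq

theorem isParryMeasure_of_le_ksEntropy (hd : 2 ≤ d) (hm : MeasurePreserving shift m m)
    (h : (Real.log (2 * d - 1) : EReal) ≤ ksEntropy m shift) : IsParryMeasure m := by
  refine ⟨inferInstance, fun ω n => ?_⟩
  rw [← ofReal_measureReal]
  congr 1
  induction n generalizing ω with
  | zero =>
    rw [cylinder_succ, cylinder_zero, preimage_univ, univ_inter, measureReal_firstLetter hd hm h,
      pow_zero, mul_one]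
  | succ n ih => rw [measureReal_cylinder_add_two hd hm h, ih, div_div, mul_assoc, ← pow_succ]

end ShiftEntropy

/-! ### Topological entropy of the Bowen–Series map -/

section CoverEntropy

variable {d : ℕ}

lemma circleToDisc_coding_eq_wordAct (hd : 2 ≤ d) (ω : ShiftSpace d) (n : ℕ) :
    circleToDisc (coding hd ω)
      = wordAct hd (inversePrefix ω n) (circleToDisc (coding hd (shift^[n] ω))) := by
  induction n with
  | zero => simp [inversePrefix]
  | succ n ih =>
    rw [ih, inversePrefix_succ_eq_append, wordAct_append, Function.iterate_succ_apply',
      wordAct_cons, wordAct_nil, circleToDisc_coding, circleToDisc_coding, discCoding_eq_piece,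
      shift_iterate_apply, zero_add]

lemma exists_dist_coding_lt_of_mem_cylinder (hd : 2 ≤ d) {ε : ℝ} (hε : 0 < ε) :
    ∃ k, ∀ ω η : ShiftSpace d, ω ∈ cylinder η k → dist (coding hd ω) (coding hd η) < ε := by
  obtain ⟨k, hk⟩ := exists_length_dist_wordAct_lt hd hε
  refine ⟨k + 1, fun ω η hωη => ?_⟩
  have hprefix : inversePrefix ω k = inversePrefix η k :=
    (inversePrefix_eq_iff ω η k).2 fun i hi => hωη i (by omega)
  have hmem (ζ : ShiftSpace d) (hζ : ζ.1 k = η.1 k) :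
      circleToDisc (coding hd (shift^[k] ζ)) ∈ wordDomain (inversePrefix η k) := by
    refine halfDisc_subset_wordDomain hd η k ((circleToDisc_mem_halfDisc hd).2 ?_)
    have harc := coding_mem_arc hd (shift^[k] ζ)
    rwa [shift_iterate_apply, zero_add, hζ] at harc
  change dist (circleToDisc (coding hd ω)) (circleToDisc (coding hd η)) < ε
  rw [circleToDisc_coding_eq_wordAct hd ω k, circleToDisc_coding_eq_wordAct hd η k, hprefix]
  exact hk _ (isReduced_inversePrefix η k) (length_inversePrefix η k).ge _
    (hmem ω (hωη k k.lt_succ_self)) _ (hmem η rfl)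

lemma IsParryMeasure.measureReal_itinerary_fiber (hd : 2 ≤ d) {P : Measure (ShiftSpace d)}
    (hP : IsParryMeasure P) (n : ℕ) (ω : ShiftSpace d) :
    P.real (itinerary shift firstLetter n ⁻¹' {itinerary shift firstLetter n ω})
      = (sphereCard d n : ℝ)⁻¹ := by
  rw [itinerary_preimage_eq_cylinder, measureReal_def, hP.measure_cylinder_eq_inv hd,
    ENNReal.toReal_inv, ENNReal.toReal_natCast]

lemma ncard_range_itinerary_firstLetter (hd : 2 ≤ d) (n : ℕ) :
    (range (itinerary (shift (d := d)) firstLetter n)).ncard = sphereCard d n := by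
  obtain ⟨P, hP⟩ := exists_isParryMeasure hd
  have := hP.isProbabilityMeasure
  exact_mod_cast ncard_range_eq
    (measurable_itinerary continuous_shift.measurable measurable_firstLetter n)
    (hP.measureReal_itinerary_fiber hd n)

lemma sphereCard_le (hd : 2 ≤ d) (n : ℕ) : sphereCard d n ≤ 2 * (2 * d - 1) ^ n := by
  cases n with
  | zero => simp [sphereCard]
  | succ n =>
    rw [pow_succ', sphereCard, ← mul_assoc]
    exact Nat.mul_le_mul_right _ (by omega)

lemma coverEntropy_bowenSeries_le (hd : 2 ≤ d) :
    Dynamics.coverEntropy (bowenSeries hd) univ ≤ ENNReal.log (2 * d - 1 : ℕ) := by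
  refine coverEntropy_le_log fun ε hε => ?_
  obtain ⟨k, hk⟩ := exists_dist_coding_lt_of_mem_cylinder hd hε
  refine ⟨(2 * (2 * d - 1) ^ k : ℕ), ENNReal.natCast_ne_top _, fun n => ?_⟩
  have hcover := coverMincard_le_ncard_range_itinerary (surjective_coding hd)
    (semiconj_coding hd) firstLetter (ε := ε) (k := k) (fun ω η h => hk ω η ?_) n
  · rw [ncard_range_itinerary_firstLetter hd] at hcover
    refine (ENat.toENNReal_mono hcover).trans ?_
    rw [ENat.toENNReal_coe]
    have hcard := sphereCard_le hd (n + k)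
    rw [pow_add, mul_left_comm, mul_comm] at hcard
    exact_mod_cast hcard
  · rw [← itinerary_preimage_eq_cylinder]
    exact h

lemma bowenSeries_mem_arc_neg (hd : 2 ≤ d) {a b : Letter d} (hab : a ≠ b) {x : Circle}
    (ha : x ∈ arc a) (hb : x ∈ arc b) : bowenSeries hd x ∈ arc a.neg := by
  have hdist := dist_center_eq_of_ne hd hab ((mem_arc_iff hd _ _).1 ha) ((mem_arc_iff hd _ _).1 hb)
  rw [← circleToDisc_mem_halfDisc hd, circleToDisc_bowenSeries hd ha]
  exact piece_mem_halfDisc hd hdist.ge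

lemma eq_of_mem_arc_of_bowenSeries_mem_arc (hd : 2 ≤ d) {a b c : Letter d} (hac : c ≠ a.neg)
    (hbc : c ≠ b.neg) {x : Circle} (ha : x ∈ arc a) (hb : x ∈ arc b)
    (hc : bowenSeries hd x ∈ arc c) : a = b := by
  by_contra hab
  have hna := bowenSeries_mem_arc_neg hd hab ha hb
  have hnb := bowenSeries_mem_arc_neg hd (Ne.symm hab) hb ha
  rw [mem_arc_iff hd] at hna hnb hc
  exact hab (Letter.neg_injective (eq_of_dist_center_le_three hd hac hbc hc hna hnb))

lemma eq_of_bowenSeries_eq (hd : 2 ≤ d) {a : Letter d} {x y : Circle} (hx : x ∈ arc a)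
    (hy : y ∈ arc a) (h : bowenSeries hd x = bowenSeries hd y) : x = y := by
  have hpiece := congrArg circleToDisc h
  rw [circleToDisc_bowenSeries hd hx, circleToDisc_bowenSeries hd hy] at hpiece
  exact circleToDisc_injective ((piece hd a).injective hpiece)

lemma eventually_le_dist_of_mem_arc (hd : 2 ≤ d) {a b c : Letter d} (hab : a ≠ b)
    (hac : c ≠ a.neg) (hbc : c ≠ b.neg) : ∀ᶠ ε : ℝ in 𝓝[>] 0, ∀ x ∈ arc a, ∀ y ∈ arc b,
      bowenSeries hd x ∈ arc c → bowenSeries hd y ∈ arc c → ε ≤ dist x y := by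
  have hclosed (a : Letter d) : IsClosed (arc a ∩ bowenSeries hd ⁻¹' arc c) :=
    (isClosed_arc hd a).inter ((isClosed_arc hd c).preimage (continuous_bowenSeries hd))
  obtain ⟨δ, hδ, hlt⟩ := Metric.exists_pos_forall_lt_edist (hclosed a).isCompact (hclosed b)
    (disjoint_left.2 fun x ha hb =>
      hab (eq_of_mem_arc_of_bowenSeries_mem_arc hd hac hbc ha.1 hb.1 ha.2))
  filter_upwards [Ioc_mem_nhdsGT (NNReal.coe_pos.2 hδ)] with ε hε x hx y hy hxc hyc
  have hedist := hlt x ⟨hx, hxc⟩ y ⟨hy, hyc⟩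
  rw [edist_nndist] at hedist
  exact hε.2.trans (by exact_mod_cast hedist.le)

lemma exists_pos_le_dist_of_bowenSeries_eq (hd : 2 ≤ d) : ∃ ε > 0, ∀ x y : Circle, x ≠ y →
    bowenSeries hd x = bowenSeries hd y → ε ≤ dist x y := by
  have hall : ∀ᶠ ε : ℝ in 𝓝[>] 0, ∀ a b c : Letter d, a ≠ b → c ≠ a.neg → c ≠ b.neg →
      ∀ x ∈ arc a, ∀ y ∈ arc b, bowenSeries hd x ∈ arc c → bowenSeries hd y ∈ arc c →
        ε ≤ dist x y := by
    simp only [eventually_all]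
    exact fun a b c => eventually_le_dist_of_mem_arc hd
  obtain ⟨ε, hdist, hε⟩ := (hall.and self_mem_nhdsWithin).exists
  refine ⟨ε, hε, fun x y hxy h => ?_⟩
  have hx := mem_arc_ccwLabel hd x
  have hy := mem_arc_ccwLabel hd y
  have hc := mem_arc_ccwLabel hd (bowenSeries hd x)
  refine hdist _ _ _ (fun hl => hxy ?_) (ccwLabel_bowenSeries_ne hd x)
    (h ▸ ccwLabel_bowenSeries_ne hd y) x hx y hy hc (h ▸ hc)
  exact eq_of_bowenSeries_eq hd hx (hl ▸ hy) h

lemma exists_finset_bowenSeries_eq (hd : 2 ≤ d) (y : Circle) :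
    ∃ t : Finset Circle, t.card = 2 * d - 1 ∧ ∀ x ∈ t, bowenSeries hd x = y := by
  let ω (a : {a : Letter d // a ≠ (ccwLabel hd y).neg}) : ShiftSpace d :=
    ShiftSpace.cons a.1 (ccwItinerary hd y) (ne_neg_comm.1 a.2)
  let F a := coding hd (ω a)
  have hF a : bowenSeries hd (F a) = y :=
    (semiconj_coding hd (ω a)).symm.trans (coding_ccwItinerary hd y)
  have hmem a : F a ∈ arc a.1 := coding_mem_arc hd (ω a)
  have hinj : Function.Injective F := fun a b hab =>
    Subtype.ext <| eq_of_mem_arc_of_bowenSeries_mem_arc hd (ne_neg_comm.1 a.2) (ne_neg_comm.1 b.2)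
      (hmem a) (hab ▸ hmem b) (hF a ▸ mem_arc_ccwLabel hd y)
  refine ⟨Finset.univ.map ⟨F, hinj⟩, ?_, ?_⟩
  · rw [Finset.card_map, Finset.card_univ, Fintype.card_subtype, card_filter_ne]
  · intro x hx
    obtain ⟨a, -, rfl⟩ := Finset.mem_map.1 hx
    exact hF a

theorem coverEntropy_bowenSeries (hd : 2 ≤ d) :
    Dynamics.coverEntropy (bowenSeries hd) univ = (Real.log (2 * d - 1) : EReal) := by
  obtain ⟨ε, hε, hsep⟩ := exists_pos_le_dist_of_bowenSeries_eq hd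
  rw [← natCast_two_mul_sub_one hd, ← ennrealLog_natCast (by omega)]
  exact (coverEntropy_bowenSeries_le hd).antisymm
    (log_le_coverEntropy hε hsep (exists_finset_bowenSeries_eq hd))

end CoverEntropy

/-! ### The measure of maximal entropy -/

section MaximalEntropy

variable {d : ℕ}

lemma arcEnd_mem_arc (hd : 2 ≤ d) (a : Letter d) : arcEnd a ∈ arc a :=
  closure_minimal sdiff_subset (isClosed_arc hd a) (arcEnd_mem_closure hd a)

lemma dist_arcEnd_center (hd : 2 ≤ d) (a : Letter d) :
    dist (arcEnd a : ℂ) (center a) = geodesicRadius d := by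
  have hne : a ≠ ccwLabel hd (arcEnd a) := fun h =>
    ne_arcEnd_ccwLabel hd (arcEnd a) (congrArg arcEnd h)
  exact dist_center_eq_of_ne hd hne ((mem_arc_iff hd _ _).1 (arcEnd_mem_arc hd a))
    ((mem_arc_iff hd _ _).1 (mem_arc_ccwLabel hd _))

lemma arcEnd_injective (hd : 2 ≤ d) : Function.Injective (arcEnd (d := d)) := by
  intro a b h
  rw [← Letter.neg_neg a, ← Letter.neg_neg b, arcEnd_neg hd, arcEnd_neg hd, inv_inj] at h
  exact Letter.neg_injective (arcStart_injective hd h)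

/-- The words coding the final point of the arc of their first letter. A word `ω` whose shift orbit
avoids this set is the itinerary `ccwItinerary` of the point it codes. -/
def terminalWords (hd : 2 ≤ d) : Set (ShiftSpace d) :=
  {ω | coding hd ω = arcEnd (ω.1 0)}

lemma coding_shift_of_mem_terminalWords (hd : 2 ≤ d) {ω : ShiftSpace d}
    (h : ω ∈ terminalWords hd) : coding hd (shift ω) = arcStart (ω.1 0).neg := by
  have hω : coding hd ω = arcEnd (ω.1 0) := h
  have hdist : dist (coding hd ω : ℂ) (center (ω.1 0)) = geodesicRadius d :=
    hω ▸ dist_arcEnd_center hd _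
  rw [semiconj_coding hd ω, bowenSeries_of_dist_eq hd hdist, hω, ← inv_inj, inv_inv,
    ← arcEnd_neg hd, Letter.neg_neg]

lemma coding_shift_eq_arcEnd (hd : 2 ≤ d) {ω : ShiftSpace d} (h : ω ∈ terminalWords hd) :
    coding hd (shift ω) = arcEnd ((shift ω).1 0) := by
  have hcoding := coding_shift_of_mem_terminalWords hd h
  have hne : (shift ω).1 0 ≠ (ω.1 0).neg := ω.ne_neg 0
  have hshift := (mem_arc_iff hd _ _).1 (coding_mem_arc hd (shift ω))
  have hneg := (mem_arc_iff hd _ _).1 (arcStart_mem_arc hd (ω.1 0).neg)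
  rw [← hcoding] at hneg
  refine (eq_arcStart_or_arcEnd hd _ (dist_center_eq_of_ne hd hne hshift hneg)).resolve_left ?_
  exact fun hstart => hne (arcStart_injective hd (hstart.symm.trans hcoding))

lemma injOn_firstLetter_terminalWords (hd : 2 ≤ d) : InjOn firstLetter (terminalWords hd) := by
  intro ω hω η hη h
  refine Subtype.ext (funext fun n => ?_)
  induction n generalizing ω η with
  | zero => exact h
  | succ _ ih =>
    have hω' := coding_shift_eq_arcEnd hd hω
    have hη' := coding_shift_eq_arcEnd hd hη
    refine ih hω' hη' (arcEnd_injective hd (hω'.symm.trans (.trans ?_ hη')))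
    rw [coding_shift_of_mem_terminalWords hd hω, coding_shift_of_mem_terminalWords hd hη]
    exact congrArg (arcStart ∘ Letter.neg) h

lemma ccwItinerary_coding_of_forall_notMem (hd : 2 ≤ d) {ω : ShiftSpace d}
    (h : ∀ n, shift^[n] ω ∉ terminalWords hd) : ccwItinerary hd (coding hd ω) = ω := by
  refine Subtype.ext (funext fun n => ?_)
  rw [ccwItinerary_apply, ← (semiconj_coding hd).iterate_right n ω, ← zero_add n,
    ← shift_iterate_apply, zero_add]
  exact (ccwLabel_eq_iff hd _ _).2 ⟨coding_mem_arc hd _, h n⟩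

variable {P : Measure (ShiftSpace d)}

lemma IsParryMeasure.measure_terminalWords (hd : 2 ≤ d) (hP : IsParryMeasure P) :
    P (terminalWords hd) = 0 := by
  have hfin : (terminalWords hd).Finite :=
    .of_finite_image (toFinite _) (injOn_firstLetter_terminalWords hd)
  rw [← biUnion_of_singleton (terminalWords hd), measure_biUnion_null_iff hfin.countable]
  exact fun ω _ => hP.measure_singleton hd ω

lemma IsParryMeasure.ccwItinerary_comp_coding_ae_eq (hd : 2 ≤ d) (hP : IsParryMeasure P) :
    ccwItinerary hd ∘ coding hd =ᵐ[P] id := by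
  have hnot : ∀ᵐ ω ∂P, ω ∉ terminalWords hd :=
    measure_eq_zero_iff_ae_notMem.1 (hP.measure_terminalWords hd)
  have hall : ∀ᵐ ω ∂P, ∀ n, shift^[n] ω ∉ terminalWords hd := ae_all_iff.2 fun n =>
    ((hP.measurePreserving_shift hd).iterate n).quasiMeasurePreserving.ae hnot
  filter_upwards [hall] with ω hω using ccwItinerary_coding_of_forall_notMem hd hω

lemma IsParryMeasure.measurePreserving_ccwItinerary (hd : 2 ≤ d) (hP : IsParryMeasure P) :
    MeasurePreserving (ccwItinerary hd) (P.map (coding hd)) P := by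
  have hs := measurable_ccwItinerary hd
  refine ⟨hs, ?_⟩
  rw [Measure.map_map hs (continuous_coding hd).measurable,
    Measure.map_congr (hP.ccwItinerary_comp_coding_ae_eq hd), Measure.map_id]

lemma IsParryMeasure.partitionEntropy_itinerary (hd : 2 ≤ d) (hP : IsParryMeasure P) (n : ℕ) :
    partitionEntropy P (itinerary shift firstLetter n) = Real.log (sphereCard d n) := by
  have := hP.isProbabilityMeasure
  exact partitionEntropy_eq_log
    (measurable_itinerary continuous_shift.measurable measurable_firstLetter n)
    (hP.measureReal_itinerary_fiber hd n)

lemma pow_le_sphereCard (hd : 2 ≤ d) (n : ℕ) : (2 * d - 1) ^ n ≤ sphereCard d n := by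
  cases n with
  | zero => rfl
  | succ n =>
    rw [sphereCard, pow_succ']
    gcongr
    omega

theorem IsParryMeasure.ksEntropy_shift (hd : 2 ≤ d) (hP : IsParryMeasure P) :
    ksEntropy P shift = (Real.log (2 * d - 1) : EReal) := by
  have := hP.isProbabilityMeasure
  refine (ksEntropy_shift_le hd (hP.measurePreserving_shift hd)).antisymm <|
    le_trans ?_ (entropyOfPartition_le_ksEntropy P shift measurable_firstLetter)
  refine le_limsup_of_frequently_le (Eventually.frequently ?_)
  filter_upwards [eventually_gt_atTop 0] with n hn
  have hn' : (0 : ℝ) < n := Nat.cast_pos.2 hn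
  rw [EReal.coe_le_coe_iff, hP.partitionEntropy_itinerary hd, le_div_iff₀ hn', mul_comm,
    ← Real.log_pow]
  have := three_le_two_mul_sub_one hd
  refine Real.log_le_log (by positivity) ?_
  rw [← natCast_two_mul_sub_one hd]
  exact_mod_cast pow_le_sphereCard hd n

theorem IsParryMeasure.isMeasureOfMaximalEntropy (hd : 2 ≤ d) (hP : IsParryMeasure P) :
    IsMeasureOfMaximalEntropy (bowenSeries hd) (P.map (coding hd)) := by
  have := hP.isProbabilityMeasure
  have hA := (continuous_bowenSeries hd).measurable
  have hc : MeasurePreserving (coding hd) P (P.map (coding hd)) :=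
    (continuous_coding hd).measurable.measurePreserving P
  refine ⟨Measure.isProbabilityMeasure_map hc.aemeasurable,
    hc.of_semiconj (hP.measurePreserving_shift hd) (semiconj_coding hd) hA, ?_⟩
  rw [coverEntropy_bowenSeries, ← hP.ksEntropy_shift hd]
  exact (ksEntropy_le_of_semiconj hc (semiconj_coding hd) hA).antisymm
    (ksEntropy_le_of_semiconj (hP.measurePreserving_ccwItinerary hd)
      (fun x => (shift_ccwItinerary hd x).symm) continuous_shift.measurable)

theorem IsParryMeasure.eq_map_coding (hd : 2 ≤ d) (hP : IsParryMeasure P) {ν : Measure Circle}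
    (hν : IsMeasureOfMaximalEntropy (bowenSeries hd) ν) : ν = P.map (coding hd) := by
  have := hν.isProbabilityMeasure
  have hc := (continuous_coding hd).measurable
  have hs : MeasurePreserving (ccwItinerary hd) ν (ν.map (ccwItinerary hd)) :=
    (measurable_ccwItinerary hd).measurePreserving ν
  have hprob := Measure.isProbabilityMeasure_map hs.aemeasurable
  have hshift := hs.of_semiconj hν.measurePreserving (fun x => (shift_ccwItinerary hd x).symm)
    continuous_shift.measurable
  have hmap : (ν.map (ccwItinerary hd)).map (coding hd) = ν := by
    rw [Measure.map_map hc hs.measurable, Function.LeftInverse.id (coding_ccwItinerary hd),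
      Measure.map_id]
  have hent : (Real.log (2 * d - 1) : EReal) ≤ ksEntropy (ν.map (ccwItinerary hd)) shift := by
    rw [← coverEntropy_bowenSeries hd, ← hν.entropy_eq]
    exact ksEntropy_le_of_semiconj ⟨hc, hmap⟩ (semiconj_coding hd)
      (continuous_bowenSeries hd).measurable
  rw [← hmap, (isParryMeasure_of_le_ksEntropy hd hshift hent).unique hP]

end MaximalEntropy

end BowenSeries

/-- The measure of maximal entropy of the Bowen–Series map `A_{G_d}` is the push-forward of the
Patterson–Sullivan measure (equivalently, of the Parry measure) under the Cannon–Thurston map. -/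
theorem mainTheorem3 (d : ℕ) (hd : 2 ≤ d) :
    (∃! ν : Measure Circle, IsMeasureOfMaximalEntropy (BowenSeries.bowenSeries hd) ν) ∧
    (∃! μ : Measure (BowenSeries.Boundary d), BowenSeries.IsPattersonSullivan μ) ∧
    (∃! ψ : BowenSeries.Boundary d → Circle, BowenSeries.IsCannonThurston hd ψ) ∧
    IsHomeomorph (BowenSeries.toBoundary (d := d)) ∧
    ∀ (ν : Measure Circle) (μ : Measure (BowenSeries.Boundary d))
      (ψ : BowenSeries.Boundary d → Circle),
      IsMeasureOfMaximalEntropy (BowenSeries.bowenSeries hd) ν →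
      BowenSeries.IsPattersonSullivan μ →
      BowenSeries.IsCannonThurston hd ψ →
        ν = μ.map ψ ∧
        BowenSeries.TendstoWeakly (BowenSeries.sphereAverage d) μ ∧
        (∀ P : Measure (BowenSeries.ShiftSpace d),
          BowenSeries.IsParryMeasure P ↔ P.map BowenSeries.toBoundary = μ) ∧
        (∀ ψ' : BowenSeries.ShiftSpace d → Circle,
          BowenSeries.IsSymbolicCoding hd ψ' ↔ ψ' = ψ ∘ BowenSeries.toBoundary) := by
  obtain ⟨P, hP⟩ := BowenSeries.exists_isParryMeasure hd
  have hPS := BowenSeries.isPattersonSullivan_iff hd hP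
  refine ⟨⟨P.map (BowenSeries.coding hd), hP.isMeasureOfMaximalEntropy hd,
      fun _ hν => hP.eq_map_coding hd hν⟩,
    ⟨P.map BowenSeries.toBoundary, (hPS _).2 rfl, fun μ hμ => (hPS μ).1 hμ⟩,
    BowenSeries.existsUnique_isCannonThurston hd, BowenSeries.isHomeomorph_toBoundary d,
    fun ν μ ψ hν hμ hψ => ?_⟩
  obtain rfl := (hPS μ).1 hμ
  have hcoding := (BowenSeries.isCannonThurston_iff hd ψ).1 hψ
  have hψm := hψ.continuous.measurable
  refine ⟨?_, BowenSeries.tendstoWeakly_sphereAverage hd hP,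
    fun Q => ⟨fun hQ => by rw [hQ.unique hP], fun hQ => ?_⟩, fun ψ' => ?_⟩
  · rw [Measure.map_map hψm (BowenSeries.continuous_toBoundary d).measurable, hcoding]
    exact hP.eq_map_coding hd hν
  · rwa [BowenSeries.map_toBoundary_injective hQ]
  · rw [hcoding, BowenSeries.isSymbolicCoding_iff]
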